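/- **Setting.** Let $Y\in\mathbb R^m$, let $X$ be an $m\times k$ matrix, $\beta\in\mathbb R^k$, $A\in\mathbb R^{m\times n}$, $K\in\mathbb R^{n\times n}$ invertible, $h\in\mathbb R^n$, $\mu\in\mathbb R$, $\sigma,\sigma_\epsilon>0$. For $(p,a,b)$ with either ($a,b>0$, $p\in\mathbb R$), or ($a=0$, $b>0$, $p<0$), or ($a>0$, $b=0$, $p>0$), let $\mathrm{GIG}(p,a,b)$ be the law on $(0,\infty)$ with density proportional to $x^{p-1}\exp\{-\tfrac12(ax+b/x)\}$. Consider the linear latent non-Gaussian model in non-centered form $$Y\mid M,V\sim N\bigl(X\beta+AK^{-1}(M-\mu h),\ \sigma_\epsilon^2I\bigr),\qquad M\mid V\sim N\bigl(\mu V,\ \mathrm{diag}(\sigma^2V)\bigr),\qquad V_i\overset{\text{ind.}}{\sim}\mathrm{GIG}(p,a,b),\quad i=1,\dots,n,$$ and let $\pi=\pi(\cdot\mid Y)$ be the posterior law of $V$ on $(0,\infty)^n$. Put $B=AK^{-1}$, $\rho=\sigma^2/\sigma_\epsilon^2$, $\bar Q(V)=\rho B^\top B+\mathrm{diag}(V)^{-1}$,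 $\bar m=\rho B^\top(Y-X\beta+\mu Bh)+\mu\mathbf 1$ and $\tilde a=a+\mu^2/\sigma^2$. One step of the marginal Gibbs chain $(V^{(t)})_{t\ge0}$ on $(0,\infty)^n$ goes from $V$ to $\tilde V$ by drawing $$M\mid V\sim N\bigl(\bar Q(V)^{-1}\bar m,\ \sigma^2\bar Q(V)^{-1}\bigr),\qquad \tilde V_i\mid M_i\sim\mathrm{GIG}\bigl(p-\tfrac12,\ \tilde a,\ b+(M_i/\sigma)^2\bigr)\ \text{ independently in } i;$$ let $P$ be its transition kernel. The chain is called *geometrically ergodic* if $P$ is a Markov kernel, $\pi$ is an invariant probability measure of $P$, and there is $\gamma\in(0,1)$ such that for every probability measure $\nu\ll\pi$ with $\int(d\nu/d\pi)^2\,d\pi<\infty$ there is a constant $C=C(\nu)>0$ with $$\|\nu P^t-\pi\|_{\mathrm{TV}}\le C\,\gamma^t\qquad\text{for all } t\in\{0,1,2,\dots\}.$$ *Null-smallness condition:* with $r=\dim\mathrm{Null}(A)$, either $r=0$, or, for $U_A\in\mathbb R^{n\times r}$ whose columns form an orthonormal basis of $\mathrm{Null}(A)$, $G=U_A^\top K^\top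 KU_A$ and $z=U_A^\top K^\top\mathbf 1$, $$\frac{|\mu|}{\sqrt{\sigma^2a+\mu^2}}\sqrt{z^\top G^{-1}z}<1$$ (this does not depend on the choice of $U_A$). **Proposition 2.7.** We have $\tilde a=0$ if and only if $a=\mu=0$. The chain $(V^{(t)})_{t\ge0}$ is geometrically ergodic in each of the following regimes. (I) $a=\mu=0$, unconditionally. In this regime necessarily $p<0$ and $b>0$, and $\tilde V_i\mid M_i$ is inverse gamma with shape $-p+\tfrac12$ and scale $\tfrac b2+\tfrac{M_i^2}{2\sigma^2}$. (II) $a=0$, $b>0$, $p<0$, $\mu\ne0$, under the null-smallness condition. In this regime $\tilde a=\mu^2/\sigma^2>0$, the null-smallness condition reduces to "$r=0$ or $\sqrt{z^\top G^{-1}z}<1$", and $\tilde V_i\mid M_i\sim\mathrm{GIG}(p-\tfrac12,\tilde a,b+(M_i/\sigma)^2)$. (III) $a>0$, $b=0$, $p>0$, under the null-smallness condition. In this regime $\tilde a>0$ and $\tilde V_i\mid M_i\sim\mathrm{GIG}(p-\tfrac12,\tilde a,(M_i/\sigma)^2)$. -/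

import Mathlib

open MeasureTheory ProbabilityTheory
open scoped ENNReal NNReal Matrix

noncomputable section

/-! ### Geometric ergodicity -/

/-- Total variation distance `sup_A |μ(A) - ν(A)|` over measurable sets `A`. -/
def tvDist {α : Type*} [MeasurableSpace α] (μ ν : Measure α) : ℝ :=
  ⨆ A : {A : Set α // MeasurableSet A}, |μ.real A.1 - ν.real A.1|

/-- The probability measures of `𝓛₂(π)`: absolutely continuous with respect to `π`, with
square-integrable Radon-Nikodym derivative. -/
structure IsL2Start {α : Type*} [MeasurableSpace α] (π ν : Measure α) : Prop where
  isProbabilityMeasure : IsProbabilityMeasure ν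
  absolutelyContinuous : ν ≪ π
  lintegral_sq_lt_top : ∫⁻ x, (ν.rnDeriv π x) ^ 2 ∂π < ∞

/-- The Markov chain with transition kernel `P` and stationary distribution `π` is geometrically
ergodic: one rate `γ ∈ (0,1)` serves all initial laws `ν ∈ 𝓛₂(π)`, the constant may depend on the
initial law. Here `ν.bind (P ^ t)` is the law `ν Pᵗ` of the chain at time `t`. -/
structure GeometricallyErgodic {α : Type*} [MeasurableSpace α] (P : Kernel α α) (π : Measure α) :
    Prop where
  isMarkovKernel : IsMarkovKernel P
  isProbabilityMeasure : IsProbabilityMeasure π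
  invariant : P.Invariant π
  rate : ∃ γ : ℝ, 0 < γ ∧ γ < 1 ∧ ∀ ν : Measure α, IsL2Start π ν →
    ∃ C : ℝ, 0 < C ∧ ∀ t : ℕ, tvDist (ν.bind ⇑(P ^ t)) π ≤ C * γ ^ t

/-! ### Generalized inverse Gaussian, inverse gamma and multivariate normal densities -/

/-- The parameter space of the GIG family. -/
def GIGAdmissible (p a b : ℝ) : Prop :=
  (0 < a ∧ 0 < b) ∨ (a = 0 ∧ 0 < b ∧ p < 0) ∨ (0 < a ∧ b = 0 ∧ 0 < p)

/-- The unnormalized `GIG(p, a, b)` density. -/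
def gigWeight (p a b x : ℝ) : ℝ := x ^ (p - 1) * Real.exp (-(1 / 2) * (a * x + b / x))

/-- The `GIG(p, a, b)` density, normalized by its integral over `(0, ∞)`. -/
def gigPDF (p a b x : ℝ) : ℝ≥0∞ :=
  if 0 < x then
    ENNReal.ofReal (gigWeight p a b x) / ∫⁻ y in Set.Ioi (0 : ℝ), ENNReal.ofReal (gigWeight p a b y)
  else 0

/-- The inverse gamma density with shape `α` and scale `β`. -/
def invGammaPDF (α β x : ℝ) : ℝ≥0∞ :=
  if 0 < x then
    ENNReal.ofReal (β ^ α / Real.Gamma α * x ^ (-(α + 1)) * Real.exp (-β / x))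
  else 0

/-- The density of the normal distribution on `ℝⁿ` with mean `η` and covariance matrix `S`
(positive definite). -/
def mvNormalPDFReal {n : ℕ} (η : Fin n → ℝ) (S : Matrix (Fin n) (Fin n) ℝ) (x : Fin n → ℝ) : ℝ :=
  (Real.sqrt ((2 * Real.pi) ^ n * S.det))⁻¹ *
    Real.exp (-(1 / 2) * ((x - η) ⬝ᵥ (S⁻¹ *ᵥ (x - η))))

/-! ### The positive orthant -/

/-- The state space `(0, ∞)ⁿ` of the mixing variables. -/
abbrev PosOrthant (n : ℕ) : Type := {V : Fin n → ℝ // ∀ i, 0 < V i}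

/-- Lebesgue measure on the positive orthant. -/
def orthantVolume (n : ℕ) : Measure (PosOrthant n) :=
  (volume : Measure (Fin n → ℝ)).comap Subtype.val

theorem measurableSet_posOrthant (n : ℕ) : MeasurableSet {V : Fin n → ℝ | ∀ i, 0 < V i} := by
  have : {V : Fin n → ℝ | ∀ i, 0 < V i} = ⋂ i, {V : Fin n → ℝ | 0 < V i} := by
    ext V; simp
  rw [this]
  exact MeasurableSet.iInter fun i => measurableSet_lt measurable_const (measurable_pi_apply i)

instance sigmaFinite_orthantVolume (n : ℕ) : SigmaFinite (orthantVolume n) := by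
  refine ⟨⟨⟨fun k => Subtype.val ⁻¹' spanningSets (volume : Measure (Fin n → ℝ)) k,
    fun _ => Set.mem_univ _, fun k => ?_, ?_⟩⟩⟩
  · refine ((MeasurableEmbedding.subtype_coe (measurableSet_posOrthant n)).comap_apply _ _).trans_lt ?_
    exact (measure_mono (Set.image_preimage_subset _ _)).trans_lt (measure_spanningSets_lt_top _ k)
  · rw [← Set.preimage_iUnion, iUnion_spanningSets, Set.preimage_univ]

/-! ### The model -/

/-- The data of a linear latent non-Gaussian model with `m` observations, latent dimension `n` and
`k` regression coefficients:
`Y | W, V ~ N(X β + A W, σε² I)`, `K W | V ~ N(μ V - μ h, diag(σ² V))`, `Vᵢ ~ GIG(p, a, b)`. -/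
structure LLnGM (m n k : ℕ) where
  Y : Fin m → ℝ
  X : Matrix (Fin m) (Fin k) ℝ
  β : Fin k → ℝ
  A : Matrix (Fin m) (Fin n) ℝ
  K : Matrix (Fin n) (Fin n) ℝ
  h : Fin n → ℝ
  μ : ℝ
  σ : ℝ
  σε : ℝ
  p : ℝ
  a : ℝ
  b : ℝ

namespace LLnGM

variable {m n k : ℕ} (L : LLnGM m n k)

/-- `B = A K⁻¹`. -/
def B : Matrix (Fin m) (Fin n) ℝ := L.A * L.K⁻¹

/-- `ã = a + μ² / σ²`. -/
def aTilde : ℝ := L.a + L.μ ^ 2 / L.σ ^ 2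

/-- `ρ = σ² / σε²`. -/
def rho : ℝ := L.σ ^ 2 / L.σε ^ 2

/-! #### The posterior law of the mixing variables -/

/-- Density of `Y` given `M` (and `V`) in the non-centered parameterization `M = K W + μ h`:
`Y | M, V ~ N(X β + A K⁻¹ (M - μ h), σε² I)`. -/
def likelihood (M : Fin n → ℝ) : ℝ≥0∞ :=
  ∏ j, gaussianPDF ((L.X *ᵥ L.β + L.B *ᵥ (M - L.μ • L.h)) j) (Real.toNNReal (L.σε ^ 2)) (L.Y j)

/-- Density of `M` given `V`: `M | V ~ N(μ V, diag(σ² V))`. -/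
def latentPrior (V M : Fin n → ℝ) : ℝ≥0∞ :=
  ∏ i, gaussianPDF (L.μ * V i) (Real.toNNReal (L.σ ^ 2 * V i)) (M i)

/-- Density of `V`: independent `GIG(p, a, b)` coordinates. -/
def mixingPrior (V : Fin n → ℝ) : ℝ≥0∞ := ∏ i, gigPDF L.p L.a L.b (V i)

/-- The measure on `(0, ∞)ⁿ` whose density at `V` is the joint density of `(Y, V)`. -/
def unnormalizedPosterior : Measure (PosOrthant n) :=
  (orthantVolume n).withDensity fun V =>
    ∫⁻ M : Fin n → ℝ, L.likelihood M * L.latentPrior V.1 M * L.mixingPrior V.1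

/-- The posterior law `π(V | Y)` of the mixing variables. -/
def posterior : Measure (PosOrthant n) :=
  (L.unnormalizedPosterior Set.univ)⁻¹ • L.unnormalizedPosterior

/-! #### The Gibbs sampler -/

/-- `Q̄(V) = ρ Bᵀ B + D_V⁻¹` with `D_V = diag(V)`. -/
def QBar (V : Fin n → ℝ) : Matrix (Fin n) (Fin n) ℝ :=
  L.rho • (L.Bᵀ * L.B) + Matrix.diagonal fun i => (V i)⁻¹

/-- `m̄ = ρ Bᵀ (Y - X β + μ B h) + μ 1`. -/
def mBar : Fin n → ℝ :=
  L.rho • (L.Bᵀ *ᵥ (L.Y - L.X *ᵥ L.β + L.μ • (L.B *ᵥ L.h))) + L.μ • (1 : Fin n → ℝ)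

/-- The density of `M | V, Y ~ N(Q̄(V)⁻¹ m̄, σ² Q̄(V)⁻¹)`. -/
def latentCondPDF (V M : Fin n → ℝ) : ℝ≥0∞ :=
  ENNReal.ofReal
    (mvNormalPDFReal ((L.QBar V)⁻¹ *ᵥ L.mBar) (L.σ ^ 2 • (L.QBar V)⁻¹) M)

/-- The density of `Vᵢ | Mᵢ = x, Y ~ GIG(p - 1/2, ã, b + (x / σ)²)`. -/
def mixingCondPDF (x v : ℝ) : ℝ≥0∞ :=
  gigPDF (L.p - 1 / 2) L.aTilde (L.b + (x / L.σ) ^ 2) v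

end LLnGM

/-! Measurability of the conditional densities, needed to form the transition kernels. -/

theorem measurable_matrix_det_of_entries {α : Type*} [MeasurableSpace α] {n : ℕ}
    {F : α → Matrix (Fin n) (Fin n) ℝ} (hF : ∀ i j, Measurable fun x => F x i j) :
    Measurable fun x => (F x).det := by
  simp only [Matrix.det_apply]
  exact Finset.measurable_sum _ fun s _ =>
    (Finset.measurable_prod _ fun i _ => hF _ _).const_smul _

theorem measurable_matrix_inv_of_entries {α : Type*} [MeasurableSpace α] {n : ℕ}
    {F : α → Matrix (Fin n) (Fin n) ℝ} (hF : ∀ i j, Measurable fun x => F x i j) (i j : Fin n) :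
    Measurable fun x => (F x)⁻¹ i j := by
  simp only [Matrix.inv_def, Ring.inverse_eq_inv', Matrix.smul_apply, smul_eq_mul,
    Matrix.adjugate_apply]
  refine (measurable_matrix_det_of_entries hF).inv.mul (measurable_matrix_det_of_entries ?_)
  intro i' j'
  simp only [Matrix.updateRow_apply]
  split_ifs
  · exact measurable_const
  · exact hF _ _

theorem measurable_gigWeight (p a : ℝ) :
    Measurable fun q : ℝ × ℝ => gigWeight p a q.1 q.2 := by
  unfold gigWeight
  fun_prop

theorem measurable_gigPDF (p a : ℝ) : Measurable fun q : ℝ × ℝ => gigPDF p a q.1 q.2 := by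
  unfold gigPDF
  refine Measurable.ite (measurableSet_lt measurable_const measurable_snd) ?_ measurable_const
  refine (measurable_gigWeight p a).ennreal_ofReal.div ?_
  exact ((measurable_gigWeight p a).ennreal_ofReal.lintegral_prod_right'
    (ν := volume.restrict (Set.Ioi (0 : ℝ)))).comp measurable_fst

namespace LLnGM

variable {m n k : ℕ} (L : LLnGM m n k)

theorem measurable_latentCondPDF :
    Measurable (Function.uncurry fun (V : PosOrthant n) M => L.latentCondPDF V.1 M) := by
  have hQ : ∀ i j, Measurable fun q : PosOrthant n × (Fin n → ℝ) => L.QBar q.1.1 i j := by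
    intro i j
    simp only [QBar, Matrix.add_apply, Matrix.diagonal_apply]
    refine measurable_const.add ?_
    split_ifs
    · exact ((measurable_pi_apply i).comp (measurable_subtype_coe.comp measurable_fst)).inv
    · exact measurable_const
  have hQi := measurable_matrix_inv_of_entries hQ
  have hS : ∀ i j, Measurable fun q : PosOrthant n × (Fin n → ℝ) =>
      (L.σ ^ 2 • (L.QBar q.1.1)⁻¹) i j := fun i j => (hQi i j).const_mul _
  have hSi := measurable_matrix_inv_of_entries hS
  have hx : ∀ i, Measurable fun q : PosOrthant n × (Fin n → ℝ) =>
      (q.2 - (L.QBar q.1.1)⁻¹ *ᵥ L.mBar) i := by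
    intro i
    simp only [Pi.sub_apply, Matrix.mulVec, dotProduct]
    exact ((measurable_pi_apply i).comp measurable_snd).sub
      (Finset.measurable_sum _ fun j _ => (hQi i j).mul_const _)
  refine Measurable.ennreal_ofReal ?_
  unfold mvNormalPDFReal
  refine Measurable.mul ?_ ?_
  · exact ((measurable_matrix_det_of_entries hS).const_mul _).sqrt.inv
  · refine (Measurable.const_mul ?_ _).exp
    simp only [Matrix.mulVec, dotProduct]
    exact Finset.measurable_sum _ fun i _ => (hx i).mul
      (Finset.measurable_sum _ fun j _ => (hSi i j).mul (hx j))

theorem measurable_mixingCondPDF :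
    Measurable (Function.uncurry fun (M : Fin n → ℝ) (V : PosOrthant n) =>
      ∏ i, L.mixingCondPDF (M i) (V.1 i)) := by
  refine Finset.measurable_prod _ fun i _ => ?_
  refine (measurable_gigPDF (L.p - 1 / 2) L.aTilde).comp (Measurable.prodMk ?_ ?_)
  · exact ((((measurable_pi_apply i).comp measurable_fst).div_const _).pow_const 2).const_add _
  · exact (measurable_pi_apply i).comp (measurable_subtype_coe.comp measurable_snd)

/-- The update `M | V, Y`. -/
def latentKernel : Kernel (PosOrthant n) (Fin n → ℝ) where
  toFun V := volume.withDensity fun M => L.latentCondPDF V.1 M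
  measurable' := by
    refine Measure.measurable_of_measurable_coe _ fun s hs => ?_
    simp_rw [withDensity_apply _ hs]
    exact L.measurable_latentCondPDF.lintegral_prod_right' (ν := volume.restrict s)

/-- The update `V | M, Y`, with independent coordinates. -/
def mixingKernel : Kernel (Fin n → ℝ) (PosOrthant n) where
  toFun M := (orthantVolume n).withDensity fun V => ∏ i, L.mixingCondPDF (M i) (V.1 i)
  measurable' := by
    refine Measure.measurable_of_measurable_coe _ fun s hs => ?_
    simp_rw [withDensity_apply _ hs]
    exact L.measurable_mixingCondPDF.lintegral_prod_right' (ν := (orthantVolume n).restrict s)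

/-- The transition kernel of the marginal chain `(V⁽ᵗ⁾)` of the Gibbs sampler: draw `M` given `V`,
then the new `V` given `M`. -/
def gibbsKernel : Kernel (PosOrthant n) (PosOrthant n) := L.mixingKernel ∘ₖ L.latentKernel

/-! #### The null-smallness condition -/

/-- `dim Null(A)`. -/
def nullity : ℕ := Module.finrank ℝ (LinearMap.ker L.A.mulVecLin)

/-- The columns of `U` form an orthonormal basis of `Null(A)`. -/
def IsNullBasis (U : Matrix (Fin n) (Fin L.nullity) ℝ) : Prop :=
  Uᵀ * U = 1 ∧ LinearMap.range U.mulVecLin = LinearMap.ker L.A.mulVecLin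

/-- `zᵀ G⁻¹ z` with `G = Uᵀ Kᵀ K U` and `z = Uᵀ Kᵀ 1`. -/
def nullForm (U : Matrix (Fin n) (Fin L.nullity) ℝ) : ℝ :=
  let G : Matrix (Fin L.nullity) (Fin L.nullity) ℝ := Uᵀ * L.Kᵀ * L.K * U
  let z : Fin L.nullity → ℝ := (Uᵀ * L.Kᵀ) *ᵥ (1 : Fin n → ℝ)
  z ⬝ᵥ (G⁻¹ *ᵥ z)

/-- The null-smallness condition; `nullForm` takes the same value at all orthonormal bases. -/
def NullSmallness : Prop :=
  L.nullity = 0 ∨ ∃ U : Matrix (Fin n) (Fin L.nullity) ℝ, L.IsNullBasis U ∧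
    |L.μ| / Real.sqrt (L.σ ^ 2 * L.a + L.μ ^ 2) * Real.sqrt (L.nullForm U) < 1

end LLnGM

end

noncomputable section

/-! ### Harris' theorem -/

section Harris

variable {α : Type*} [MeasurableSpace α]

/-! The argument is Harris' theorem with the Lyapunov function `∑ Vᵢ ^ s + ∑ Vᵢ ^ (-t)`. Its
sublevel sets lie in boxes `[r₁, r₂]ⁿ` with `r₁ > 0`, on which the density of `M` given `V` is
bounded below for `M ∈ [1,2]ⁿ`. This gives the minorization. Invariance of the posterior holds
because the joint density of `(Y, M, V)` is proportional to the `M`-update as a function of `M` and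
to the `V`-update as a function of `V`. What remains is a drift for one positive and one negative
moment.

Positive moment, `ã > 0`, `s = 2`. The three-term recurrence of the GIG integrals gives `E[Ṽᵢ² | M]
≤ (1+ε)/ã · (b + Mᵢ²/σ²) + C`. The conditional variance of `Mᵢ` is at most `σ² Vᵢ`, of lower order.
The squared conditional mean is at most `μ² |e|² |V|² + O(|V|)`, where `e` is the projection of `1`
onto `Null(B) = K Null(A)`. Since `|e|² = zᵀ G⁻¹ z`, the drift coefficient tends to `μ² |e|² / (σ² a
+ μ²)` as `ε → 0`, and null-smallness says exactly that this limit is below `1`.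

Positive moment, `a = μ = 0`. Now `m̄` lies in the range of `Bᵀ`, so the conditional mean is bounded
whatever `V` is. For small `s` the coefficient is `Γ(1/2+s) Γ(1/2-p-s) / (Γ(1/2) Γ(1/2-p))`, less
than `1` by strict log-convexity of `Γ` and `p < 0`.

Negative moment. If `b > 0`, then `E[1/Ṽᵢ | M]` is bounded. If `b = 0`, a small power `t` is used.
The GIG moment is at most `l (Mᵢ²/(2σ²))^(-t) + C` with `l` just above `Γ(1/2-t)/Γ(1/2-2t)`. A
nonzero mean only decreases `E |Mᵢ|^(-2t)`, and the variance is comparable to `Vᵢ` near `0`. The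
coefficient is then close to `Γ(1/2-t)² / (Γ(1/2-2t) Γ(1/2)) < 1`.

Carrying lemmas: `geometricallyErgodic_of_drift_minorization`, `exists_minorization`,
`bind_unnormalizedPosterior`, `exists_sq_drift`, `exists_rpow_drift_of_aTilde_eq_zero` and
`exists_rpow_neg_drift`. -/

theorem integrable_of_unit_interval {μ : Measure α} [IsFiniteMeasure μ] {φ : α → ℝ}
    (hφ : Measurable φ) (h0 : ∀ x, 0 ≤ φ x) (h1 : ∀ x, φ x ≤ 1) : Integrable φ μ :=
  Integrable.of_bound hφ.aestronglyMeasurable 1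
    (.of_forall fun x => by rw [Real.norm_eq_abs, abs_of_nonneg (h0 x)]; exact h1 x)

/-- Two finite measures of the same mass `q` integrate a function of bounded weighted oscillation
to values that are close. -/
theorem abs_integral_sub_integral_le {μ ν : Measure α} [IsFiniteMeasure μ] [IsFiniteMeasure ν]
    {q c β : ℝ} (hμq : μ.real Set.univ = q) (hνq : ν.real Set.univ = q)
    {φ U : α → ℝ} (hφ : Measurable φ) (h0 : ∀ x, 0 ≤ φ x) (h1 : ∀ x, φ x ≤ 1)
    (hUμ : Integrable U μ) (hUν : Integrable U ν)
    (hosc : ∀ x y, |φ x - φ y| ≤ c * (2 + β * U x + β * U y)) :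
    |∫ x, φ x ∂μ - ∫ x, φ x ∂ν| ≤ c * (2 * q + β * ∫ x, U x ∂μ + β * ∫ x, U x ∂ν) := by
  have hq0 : 0 ≤ q := hμq ▸ measureReal_nonneg
  rcases hq0.eq_or_lt with hq | hq
  · have hμ0 : μ = 0 := by
      rw [← hq, measureReal_eq_zero_iff] at hμq
      exact Measure.measure_univ_eq_zero.1 hμq
    have hν0 : ν = 0 := by
      rw [← hq, measureReal_eq_zero_iff] at hνq
      exact Measure.measure_univ_eq_zero.1 hνq
    simp [hμ0, hν0, ← hq]
  have iφμ := integrable_of_unit_interval (μ := μ) hφ h0 h1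
  have iφν := integrable_of_unit_interval (μ := ν) hφ h0 h1
  -- Couple by the product measure, of mass `q²`: both sides pick up a factor `q`, which is
  -- cancelled at the end.
  have e1 : ∫ z, (φ z.1 - φ z.2) ∂(μ.prod ν) = q * (∫ x, φ x ∂μ - ∫ x, φ x ∂ν) := by
    rw [integral_sub (iφμ.comp_fst ν) (iφν.comp_snd μ), integral_fun_fst, integral_fun_snd,
      hμq, hνq, smul_eq_mul, smul_eq_mul, mul_sub]
  have i2 : Integrable (fun z : α × α => c * (2 + β * U z.1 + β * U z.2)) (μ.prod ν) :=
    (((integrable_const _).add ((hUμ.comp_fst ν).const_mul β)).add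
      ((hUν.comp_snd μ).const_mul β)).const_mul c
  have e2 : ∫ z, c * (2 + β * U z.1 + β * U z.2) ∂(μ.prod ν)
      = q * (c * (2 * q + β * ∫ x, U x ∂μ + β * ∫ x, U x ∂ν)) := by
    rw [integral_const_mul, integral_add, integral_add, integral_const_mul, integral_const_mul,
      integral_fun_fst, integral_fun_snd, hμq, hνq, integral_const, ← Set.univ_prod_univ,
      measureReal_prod_prod, hμq, hνq]
    · simp only [smul_eq_mul]; ring
    · exact integrable_const _
    · exact (hUμ.comp_fst ν).const_mul β
    · exact (integrable_const _).add ((hUμ.comp_fst ν).const_mul β)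
    · exact (hUν.comp_snd μ).const_mul β
  have h := (abs_integral_le_integral_abs (f := fun z : α × α => φ z.1 - φ z.2)
    (μ := μ.prod ν)).trans (integral_mono_of_nonneg (.of_forall fun _ => abs_nonneg _) i2
      (.of_forall fun z => hosc z.1 z.2))
  rw [e1, e2, abs_mul, abs_of_pos hq] at h
  exact le_of_mul_le_mul_left h hq

variable {P : Kernel α α} {π : Measure α}

/-- The weighted oscillation of `P φ` contracts under a drift and a minorization condition. -/
theorem exists_contraction [IsMarkovKernel P] {U : α → ℝ} {lam K : ℝ}
    (hU0 : ∀ x, 0 ≤ U x) (hlam1 : lam < 1) (hK : 0 ≤ K)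
    (hint : ∀ x, Integrable U (P x)) (hdrift : ∀ x, ∫ y, U y ∂(P x) ≤ lam * U x + K)
    (hmin : ∀ R : ℝ, ∃ η : Measure α, η Set.univ ≠ 0 ∧ ∀ x, U x ≤ R → η ≤ P x) :
    ∃ γ β : ℝ, 0 < γ ∧ γ < 1 ∧ 0 < β ∧ ∀ (φ : α → ℝ) (c : ℝ), 0 ≤ c → Measurable φ →
      (∀ x, 0 ≤ φ x) → (∀ x, φ x ≤ 1) →
      (∀ x y, |φ x - φ y| ≤ c * (2 + β * U x + β * U y)) →
      ∀ x y, |∫ z, φ z ∂(P x) - ∫ z, φ z ∂(P y)| ≤ γ * c * (2 + β * U x + β * U y) := by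
  -- For `U x + U y ≥ R`, half of the drift gain, `(1 - lam)/2 · (U x + U y)`, pays for `2 * K + 1`:
  -- the two drift constants and one unit of strict decrease.
  set R := (4 * K + 2) / (1 - lam) with hR
  have h1l : 0 < 1 - lam := by linarith
  have hRmul : (1 - lam) * R = 4 * K + 2 := by rw [hR]; field_simp
  obtain ⟨η, hη0, hη⟩ := hmin R
  -- On an empty sublevel set the minorization says nothing, and `η` may even be infinite; then the
  -- drift alone contracts.
  by_cases hne : ∃ x, U x ≤ R
  swap
  · push Not at hne
    -- all points are outside the sublevel set
    refine ⟨max (1 / 2) ((1 + lam) / 2), 1, by positivity, by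
      rw [max_lt_iff]; constructor <;> linarith, one_pos, ?_⟩
    intro φ c hc hφ h0 h1 hosc x y
    have h := abs_integral_sub_integral_le (μ := P x) (ν := P y) (q := 1) (by simp) (by simp)
      hφ h0 h1 (hint x) (hint y) hosc
    refine h.trans ?_
    have hx := hdrift x
    have hy := hdrift y
    have hx' := hne x
    have hy' := hne y
    have hxR : (1 - lam) * R ≤ (1 - lam) * U x := by gcongr
    have hyR : (1 - lam) * R ≤ (1 - lam) * U y := by gcongr
    have : 2 * 1 + 1 * ∫ z, U z ∂(P x) + 1 * ∫ z, U z ∂(P y)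
        ≤ max (1 / 2) ((1 + lam) / 2) * (2 + 1 * U x + 1 * U y) := by
      have a1 : 1 ≤ max (1 / 2) ((1 + lam) / 2) * 2 := by
        have := le_max_left (1 / 2 : ℝ) ((1 + lam) / 2); linarith
      have a2 : (1 + lam) / 2 * (U x + U y) ≤ max (1 / 2) ((1 + lam) / 2) * (U x + U y) := by
        gcongr
        · exact add_nonneg (hU0 x) (hU0 y)
        · exact le_max_right _ _
      nlinarith
    calc _ ≤ c * (max (1 / 2) ((1 + lam) / 2) * (2 + 1 * U x + 1 * U y)) := by gcongr
      _ = _ := by ring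
  obtain ⟨x₀, hx₀⟩ := hne
  have hηfin : IsFiniteMeasure η :=
    ⟨((hη x₀ hx₀) Set.univ).trans_lt (measure_lt_top _ _)⟩
  set a := η.real Set.univ with ha
  have ha0 : 0 < a := by
    rw [ha, measureReal_def]; exact ENNReal.toReal_pos hη0 (measure_ne_top _ _)
  have ha1 : a ≤ 1 := by
    have := ENNReal.toReal_mono (measure_ne_top (P x₀) Set.univ) ((hη x₀ hx₀) Set.univ)
    simpa [ha, measureReal_def] using this
  -- Small enough that the drift constants cost `2 * β * K = a - β`, less than the coupled mass `a`.
  set β := a / (2 * K + 1) with hβ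
  have hβ0 : 0 < β := by positivity
  have hβK : 2 * (β * K) + β = a := by rw [hβ]; field_simp
  have hβK' : 0 ≤ β * K := by positivity
  -- The first entry serves two points in the sublevel set, the second the remaining pairs, the
  -- third the terms containing `U`.
  set γ := max (1 - a / 2) (max (1 - β / 2) ((1 + lam) / 2)) with hγ
  have hγ1 : 1 - a / 2 ≤ γ := le_max_left _ _
  have hγ2 : 1 - β / 2 ≤ γ := (le_max_left _ _).trans (le_max_right _ _)
  have hγ3 : (1 + lam) / 2 ≤ γ := (le_max_right _ _).trans (le_max_right _ _)
  refine ⟨γ, β, by linarith, ?_, hβ0, ?_⟩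
  · rw [hγ, max_lt_iff, max_lt_iff]; refine ⟨?_, ?_, ?_⟩ <;> linarith
  intro φ c hc hφ h0 h1 hosc x y
  have hx := mul_le_mul_of_nonneg_left (hdrift x) hβ0.le
  have hy := mul_le_mul_of_nonneg_left (hdrift y) hβ0.le
  have hS0 : 0 ≤ β * (U x + U y) := mul_nonneg hβ0.le (add_nonneg (hU0 x) (hU0 y))
  have hγS : (1 + lam) / 2 * (β * (U x + U y)) ≤ γ * (β * (U x + U y)) := by gcongr
  suffices h : |∫ z, φ z ∂(P x) - ∫ z, φ z ∂(P y)| ≤ c * (γ * (2 + β * U x + β * U y)) by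
    calc _ ≤ _ := h
      _ = _ := by ring
  by_cases hcase : U x ≤ R ∧ U y ≤ R
  · have sub : ∀ z, U z ≤ R → (P z - η).real Set.univ = 1 - a ∧
        ∫ u, φ u ∂(P z - η) = ∫ u, φ u ∂(P z) - ∫ u, φ u ∂η ∧
        Integrable U (P z - η) ∧ ∫ u, U u ∂(P z - η) ≤ ∫ u, U u ∂(P z) := by
      intro z hz
      have hle := hη z hz
      have hadd : P z - η + η = P z := Measure.sub_add_cancel_of_le hle
      have hsub : P z - η ≤ P z := Measure.sub_le
      refine ⟨?_, ?_, (hint z).mono_measure hsub, ?_⟩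
      · have h2 : (P z - η + η).real Set.univ = (P z - η).real Set.univ + η.real Set.univ :=
          measureReal_add_apply
        rw [hadd, probReal_univ] at h2
        linarith
      · have : ∫ u, φ u ∂(P z - η + η) = _ := integral_add_measure
          (integrable_of_unit_interval hφ h0 h1) (integrable_of_unit_interval hφ h0 h1)
        rw [hadd] at this
        linarith
      · exact integral_mono_measure hsub (.of_forall hU0) (hint z)
    obtain ⟨x1, x2, x3, x4⟩ := sub x hcase.1
    obtain ⟨y1, y2, y3, y4⟩ := sub y hcase.2
    have h := abs_integral_sub_integral_le x1 y1 hφ h0 h1 x3 y3 hosc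
    rw [x2, y2, sub_sub_sub_cancel_right] at h
    refine h.trans (mul_le_mul_of_nonneg_left ?_ hc)
    have x5 := mul_le_mul_of_nonneg_left x4 hβ0.le
    have y5 := mul_le_mul_of_nonneg_left y4 hβ0.le
    nlinarith
  · have h := abs_integral_sub_integral_le (μ := P x) (ν := P y) (q := 1) (by simp) (by simp)
      hφ h0 h1 (hint x) (hint y) hosc
    refine h.trans (mul_le_mul_of_nonneg_left ?_ hc)
    have hS : R ≤ U x + U y := by
      rw [not_and_or, not_le, not_le] at hcase
      rcases hcase with h' | h'
      · linarith [hU0 y]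
      · linarith [hU0 x]
    have hS' : (1 - lam) * R ≤ (1 - lam) * (U x + U y) := by gcongr
    have hS'' := mul_le_mul_of_nonneg_left hS' hβ0.le
    rw [hRmul] at hS''
    nlinarith

theorem invariant_pow (h : P.Invariant π) (t : ℕ) : (P ^ t).Invariant π := by
  induction t with
  | zero => simp only [pow_zero]; exact Measure.bind_dirac
  | succ t ih => rw [pow_succ]; exact ih.comp h

/-- The stationary law integrates a drift function. -/
theorem lintegral_stationary_lt_top [IsMarkovKernel P] [IsProbabilityMeasure π]
    (hinv : P.Invariant π) {W : α → ℝ} (hW : Measurable W) (hW0 : ∀ x, 0 ≤ W x) {lam K : ℝ}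
    (hlam0 : 0 ≤ lam) (hlam1 : lam < 1) (hK : 0 ≤ K)
    (hdrift : ∀ x, ∫⁻ y, ENNReal.ofReal (W y) ∂(P x) ≤ ENNReal.ofReal (lam * W x + K)) :
    ∫⁻ x, ENNReal.ofReal (W x) ∂π < ∞ := by
  -- The fixed point of `u ↦ lam * u + K`, hence a bound for the iterated drift constants.
  set K' := K / (1 - lam) with hK'
  have h1l : 0 < 1 - lam := by linarith
  have hK'0 : 0 ≤ K' := by positivity
  have hK'mul : lam * K' + K = K' := by rw [hK']; field_simp; ring
  have hmeas : Measurable fun x => ENNReal.ofReal (W x) := hW.ennreal_ofReal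
  have hmk : ∀ t : ℕ, IsMarkovKernel (P ^ t) := by
    intro t
    induction t with
    | zero => rw [pow_zero]; exact (inferInstance : IsMarkovKernel (Kernel.id : Kernel α α))
    | succ t ih => rw [pow_succ]; exact (inferInstance : IsMarkovKernel ((P ^ t) ∘ₖ P))
  have hiter : ∀ (t : ℕ) x, ∫⁻ y, ENNReal.ofReal (W y) ∂((P ^ t) x)
      ≤ ENNReal.ofReal (lam ^ t * W x + K') := by
    intro t
    induction t with
    | zero =>
      intro x
      rw [pow_zero, show (1 : Kernel α α) = Kernel.id from rfl, Kernel.lintegral_id' hmeas]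
      exact ENNReal.ofReal_le_ofReal (by simpa using hK'0)
    | succ t ih =>
      intro x
      rw [pow_succ', show P * P ^ t = P ∘ₖ (P ^ t) from rfl, Kernel.lintegral_comp _ _ _ hmeas]
      have hb : ∀ u ≥ 0, ENNReal.ofReal (lam * u + K)
          = ENNReal.ofReal lam * ENNReal.ofReal u + ENNReal.ofReal K := by
        intro u hu
        rw [ENNReal.ofReal_add (by positivity) hK, ENNReal.ofReal_mul hlam0]
      calc _ ≤ ∫⁻ y, (ENNReal.ofReal lam * ENNReal.ofReal (W y) + ENNReal.ofReal K)
              ∂((P ^ t) x) := lintegral_mono fun y => (hdrift y).trans_eq (hb _ (hW0 y))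
        _ = ENNReal.ofReal lam * ∫⁻ y, ENNReal.ofReal (W y) ∂((P ^ t) x) + ENNReal.ofReal K := by
            rw [lintegral_add_right _ measurable_const, lintegral_const_mul _ hmeas]
            simp
        _ ≤ ENNReal.ofReal lam * ENNReal.ofReal (lam ^ t * W x + K') + ENNReal.ofReal K := by
            gcongr; exact ih x
        _ = ENNReal.ofReal (lam ^ (t + 1) * W x + K') := by
            have : 0 ≤ lam ^ t * W x := mul_nonneg (by positivity) (hW0 x)
            rw [← hb _ (by positivity)]
            congr 1
            rw [pow_succ]; linarith
  -- Integrability of `W` is not yet known, so `W` is truncated at `N`: invariance under `P ^ t` and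
  -- dominated convergence as `t → ∞` remove the starting point, and monotone convergence removes
  -- `N`.
  have hN : ∀ N : ℕ, ∫⁻ x, min (ENNReal.ofReal (W x)) N ∂π ≤ ENNReal.ofReal K' := by
    intro N
    have hb : ∀ t : ℕ, ∫⁻ x, min (ENNReal.ofReal (W x)) N ∂π
        ≤ ∫⁻ x, min (ENNReal.ofReal (lam ^ t * W x + K')) N ∂π := by
      intro t
      have hm : Measurable fun x => min (ENNReal.ofReal (W x)) (N : ℝ≥0∞) :=
        hmeas.min measurable_const
      conv_lhs => rw [← (invariant_pow hinv t).def]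
      rw [Measure.lintegral_bind (P ^ t).aemeasurable hm.aemeasurable]
      refine lintegral_mono fun x => le_min ?_ ?_
      · exact (lintegral_mono fun y => min_le_left _ _).trans (hiter t x)
      · calc _ ≤ ∫⁻ _, (N : ℝ≥0∞) ∂((P ^ t) x) := lintegral_mono fun y => min_le_right _ _
          _ = N := by simp
    have hlim : Filter.Tendsto (fun t : ℕ => ∫⁻ x, min (ENNReal.ofReal (lam ^ t * W x + K')) N ∂π)
        Filter.atTop (nhds (∫⁻ _, min (ENNReal.ofReal K') (N : ℝ≥0∞) ∂π)) := by
      refine tendsto_lintegral_of_dominated_convergence (fun _ => (N : ℝ≥0∞)) (fun t => ?_)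
        (fun t => .of_forall fun x => min_le_right _ _) (by simp) (.of_forall fun x => ?_)
      · exact (((hW.const_mul _).add_const _).ennreal_ofReal).min measurable_const
      · have : Filter.Tendsto (fun t : ℕ => lam ^ t * W x + K') Filter.atTop (nhds K') := by
          simpa using ((tendsto_pow_atTop_nhds_zero_of_lt_one hlam0 hlam1).mul_const
            (W x)).add_const K'
        exact ((ENNReal.continuous_ofReal.tendsto _).comp this).min tendsto_const_nhds
    refine (ge_of_tendsto' hlim hb).trans ?_
    simp
  have hmono : ∫⁻ x, ENNReal.ofReal (W x) ∂π
      = ⨆ N : ℕ, ∫⁻ x, min (ENNReal.ofReal (W x)) N ∂π := by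
    rw [← lintegral_iSup (fun N => hmeas.min measurable_const)]
    · congr 1
      ext x
      refine le_antisymm ?_ (iSup_le fun N => min_le_left _ _)
      obtain ⟨N, hN⟩ := exists_nat_ge (W x)
      refine le_iSup_of_le N (le_min le_rfl ?_)
      exact (ENNReal.ofReal_le_ofReal hN).trans_eq (by simp)
    · intro i j hij x
      exact min_le_min le_rfl (by exact_mod_cast hij)
  rw [hmono]
  exact (iSup_le hN).trans_lt ENNReal.ofReal_lt_top

/-- With `dν = f dπ`, the pointwise bound `f U ≤ max(f, U)² ≤ f² + U²` suffices. -/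
theorem lintegral_lt_top_of_isL2Start [IsProbabilityMeasure π] {ν : Measure α}
    (hν : IsL2Start π ν) {U : α → ℝ} (hU : Measurable U)
    (hUπ : ∫⁻ x, ENNReal.ofReal (U x) ^ 2 ∂π < ∞) : ∫⁻ x, ENNReal.ofReal (U x) ∂ν < ∞ := by
  have := hν.isProbabilityMeasure
  rw [← Measure.withDensity_rnDeriv_eq ν π hν.absolutelyContinuous,
    lintegral_withDensity_eq_lintegral_mul _ (Measure.measurable_rnDeriv _ _) hU.ennreal_ofReal]
  calc _ ≤ ∫⁻ x, ((ν.rnDeriv π x) ^ 2 + ENNReal.ofReal (U x) ^ 2) ∂π := by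
        refine lintegral_mono fun x => ?_
        simp only [Pi.mul_apply]
        rcases le_total (ν.rnDeriv π x) (ENNReal.ofReal (U x)) with h | h
        · exact (mul_le_mul_left h _).trans (by rw [← sq]; exact le_add_self)
        · exact (mul_le_mul_right h _).trans (by rw [← sq]; exact le_self_add)
    _ = _ := lintegral_add_left ((Measure.measurable_rnDeriv _ _).pow_const 2) _
    _ < ∞ := ENNReal.add_lt_top.2 ⟨hν.lintegral_sq_lt_top, hUπ⟩

theorem integrable_of_lintegral_ofReal {μ : Measure α} {U : α → ℝ} (hU : Measurable U)
    (hU0 : ∀ x, 0 ≤ U x) (h : ∫⁻ x, ENNReal.ofReal (U x) ∂μ < ∞) : Integrable U μ :=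
  ⟨hU.aestronglyMeasurable, (hasFiniteIntegral_iff_ofReal (.of_forall hU0)).2 h⟩

/-- **Harris' theorem**, with square-integrable initial laws: a drift condition and minorization on
the sublevel sets of the drift function imply geometric ergodicity. -/
theorem geometricallyErgodic_of_drift_minorization [IsMarkovKernel P] [IsProbabilityMeasure π]
    (hinv : P.Invariant π) {W : α → ℝ} (hW : Measurable W) (hW0 : ∀ x, 0 ≤ W x) {lam K : ℝ}
    (hlam0 : 0 ≤ lam) (hlam1 : lam < 1) (hK : 0 ≤ K)
    (hdrift : ∀ x, ∫⁻ y, ENNReal.ofReal (W y) ∂(P x) ≤ ENNReal.ofReal (lam * W x + K))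
    (hmin : ∀ R : ℝ, ∃ η : Measure α, η Set.univ ≠ 0 ∧ ∀ x, W x ≤ R → η ≤ P x) :
    GeometricallyErgodic P π := by
  -- The stationary law is only known to integrate `W`, whereas an initial law in `𝓛₂(π)` integrates
  -- functions of `𝓛₂(π)`. Hence the contraction is run with `√W`, which inherits the drift by
  -- Jensen's inequality.
  set U : α → ℝ := fun x => Real.sqrt (W x) with hUdef
  have hU : Measurable U := hW.sqrt
  have hU0 : ∀ x, 0 ≤ U x := fun x => Real.sqrt_nonneg _
  have hU2 : ∀ x, U x ^ 2 = W x := fun x => Real.sq_sqrt (hW0 x)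
  have hWint : ∀ x, Integrable W (P x) := fun x =>
    integrable_of_lintegral_ofReal hW hW0 ((hdrift x).trans_lt ENNReal.ofReal_lt_top)
  have hUL2 : ∀ x, MemLp U 2 (P x) := fun x =>
    (memLp_two_iff_integrable_sq hU.aestronglyMeasurable).2 (by simpa only [hU2] using hWint x)
  have hUint : ∀ x, Integrable U (P x) := fun x => (hUL2 x).integrable (by norm_num)
  have hUdrift : ∀ x, ∫ y, U y ∂(P x) ≤ Real.sqrt lam * U x + Real.sqrt K := by
    intro x
    have h1 : (∫ y, U y ∂(P x)) ^ 2 ≤ lam * W x + K := by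
      have hv := variance_nonneg U (P x)
      rw [variance_eq_sub (hUL2 x)] at hv
      have h2 : ∫ y, (U ^ 2) y ∂(P x) ≤ lam * W x + K := by
        simp only [Pi.pow_apply, hU2]
        rw [integral_eq_lintegral_of_nonneg_ae (.of_forall hW0) hW.aestronglyMeasurable]
        exact ENNReal.toReal_le_of_le_ofReal
          (add_nonneg (mul_nonneg hlam0 (hW0 x)) hK) (hdrift x)
      linarith
    refine (Real.le_sqrt_of_sq_le h1).trans ?_
    rw [hUdef]
    dsimp only
    rw [← Real.sqrt_mul hlam0]
    have ha := mul_nonneg hlam0 (hW0 x)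
    refine Real.sqrt_le_iff.2 ⟨by positivity, ?_⟩
    rw [add_sq, Real.sq_sqrt ha, Real.sq_sqrt hK]
    have : 0 ≤ 2 * √(lam * W x) * √K := by positivity
    linarith
  have hmin' : ∀ R : ℝ, ∃ η : Measure α, η Set.univ ≠ 0 ∧ ∀ x, U x ≤ R → η ≤ P x := by
    intro R
    obtain ⟨η, h0, h⟩ := hmin (R ^ 2)
    refine ⟨η, h0, fun x hx => h x ?_⟩
    rw [← hU2]
    exact pow_le_pow_left₀ (hU0 x) hx 2
  obtain ⟨γ, β, hγ0, hγ1, hβ, hcontr⟩ := exists_contraction (P := P) hU0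
    (by rw [Real.sqrt_lt' one_pos]; simpa using hlam1) (Real.sqrt_nonneg K) hUint hUdrift hmin'
  refine ⟨inferInstance, inferInstance, hinv, γ, hγ0, hγ1, fun ν hν => ?_⟩
  have := hν.isProbabilityMeasure
  have hmk : ∀ t : ℕ, IsMarkovKernel (P ^ t) := by
    intro t
    induction t with
    | zero => rw [pow_zero]; exact (inferInstance : IsMarkovKernel (Kernel.id : Kernel α α))
    | succ t ih => rw [pow_succ]; exact (inferInstance : IsMarkovKernel ((P ^ t) ∘ₖ P))
  have hπU2 : ∫⁻ x, ENNReal.ofReal (U x) ^ 2 ∂π < ∞ := by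
    simp_rw [← ENNReal.ofReal_pow (hU0 _), hU2]
    exact lintegral_stationary_lt_top hinv hW hW0 hlam0 hlam1 hK hdrift
  have hνU : Integrable U ν :=
    integrable_of_lintegral_ofReal hU hU0 (lintegral_lt_top_of_isL2Start hν hU hπU2)
  have hπU : Integrable U π := by
    refine MemLp.integrable (q := 2) (by norm_num) ?_
    rw [memLp_two_iff_integrable_sq hU.aestronglyMeasurable]
    refine integrable_of_lintegral_ofReal (hU.pow_const 2) (fun x => sq_nonneg _) ?_
    simpa only [ENNReal.ofReal_pow (hU0 _)] using hπU2
  -- The weighted oscillation bound at time `t`, integrated against `ν ⊗ π`.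
  refine ⟨2 + β * ∫ x, U x ∂ν + β * ∫ x, U x ∂π, ?_, fun t => ?_⟩
  · have h1 : 0 ≤ ∫ x, U x ∂ν := integral_nonneg hU0
    have h2 : 0 ≤ ∫ x, U x ∂π := integral_nonneg hU0
    positivity
  refine ciSup_le fun A => ?_
  obtain ⟨A, hA⟩ := A
  have hφm : ∀ t : ℕ, Measurable fun x => ((P ^ t) x).real A := fun t =>
    ((P ^ t).measurable_coe hA).ennreal_toReal
  -- Induction on `t` for the functions `x ↦ Pᵗ(x, A)`. At `t = 0` the oscillation is at most `1`,
  -- below the constant `2` in the weight.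
  have hosc : ∀ (t : ℕ) x y, |((P ^ t) x).real A - ((P ^ t) y).real A|
      ≤ γ ^ t * (2 + β * U x + β * U y) := by
    intro t
    induction t with
    | zero =>
      intro x y
      have b1 := measureReal_nonneg (μ := (P ^ 0) x) (s := A)
      have b2 := measureReal_nonneg (μ := (P ^ 0) y) (s := A)
      have b3 := measureReal_le_one (μ := (P ^ 0) x) (s := A)
      have b4 := measureReal_le_one (μ := (P ^ 0) y) (s := A)
      have b5 := mul_nonneg hβ.le (hU0 x)
      have b6 := mul_nonneg hβ.le (hU0 y)
      rw [abs_le]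
      constructor <;> simp only [pow_zero, one_mul] at * <;> linarith
    | succ t ih =>
      have hstep : ∀ x, ((P ^ (t + 1)) x).real A = ∫ y, ((P ^ t) y).real A ∂(P x) := by
        intro x
        rw [integral_eq_lintegral_of_nonneg_ae (.of_forall fun _ => measureReal_nonneg)
          (hφm t).aestronglyMeasurable, measureReal_def]
        congr 1
        have := Kernel.pow_add_apply_eq_lintegral P 1 t x hA
        rw [add_comm t 1, this, pow_one]
        exact lintegral_congr fun y => (ENNReal.ofReal_toReal (measure_ne_top _ _)).symm
      intro x y
      rw [hstep, hstep, pow_succ']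
      exact hcontr _ _ (by positivity) (hφm t) (fun _ => measureReal_nonneg)
        (fun _ => measureReal_le_one) ih x y
  have hbind : ∀ (κ : Measure α) [IsProbabilityMeasure κ],
      (κ.bind ⇑(P ^ t)).real A = ∫ x, ((P ^ t) x).real A ∂κ := by
    intro κ _
    rw [integral_eq_lintegral_of_nonneg_ae (.of_forall fun _ => measureReal_nonneg)
      (hφm t).aestronglyMeasurable, measureReal_def,
      Measure.bind_apply hA (P ^ t).aemeasurable]
    congr 1
    exact lintegral_congr fun y => (ENNReal.ofReal_toReal (measure_ne_top _ _)).symm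
  have hπA : π.real A = ∫ x, ((P ^ t) x).real A ∂π := by
    rw [← hbind π, (invariant_pow hinv t).def]
  rw [hbind ν, hπA]
  have h := abs_integral_sub_integral_le (q := 1) (by simp) (by simp) (hφm t)
    (fun _ => measureReal_nonneg) (fun _ => measureReal_le_one) hνU hπU (hosc t)
  calc _ ≤ _ := h
    _ = _ := by ring

end Harris

/-! ### Integrals of products -/

theorem lintegral_fin_prod {n : ℕ} (μ : Fin n → Measure ℝ) [∀ i, SigmaFinite (μ i)]
    {f : Fin n → ℝ → ℝ≥0∞} (hf : ∀ i, Measurable (f i)) :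
    ∫⁻ x : Fin n → ℝ, ∏ i, f i (x i) ∂(Measure.pi μ) = ∏ i, ∫⁻ x, f i x ∂(μ i) := by
  induction n with
  | zero => simp
  | succ n ih =>
    have hm : Measurable fun x : Fin n → ℝ => ∏ i : Fin n, f i.succ (x i) :=
      Finset.measurable_prod _ fun i _ => (hf i.succ).comp (measurable_pi_apply i)
    calc
      _ = ∫⁻ x : ℝ × (Fin n → ℝ),
            f 0 x.1 * ∏ i : Fin n, f (Fin.succ i) (x.2 i)
            ∂((μ 0).prod (Measure.pi (fun i => μ i.succ))) := by
        rw [← ((measurePreserving_piFinSuccAbove μ 0).symm).lintegral_comp_emb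
          (MeasurableEquiv.measurableEmbedding _)]
        simp_rw [MeasurableEquiv.piFinSuccAbove_symm_apply, Fin.insertNthEquiv,
          Fin.prod_univ_succ, Fin.insertNth_zero, Equiv.coe_fn_mk, Fin.cons_succ,
          Fin.zero_succAbove, cast_eq, Fin.cons_zero]
      _ = (∫⁻ x, f 0 x ∂μ 0)
            * ∏ i : Fin n, ∫⁻ x, f (Fin.succ i) x ∂(μ i.succ) := by
        rw [← ih (fun i => μ i.succ) (fun i => hf i.succ),
          lintegral_prod_mul (hf 0).aemeasurable hm.aemeasurable]
      _ = ∏ i, ∫⁻ x, f i x ∂(μ i) := by rw [Fin.prod_univ_succ]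

theorem pi_withDensity {n : ℕ} {μ : Measure ℝ} [SigmaFinite μ] {f : ℝ → ℝ≥0∞} (hf : Measurable f)
    [SigmaFinite (μ.withDensity f)] :
    Measure.pi (fun _ : Fin n => μ.withDensity f)
      = (Measure.pi fun _ : Fin n => μ).withDensity fun x => ∏ i, f (x i) := by
  refine Measure.pi_eq fun s hs => ?_
  rw [withDensity_apply _ (MeasurableSet.univ_pi hs), Measure.restrict_pi_pi,
    lintegral_fin_prod _ fun _ => hf]
  exact Finset.prod_congr rfl fun i _ => (withDensity_apply _ (hs i)).symm

theorem lintegral_orthantVolume {n : ℕ} (F : (Fin n → ℝ) → ℝ≥0∞) :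
    ∫⁻ V, F V.1 ∂(orthantVolume n)
      = ∫⁻ x, F x ∂(Measure.pi fun _ : Fin n => (volume : Measure ℝ).restrict (Set.Ioi 0)) := by
  have he : MeasurableEmbedding (Subtype.val : PosOrthant n → Fin n → ℝ) :=
    MeasurableEmbedding.subtype_coe (measurableSet_posOrthant n)
  refine (he.lintegral_map (μ := orthantVolume n) F).symm.trans ?_
  rw [orthantVolume, he.map_comap, ← Measure.restrict_pi_pi, ← volume_pi]
  congr 2
  ext V
  simp [Set.mem_pi]

theorem lintegral_orthantVolume_prod {n : ℕ} {f : Fin n → ℝ → ℝ≥0∞} (hf : ∀ i, Measurable (f i)) :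
    ∫⁻ V, ∏ i, f i (V.1 i) ∂(orthantVolume n) = ∏ i, ∫⁻ v in Set.Ioi 0, f i v := by
  rw [lintegral_orthantVolume fun x => ∏ i, f i (x i), lintegral_fin_prod _ hf]

/-! ### The multivariate normal density -/

theorem lintegral_matrix_affine {n : ℕ} {R : Matrix (Fin n) (Fin n) ℝ} (hR : R.det ≠ 0)
    (η : Fin n → ℝ) {F : (Fin n → ℝ) → ℝ≥0∞} (hF : Measurable F) :
    ∫⁻ x, F x = ENNReal.ofReal |R.det| * ∫⁻ z, F (η + R *ᵥ z) := by
  have hm : Measurable (Matrix.toLin' R) := (LinearMap.continuous_of_finiteDimensional _).measurable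
  have h2 : ∫⁻ z, F (η + R *ᵥ z) = ∫⁻ y, F (η + y) ∂(Measure.map (Matrix.toLin' R) volume) := by
    have hF' : Measurable fun y => F (η + y) := hF.comp (measurable_const_add η)
    rw [lintegral_map hF' hm]
    simp
  rw [h2, Real.map_matrix_volume_pi_eq_smul_volume_pi hR, lintegral_smul_measure, smul_eq_mul,
    ← mul_assoc, ← ENNReal.ofReal_mul (abs_nonneg _), ← abs_mul, mul_inv_cancel₀ hR,
    lintegral_add_left_eq_self F η]
  simp

/-- For a symmetric square root `R` of `S`, the quadratic form at `η + R z` is `|z|²`, and the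
Jacobian `|det R|` cancels `√(det S)`. -/
theorem mvNormalPDFReal_affine {n : ℕ} {R S : Matrix (Fin n) (Fin n) ℝ} (hRS : R * R = S)
    (hRt : Rᵀ = R) (hR : R.det ≠ 0) (η z : Fin n → ℝ) :
    |R.det| * mvNormalPDFReal η S (η + R *ᵥ z) = ∏ i, gaussianPDFReal 0 1 (z i) := by
  have hu : IsUnit R.det := isUnit_iff_ne_zero.2 hR
  have hS : S⁻¹ *ᵥ (R *ᵥ z) = R⁻¹ *ᵥ z := by
    rw [← hRS, Matrix.mul_inv_rev, Matrix.mulVec_mulVec, Matrix.mul_assoc,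
      Matrix.nonsing_inv_mul _ hu, Matrix.mul_one]
  have hq : (R *ᵥ z) ⬝ᵥ (R⁻¹ *ᵥ z) = z ⬝ᵥ z := by
    rw [← Matrix.vecMul_transpose, hRt, ← Matrix.dotProduct_mulVec, Matrix.mulVec_mulVec,
      Matrix.mul_nonsing_inv _ hu, Matrix.one_mulVec]
  have hd : S.det = R.det ^ 2 := by rw [← hRS, Matrix.det_mul, sq]
  rw [mvNormalPDFReal, add_sub_cancel_left, hS, hq, hd, Real.sqrt_mul (by positivity),
    Real.sqrt_sq_eq_abs]
  simp only [gaussianPDFReal_def, NNReal.coe_one, mul_one, sub_zero, Finset.prod_mul_distrib,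
    Finset.prod_const, Finset.card_univ, Fintype.card_fin]
  rw [← Real.exp_sum, mul_inv, ← mul_assoc, mul_comm |R.det|, mul_assoc (√_)⁻¹,
    inv_mul_cancel₀ (abs_ne_zero.2 hR), mul_one, inv_pow, Real.sqrt_eq_rpow, Real.sqrt_eq_rpow,
    ← Real.rpow_natCast, ← Real.rpow_natCast, ← Real.rpow_mul (by positivity),
    ← Real.rpow_mul (by positivity), mul_comm (n : ℝ)]
  congr 2
  rw [dotProduct, Finset.mul_sum]
  exact Finset.sum_congr rfl fun i _ => by ring

open scoped MatrixOrder in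
-- The identification with `multivariateGaussian` supplies the total mass and the one-dimensional
-- marginals of the `M`-update.
theorem withDensity_mvNormalPDFReal {n : ℕ} {S : Matrix (Fin n) (Fin n) ℝ} (hS : S.PosDef)
    (η : Fin n → ℝ) (hm : Measurable fun x => ENNReal.ofReal (mvNormalPDFReal η S x)) :
    (volume.withDensity fun x => ENNReal.ofReal (mvNormalPDFReal η S x))
      = (multivariateGaussian (WithLp.toLp 2 η) S).map WithLp.ofLp := by
  set R := CFC.sqrt S with hRdef
  have hRS : R * R = S := CFC.sqrt_mul_sqrt_self S hS.posSemidef.nonneg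
  have hRt : Rᵀ = R := by
    have : R.PosSemidef := Matrix.nonneg_iff_posSemidef.1 (CFC.sqrt_nonneg S)
    simpa [Matrix.IsHermitian] using this.1
  have hR : R.det ≠ 0 := by
    intro h
    have := hS.det_pos
    rw [← hRS, Matrix.det_mul, h] at this
    simp at this
  have hmul : Measurable fun z : Fin n → ℝ => η + R *ᵥ z :=
    measurable_const.add (Continuous.measurable (by fun_prop))
  have hgauss : (multivariateGaussian (WithLp.toLp 2 η) S).map WithLp.ofLp
      = (Measure.pi fun _ : Fin n => gaussianReal 0 1).map fun z => η + R *ᵥ z := by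
    rw [multivariateGaussian, ← map_pi_eq_stdGaussian, Measure.map_map (by fun_prop) (by fun_prop),
      Measure.map_map (by fun_prop) (by fun_prop)]
    congr 1
  rw [hgauss, gaussianReal_of_var_ne_zero _ one_ne_zero]
  have : SigmaFinite (volume.withDensity (gaussianPDF 0 1)) := by
    rw [← gaussianReal_of_var_ne_zero _ one_ne_zero]
    infer_instance
  rw [pi_withDensity (measurable_gaussianPDF 0 1), ← volume_pi]
  refine Measure.ext_of_lintegral _ fun f hf => ?_
  have hfm : Measurable fun z => f (η + R *ᵥ z) := hf.comp hmul
  have hmfm : Measurable fun z =>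
      ((fun x => ENNReal.ofReal (mvNormalPDFReal η S x)) * f) (η + R *ᵥ z) := (hm.mul hf).comp hmul
  rw [lintegral_map hf hmul, lintegral_withDensity_eq_lintegral_mul _ hm hf,
    lintegral_withDensity_eq_lintegral_mul _ _ hfm,
    lintegral_matrix_affine hR η (hm.mul hf), ← lintegral_const_mul _ hmfm]
  · refine lintegral_congr fun z => ?_
    simp only [Pi.mul_apply]
    rw [← mul_assoc, ← ENNReal.ofReal_mul (abs_nonneg _), mvNormalPDFReal_affine hRS hRt hR]
    congr 1
    simp only [gaussianPDF]
    rw [ENNReal.ofReal_prod_of_nonneg fun i _ => gaussianPDFReal_nonneg _ _ _]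
  · exact Finset.measurable_prod _ fun i _ =>
      (measurable_gaussianPDF 0 1).comp (measurable_pi_apply i)

theorem map_eval_withDensity_mvNormalPDFReal {n : ℕ} {S : Matrix (Fin n) (Fin n) ℝ}
    (hS : S.PosDef) (η : Fin n → ℝ)
    (hm : Measurable fun x => ENNReal.ofReal (mvNormalPDFReal η S x)) (i : Fin n) :
    (volume.withDensity fun x => ENNReal.ofReal (mvNormalPDFReal η S x)).map (fun x => x i)
      = gaussianReal (η i) (S i i).toNNReal := by
  rw [withDensity_mvNormalPDFReal hS η hm, Measure.map_map (by fun_prop) (by fun_prop)]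
  exact (measurePreserving_eval_multivariateGaussian hS.posSemidef).map_eq

theorem isProbabilityMeasure_withDensity_mvNormalPDFReal {n : ℕ} {S : Matrix (Fin n) (Fin n) ℝ}
    (hS : S.PosDef) (η : Fin n → ℝ)
    (hm : Measurable fun x => ENNReal.ofReal (mvNormalPDFReal η S x)) :
    IsProbabilityMeasure (volume.withDensity fun x => ENNReal.ofReal (mvNormalPDFReal η S x)) := by
  rw [withDensity_mvNormalPDFReal hS η hm]
  exact Measure.isProbabilityMeasure_map (by fun_prop)

/-! ### Correlation inequality -/

/-- Chebyshev's correlation inequality: oppositely ordered functions are negatively correlated. -/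
theorem lintegral_mul_le_of_opposite {α : Type*} [MeasurableSpace α] {μ : Measure α}
    [IsProbabilityMeasure μ] {f g : α → ℝ} (hf : Measurable f) (hg : Measurable g)
    (hf0 : ∀ x, 0 ≤ f x) (hg0 : ∀ x, 0 ≤ g x) {c d : ℝ} (hc0 : 0 ≤ c) (hd0 : 0 ≤ d)
    (hc : ∫⁻ x, ENNReal.ofReal (f x) ∂μ = ENNReal.ofReal c)
    (h : ∀ᵐ x ∂μ, (f x - c) * (g x - d) ≤ 0) :
    ∫⁻ x, ENNReal.ofReal (f x * g x) ∂μ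
      ≤ ENNReal.ofReal c * ∫⁻ x, ENNReal.ofReal (g x) ∂μ := by
  -- Integrate `f g + c d ≤ d f + c g`. Since `∫ f = c`, the terms `c d` cancel, whatever `d` is.
  have hle : ∫⁻ x, ENNReal.ofReal (f x * g x) ∂μ + ENNReal.ofReal (c * d)
      ≤ ENNReal.ofReal c * ∫⁻ x, ENNReal.ofReal (g x) ∂μ + ENNReal.ofReal (c * d) := by
    calc _ = ∫⁻ x, (ENNReal.ofReal (f x * g x) + ENNReal.ofReal (c * d)) ∂μ := by
          rw [lintegral_add_right _ measurable_const]; simp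
      _ ≤ ∫⁻ x, (ENNReal.ofReal d * ENNReal.ofReal (f x)
            + ENNReal.ofReal c * ENNReal.ofReal (g x)) ∂μ := by
          refine lintegral_mono_ae ?_
          filter_upwards [h] with x hx
          rw [← ENNReal.ofReal_mul hd0, ← ENNReal.ofReal_mul hc0,
            ← ENNReal.ofReal_add (mul_nonneg (hf0 x) (hg0 x)) (mul_nonneg hc0 hd0),
            ← ENNReal.ofReal_add (mul_nonneg hd0 (hf0 x)) (mul_nonneg hc0 (hg0 x))]
          exact ENNReal.ofReal_le_ofReal (by linarith)
      _ = ENNReal.ofReal d * ENNReal.ofReal c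
            + ENNReal.ofReal c * ∫⁻ x, ENNReal.ofReal (g x) ∂μ := by
          rw [lintegral_add_left (hf.ennreal_ofReal.const_mul _),
            lintegral_const_mul _ hf.ennreal_ofReal, lintegral_const_mul _ hg.ennreal_ofReal, hc]
      _ = _ := by rw [← ENNReal.ofReal_mul hd0, mul_comm d, add_comm]
  exact (ENNReal.add_le_add_iff_right ENNReal.ofReal_ne_top).1 hle

/-! ### Absolute moments of the normal distribution -/

/-- The absolute moment `E |Z| ^ r` of a standard normal variable. -/
def stdNormalAbsMoment (r : ℝ) : ℝ := 2 ^ (r / 2) * Real.Gamma ((r + 1) / 2) / Real.Gamma (1 / 2)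

theorem stdNormalAbsMoment_pos {r : ℝ} (hr : -1 < r) : 0 < stdNormalAbsMoment r := by
  have h1 : 0 < Real.Gamma ((r + 1) / 2) := Real.Gamma_pos_of_pos (by linarith)
  have h2 : 0 < Real.Gamma (1 / 2) := Real.Gamma_pos_of_pos (by norm_num)
  unfold stdNormalAbsMoment
  positivity

theorem lintegral_abs_rpow_stdNormal {r : ℝ} (hr : -1 < r) :
    ∫⁻ x, ENNReal.ofReal (|x| ^ r) ∂(gaussianReal 0 1)
      = ENNReal.ofReal (stdNormalAbsMoment r) := by
  have hval : ∫ x : ℝ, |x| ^ r * gaussianPDFReal 0 1 x = stdNormalAbsMoment r := by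
    have h1 : ∀ x : ℝ, |x| ^ r * gaussianPDFReal 0 1 x
        = (fun y : ℝ => (√(2 * Real.pi))⁻¹ * (y ^ r * Real.exp (-(1 / 2) * y ^ (2 : ℝ)))) |x| := by
      intro x
      simp only [gaussianPDFReal_def, NNReal.coe_one, mul_one, sub_zero, Real.rpow_two, sq_abs]
      rw [show -x ^ 2 / 2 = -(1 / 2) * x ^ 2 by ring]
      ring
    rw [integral_congr_ae (.of_forall h1), integral_comp_abs (f := fun y : ℝ =>
        (√(2 * Real.pi))⁻¹ * (y ^ r * Real.exp (-(1 / 2) * y ^ (2 : ℝ)))), integral_const_mul,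
      integral_rpow_mul_exp_neg_mul_rpow two_pos hr (by norm_num), stdNormalAbsMoment,
      Real.Gamma_one_half_eq, Real.sqrt_mul (by norm_num), one_div, Real.inv_rpow (by norm_num),
      neg_div, Real.rpow_neg (by norm_num), inv_inv, add_div, Real.rpow_add (by norm_num),
      ← Real.sqrt_eq_rpow]
    have h2 : √(2 : ℝ) ≠ 0 := by positivity
    have h3 : √Real.pi ≠ 0 := by positivity
    field_simp
  -- A nonintegrable function has Bochner integral `0`, so the nonzero value just computed proves
  -- integrability.
  have hint : Integrable fun x : ℝ => |x| ^ r * gaussianPDFReal 0 1 x := by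
    refine Integrable.of_integral_ne_zero ?_
    rw [hval]
    exact (stdNormalAbsMoment_pos hr).ne'
  rw [gaussianReal_of_var_ne_zero _ one_ne_zero,
    lintegral_withDensity_eq_lintegral_mul _ (measurable_gaussianPDF 0 1) (by fun_prop), ← hval,
    ofReal_integral_eq_lintegral_ofReal hint (.of_forall fun x => mul_nonneg (by positivity)
      (gaussianPDFReal_nonneg _ _ _))]
  refine lintegral_congr fun x => ?_
  simp only [Pi.mul_apply, gaussianPDF]
  rw [mul_comm, ENNReal.ofReal_mul (by positivity)]

theorem gaussianReal_eq_map (m : ℝ) {τ : ℝ} {v : ℝ≥0} (hv : (v : ℝ) = τ ^ 2) :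
    gaussianReal m v = (gaussianReal 0 1).map fun z => m + τ * z := by
  have : (fun z : ℝ => m + τ * z) = (fun x => m + x) ∘ fun z => τ * z := rfl
  rw [this, ← Measure.map_map (by fun_prop) (by fun_prop), gaussianReal_map_const_mul,
    gaussianReal_map_const_add]
  congr 1
  · simp
  · ext; simp [hv]

theorem lintegral_sq_gaussianReal (m : ℝ) (v : ℝ≥0) :
    ∫⁻ x, ENNReal.ofReal (x ^ 2) ∂(gaussianReal m v) = ENNReal.ofReal (m ^ 2 + v) := by
  have hL2 : MemLp id 2 (gaussianReal m v) := memLp_id_gaussianReal 2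
  have hv := variance_eq_sub hL2
  rw [variance_id_gaussianReal] at hv
  have hi : Integrable (fun x : ℝ => x ^ 2) (gaussianReal m v) := hL2.integrable_sq
  rw [← ofReal_integral_eq_lintegral_ofReal hi (.of_forall fun x => sq_nonneg x)]
  congr 1
  have h1 : ∫ x, (id ^ 2 : ℝ → ℝ) x ∂(gaussianReal m v) = ∫ x, x ^ 2 ∂(gaussianReal m v) := rfl
  have h2 : ∫ x, id x ∂(gaussianReal m v) = m := integral_id_gaussianReal
  rw [h1, h2] at hv
  linarith

/-- Write the variable as `m + √v Z`; the power `r ≤ 1` is subadditive. -/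
theorem lintegral_abs_rpow_gaussianReal_le (m : ℝ) (v : ℝ≥0) {r : ℝ} (hr0 : 0 ≤ r)
    (hr1 : r ≤ 1) :
    ∫⁻ x, ENNReal.ofReal (|x| ^ r) ∂(gaussianReal m v)
      ≤ ENNReal.ofReal (|m| ^ r + (v : ℝ) ^ (r / 2) * stdNormalAbsMoment r) := by
  have hv : (v : ℝ) = √(v : ℝ) ^ 2 := (Real.sq_sqrt v.2).symm
  have hvr : (v : ℝ) ^ (r / 2) = √(v : ℝ) ^ r := by
    rw [Real.sqrt_eq_rpow, ← Real.rpow_mul (NNReal.coe_nonneg v)]; congr 1; ring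
  rw [gaussianReal_eq_map m hv, lintegral_map (by fun_prop) (by fun_prop), hvr]
  calc _ ≤ ∫⁻ z, (ENNReal.ofReal (|m| ^ r) + ENNReal.ofReal (√(v : ℝ) ^ r)
          * ENNReal.ofReal (|z| ^ r)) ∂(gaussianReal 0 1) := by
        refine lintegral_mono fun z => ?_
        rw [← ENNReal.ofReal_mul (by positivity), ← ENNReal.ofReal_add (by positivity)
          (by positivity), ← Real.mul_rpow (by positivity) (by positivity)]
        refine ENNReal.ofReal_le_ofReal ?_
        refine (Real.rpow_le_rpow (abs_nonneg _) (abs_add_le _ _) hr0).trans ?_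
        rw [abs_mul, abs_of_nonneg (Real.sqrt_nonneg (v : ℝ))]
        exact Real.rpow_add_le_add_rpow (by positivity) (by positivity) hr0 hr1
    _ = _ := by
        have := stdNormalAbsMoment_pos (r := r) (by linarith)
        rw [lintegral_add_left measurable_const, lintegral_const_mul _ (by fun_prop),
          lintegral_abs_rpow_stdNormal (by linarith), ← ENNReal.ofReal_mul (by positivity),
          ENNReal.ofReal_add (by positivity) (by positivity)]
        simp

/-- A shift away from `0` only decreases negative moments. By symmetry `N(m,1)` may be averaged with
`N(-m,1)`; relative to `N(0,1)` the average has density `exp(-m²/2) cosh(m x)`, which increases in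
`|x|` while `|x| ^ (-r)` decreases, so the correlation inequality applies. -/
theorem lintegral_abs_rpow_neg_gaussianReal_one_le (m : ℝ) {r : ℝ} (hr0 : 0 < r) (hr1 : r < 1) :
    ∫⁻ x, ENNReal.ofReal (|x| ^ (-r)) ∂(gaussianReal m 1)
      ≤ ENNReal.ofReal (stdNormalAbsMoment (-r)) := by
  set c := stdNormalAbsMoment (-r) with hc
  have hc0 : 0 < c := stdNormalAbsMoment_pos (by linarith)
  set g : ℝ → ℝ := fun x => Real.exp (-m ^ 2 / 2) * (2 * Real.cosh (m * x)) with hg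
  have hgm : Measurable g := by
    have : Continuous g := by rw [hg]; fun_prop
    exact this.measurable
  have hg0 : ∀ x, 0 ≤ g x := fun x => by have := Real.cosh_pos (m * x); positivity
  have hdens : ∀ x, gaussianPDF m 1 x + gaussianPDF (-m) 1 x
      = gaussianPDF 0 1 x * ENNReal.ofReal (g x) := by
    intro x
    simp only [gaussianPDF]
    rw [← ENNReal.ofReal_add (gaussianPDFReal_nonneg _ _ _) (gaussianPDFReal_nonneg _ _ _),
      ← ENNReal.ofReal_mul (gaussianPDFReal_nonneg _ _ _)]
    congr 1
    simp only [gaussianPDFReal_def, NNReal.coe_one, mul_one, sub_zero, hg, Real.cosh_eq]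
    rw [← mul_add, mul_assoc]
    congr 1
    have e1 : -(x - m) ^ 2 / 2 = -x ^ 2 / 2 + -m ^ 2 / 2 + m * x := by ring
    have e2 : -(x - -m) ^ 2 / 2 = -x ^ 2 / 2 + -m ^ 2 / 2 + -(m * x) := by ring
    rw [e1, e2]
    simp only [Real.exp_add]
    ring
  have hsum : ∀ f : ℝ → ℝ≥0∞, Measurable f →
      ∫⁻ x, f x ∂(gaussianReal m 1) + ∫⁻ x, f x ∂(gaussianReal (-m) 1)
        = ∫⁻ x, f x * ENNReal.ofReal (g x) ∂(gaussianReal 0 1) := by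
    intro f hf
    have hfg : Measurable fun x => f x * ENNReal.ofReal (g x) := hf.mul hgm.ennreal_ofReal
    simp only [gaussianReal_of_var_ne_zero _ (one_ne_zero' ℝ≥0)]
    rw [lintegral_withDensity_eq_lintegral_mul _ (measurable_gaussianPDF m 1) hf,
      lintegral_withDensity_eq_lintegral_mul _ (measurable_gaussianPDF (-m) 1) hf,
      lintegral_withDensity_eq_lintegral_mul _ (measurable_gaussianPDF 0 1)
        hfg,
      ← lintegral_add_left ((measurable_gaussianPDF m 1).mul hf)]
    refine lintegral_congr fun x => ?_
    simp only [Pi.mul_apply]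
    rw [← add_mul, hdens]
    ring
  have hsymm : ∫⁻ x, ENNReal.ofReal (|x| ^ (-r)) ∂(gaussianReal (-m) 1)
      = ∫⁻ x, ENNReal.ofReal (|x| ^ (-r)) ∂(gaussianReal m 1) := by
    rw [← gaussianReal_map_neg, lintegral_map (by fun_prop) (by fun_prop)]
    simp
  have hone : ∫⁻ x, ENNReal.ofReal (g x) ∂(gaussianReal 0 1) = 2 := by
    have := hsum (fun _ => 1) measurable_const
    simp only [one_mul, lintegral_const, measure_univ, mul_one] at this
    rw [← this]; norm_num
  -- The level `d` is the value of `g` where `|x| ^ (-r)` equals its mean `c`, so both factors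
  -- change sign at the same `|x|`.
  have hcheb := lintegral_mul_le_of_opposite (μ := gaussianReal 0 1)
    (f := fun x => |x| ^ (-r)) (g := g) (c := c) (d := g (c ^ (-r⁻¹))) (by fun_prop) hgm
    (fun x => by positivity) hg0 hc0.le (hg0 _) (lintegral_abs_rpow_stdNormal (by linarith)) (by
      have hne : ∀ᵐ x ∂(gaussianReal 0 1), x ≠ 0 := by
        have : NullSingletonClass (gaussianReal 0 1) :=
          nullSingletonClass_gaussianReal one_ne_zero
        exact measure_eq_zero_iff_ae_notMem.1 (measure_singleton (0 : ℝ))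
      filter_upwards [hne] with x hx
      have hx0 : 0 < |x| := abs_pos.2 hx
      have hx1 : 0 < c ^ (-r⁻¹) := Real.rpow_pos_of_pos hc0 _
      have hcr : (c ^ (-r⁻¹)) ^ (-r) = c := by
        rw [← Real.rpow_mul hc0.le, neg_mul_neg, inv_mul_cancel₀ hr0.ne', Real.rpow_one]
      rcases le_total |x| (c ^ (-r⁻¹)) with h | h
      · refine mul_nonpos_of_nonneg_of_nonpos ?_ ?_
        · rw [sub_nonneg]
          calc c = _ := hcr.symm
            _ ≤ _ := Real.rpow_le_rpow_of_nonpos hx0 h (by linarith)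
        · rw [sub_nonpos, hg]
          dsimp only
          have : Real.cosh (m * x) ≤ Real.cosh (m * c ^ (-r⁻¹)) := by
            rw [Real.cosh_le_cosh, abs_mul, abs_mul, abs_of_pos hx1]
            gcongr
          gcongr
      · refine mul_nonpos_of_nonpos_of_nonneg ?_ ?_
        · rw [sub_nonpos]
          calc _ ≤ _ := Real.rpow_le_rpow_of_nonpos hx1 h (by linarith)
            _ = c := hcr
        · rw [sub_nonneg, hg]
          dsimp only
          have : Real.cosh (m * c ^ (-r⁻¹)) ≤ Real.cosh (m * x) := by
            rw [Real.cosh_le_cosh, abs_mul, abs_mul, abs_of_pos hx1]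
            gcongr
          gcongr)
  have h2 := hsum (fun x => ENNReal.ofReal (|x| ^ (-r))) (by fun_prop)
  rw [hsymm] at h2
  have h3 : ∀ x : ℝ, ENNReal.ofReal (|x| ^ (-r)) * ENNReal.ofReal (g x)
      = ENNReal.ofReal (|x| ^ (-r) * g x) := fun x => (ENNReal.ofReal_mul (by positivity)).symm
  simp only [h3] at h2
  rw [← h2, hone, ← two_mul, mul_comm (ENNReal.ofReal c)] at hcheb
  exact (ENNReal.mul_le_mul_iff_right two_ne_zero (by norm_num)).1 hcheb

theorem lintegral_abs_rpow_neg_gaussianReal_le (m : ℝ) {v : ℝ≥0} (hv0 : v ≠ 0) {r : ℝ}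
    (hr0 : 0 < r) (hr1 : r < 1) :
    ∫⁻ x, ENNReal.ofReal (|x| ^ (-r)) ∂(gaussianReal m v)
      ≤ ENNReal.ofReal ((v : ℝ) ^ (-(r / 2)) * stdNormalAbsMoment (-r)) := by
  have hvpos : 0 < (v : ℝ) := NNReal.coe_pos.2 (pos_iff_ne_zero.2 hv0)
  have hv : (v : ℝ) = √(v : ℝ) ^ 2 := (Real.sq_sqrt v.2).symm
  have hs : 0 < √(v : ℝ) := Real.sqrt_pos.2 hvpos
  have hvr : (v : ℝ) ^ (-(r / 2)) = √(v : ℝ) ^ (-r) := by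
    rw [Real.sqrt_eq_rpow, ← Real.rpow_mul (NNReal.coe_nonneg v)]; congr 1; ring
  have h1 := lintegral_abs_rpow_neg_gaussianReal_one_le (m / √(v : ℝ)) hr0 hr1
  rw [gaussianReal_eq_map _ (τ := 1) (by simp), lintegral_map (by fun_prop) (by fun_prop)] at h1
  rw [gaussianReal_eq_map m hv, lintegral_map (by fun_prop) (by fun_prop), hvr]
  have h2 : ∀ z : ℝ, ENNReal.ofReal (|m + √(v : ℝ) * z| ^ (-r))
      = ENNReal.ofReal (√(v : ℝ) ^ (-r)) * ENNReal.ofReal (|m / √(v : ℝ) + 1 * z| ^ (-r)) := by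
    intro z
    rw [← ENNReal.ofReal_mul (by positivity), ← Real.mul_rpow hs.le (abs_nonneg _),
      ← abs_of_pos hs, ← abs_mul, abs_of_pos hs]
    congr 3
    field_simp
  simp_rw [h2]
  rw [lintegral_const_mul _ (by fun_prop), ENNReal.ofReal_mul (by positivity)]
  gcongr

/-! ### Strict log-convexity of the Gamma function -/

/-- Strict Cauchy–Schwarz: the integral of `e^(-t) t^(x-1) (A - t^((y-x)/2))²` is positive, and `A =
Γ((x+y)/2)/Γ(x)` is the minimizer of this quadratic in `A`. -/
theorem Real.Gamma_midpoint_sq_lt {x y : ℝ} (hx : 0 < x) (hxy : x < y) :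
    Real.Gamma ((x + y) / 2) ^ 2 < Real.Gamma x * Real.Gamma y := by
  have hy : 0 < y := hx.trans hxy
  have hm : 0 < (x + y) / 2 := by linarith
  have gx := Real.Gamma_pos_of_pos hx
  have gm := Real.Gamma_pos_of_pos hm
  set A := Real.Gamma ((x + y) / 2) / Real.Gamma x with hA
  have hA0 : 0 < A := by positivity
  set F : ℝ → ℝ := fun t => A ^ 2 * (Real.exp (-t) * t ^ (x - 1))
    - 2 * A * (Real.exp (-t) * t ^ ((x + y) / 2 - 1)) + Real.exp (-t) * t ^ (y - 1) with hF
  have i1 := (Real.GammaIntegral_convergent hx).const_mul (A ^ 2)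
  have i2 := (Real.GammaIntegral_convergent hm).const_mul (2 * A)
  have i3 := Real.GammaIntegral_convergent hy
  have hFeq : ∀ t > 0, F t = Real.exp (-t) * t ^ (x - 1) * (A - t ^ ((y - x) / 2)) ^ 2 := by
    intro t ht
    have e1 : t ^ ((x + y) / 2 - 1) = t ^ (x - 1) * t ^ ((y - x) / 2) := by
      rw [← Real.rpow_add ht]; congr 1; ring
    have e2 : t ^ (y - 1) = t ^ (x - 1) * t ^ ((y - x) / 2) * t ^ ((y - x) / 2) := by
      rw [← Real.rpow_add ht, ← Real.rpow_add ht]; congr 1; ring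
    rw [hF]
    dsimp only
    rw [e1, e2]
    ring
  have hFint : ∫ t in Set.Ioi 0, F t
      = A ^ 2 * Real.Gamma x - 2 * A * Real.Gamma ((x + y) / 2) + Real.Gamma y := by
    have i12 : Integrable (fun t => A ^ 2 * (Real.exp (-t) * t ^ (x - 1))
        - 2 * A * (Real.exp (-t) * t ^ ((x + y) / 2 - 1))) (volume.restrict (Set.Ioi 0)) :=
      i1.sub i2
    rw [hF, integral_add i12 i3, integral_sub i1 i2, integral_const_mul,
      integral_const_mul, Real.Gamma_eq_integral hx, Real.Gamma_eq_integral hm,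
      Real.Gamma_eq_integral hy]
  have hpos : 0 < ∫ t in Set.Ioi 0, F t := by
    rw [setIntegral_pos_iff_support_of_nonneg_ae]
    · refine lt_of_lt_of_le ?_ (measure_mono (s := Set.Ioi (A ^ (2 / (y - x)))) fun t ht => ?_)
      · simp
      · have ht0 : 0 < t := (Real.rpow_pos_of_pos hA0 _).trans ht
        have hlt : A < t ^ ((y - x) / 2) := by
          have h := Real.rpow_lt_rpow (Real.rpow_pos_of_pos hA0 _).le ht
            (show 0 < (y - x) / 2 by linarith)
          rwa [← Real.rpow_mul hA0.le, div_mul_div_comm, mul_comm 2, div_self, Real.rpow_one] at h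
          have : y - x ≠ 0 := by linarith
          positivity
        refine ⟨?_, ht0⟩
        rw [Function.mem_support, hFeq t ht0]
        have : A - t ^ ((y - x) / 2) ≠ 0 := by linarith
        positivity
    · filter_upwards [ae_restrict_mem measurableSet_Ioi] with t ht
      rw [hFeq t ht]
      have : (0 : ℝ) < t := ht
      simp only [Pi.zero_apply]
      positivity
    · exact (i1.sub i2).add i3
  rw [hFint] at hpos
  have e : A ^ 2 * Real.Gamma x - 2 * A * Real.Gamma ((x + y) / 2) + Real.Gamma y
      = (Real.Gamma x * Real.Gamma y - Real.Gamma ((x + y) / 2) ^ 2) / Real.Gamma x := by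
    rw [hA]; field_simp; ring
  rw [e, div_pos_iff_of_pos_right gx] at hpos
  linarith

/-- Bringing the arguments closer, at constant sum, decreases a product of Gamma values. -/
theorem Real.Gamma_mul_Gamma_lt {x y s : ℝ} (hx : 0 < x) (hs : 0 < s) (hsy : s ≤ (y - x) / 2) :
    Real.Gamma (x + s) * Real.Gamma (y - s) < Real.Gamma x * Real.Gamma y := by
  have hxy : x < y := by linarith
  have hmid := Real.Gamma_midpoint_sq_lt hx hxy
  -- The points `x + s` and `y - s` divide the segments from `x` and from `y` to the midpoint in the
  -- same ratio `θ`. Convexity on both segments reduces the claim to the strict midpoint inequality.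
  set θ := s / ((y - x) / 2) with hθ
  have hd : 0 < (y - x) / 2 := by linarith
  have hθ0 : 0 < θ := by positivity
  have hθ1 : θ ≤ 1 := (div_le_one hd).2 hsy
  have hθs : θ * ((y - x) / 2) = s := by rw [hθ, div_mul_cancel₀ _ hd.ne']
  have hm : 0 < (x + y) / 2 := by linarith
  have gx := Real.Gamma_pos_of_pos hx
  have gy := Real.Gamma_pos_of_pos (show 0 < y by linarith)
  have gm := Real.Gamma_pos_of_pos hm
  have g1 := Real.Gamma_pos_of_pos (show 0 < x + s by linarith)
  have g2 := Real.Gamma_pos_of_pos (show 0 < y - s by linarith)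
  have c1 := Real.convexOn_log_Gamma.2 (Set.mem_Ioi.2 hx) (Set.mem_Ioi.2 hm)
    (show 0 ≤ 1 - θ by linarith) hθ0.le (by ring)
  have c2 := Real.convexOn_log_Gamma.2 (Set.mem_Ioi.2 (show 0 < y by linarith)) (Set.mem_Ioi.2 hm)
    (show 0 ≤ 1 - θ by linarith) hθ0.le (by ring)
  simp only [smul_eq_mul, Function.comp_apply] at c1 c2
  rw [show (1 - θ) * x + θ * ((x + y) / 2) = x + s by rw [← hθs]; ring] at c1
  rw [show (1 - θ) * y + θ * ((x + y) / 2) = y - s by rw [← hθs]; ring] at c2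
  have hlog := Real.log_lt_log (by positivity) hmid
  rw [Real.log_pow, Real.log_mul gx.ne' gy.ne'] at hlog
  push_cast at hlog
  rw [← Real.log_lt_log_iff (by positivity) (by positivity), Real.log_mul g1.ne' g2.ne',
    Real.log_mul gx.ne' gy.ne']
  nlinarith

/-! ### Integrals of the generalized inverse Gaussian weight -/

theorem gigWeight_pos (r a b : ℝ) {x : ℝ} (hx : 0 < x) : 0 < gigWeight r a b x :=
  mul_pos (Real.rpow_pos_of_pos hx _) (Real.exp_pos _)

theorem gigWeight_add (r s a b : ℝ) {x : ℝ} (hx : 0 < x) :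
    gigWeight (r + s) a b x = x ^ s * gigWeight r a b x := by
  rw [gigWeight, gigWeight, ← mul_assoc, ← Real.rpow_add hx]
  congr 2
  ring

theorem measurable_gigWeight' (r a b : ℝ) : Measurable (gigWeight r a b) := by
  unfold gigWeight
  fun_prop

/-- The normalizing integral of the `GIG` family. -/
def gigIntegral (r a b : ℝ) : ℝ := ∫ x in Set.Ioi 0, gigWeight r a b x

theorem gigIntegral_pos {r a b : ℝ} (h : IntegrableOn (gigWeight r a b) (Set.Ioi 0)) :
    0 < gigIntegral r a b := by
  rw [gigIntegral, setIntegral_pos_iff_support_of_nonneg_ae _ h]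
  · refine lt_of_lt_of_le ?_ (measure_mono (s := Set.Ioi 0) fun t ht =>
      ⟨(gigWeight_pos r a b ht).ne', ht⟩)
    simp
  · filter_upwards [ae_restrict_mem measurableSet_Ioi] with t ht
    exact (gigWeight_pos r a b ht).le

theorem integrableOn_gigWeight_of_pos_left {r a : ℝ} (ha : 0 < a) (hr : 0 < r) :
    IntegrableOn (gigWeight r a 0) (Set.Ioi 0) := by
  refine Integrable.of_integral_ne_zero ?_
  have h : ∫ x in Set.Ioi 0, gigWeight r a 0 x
      = ∫ t in Set.Ioi 0, t ^ (r - 1) * Real.exp (-(a / 2 * t)) :=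
    integral_congr_ae (.of_forall fun x => by simp only [gigWeight]; congr 2; ring)
  rw [h, Real.integral_rpow_mul_exp_neg_mul_Ioi hr (by positivity)]
  have := Real.Gamma_pos_of_pos hr
  positivity

/-- The substitution `x ↦ 1/x` turns this into a Gamma integral. -/
theorem gigIntegral_zero_left {r b : ℝ} (hb : 0 < b) (hr : r < 0) :
    gigIntegral r 0 b = Real.Gamma (-r) * (b / 2) ^ r := by
  have h := integral_comp_rpow_Ioi (fun y : ℝ => y ^ (-r - 1) * Real.exp (-(b / 2 * y)))
    (p := -1) (by norm_num)
  rw [Real.integral_rpow_mul_exp_neg_mul_Ioi (by linarith) (by positivity)] at h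
  rw [gigIntegral]
  calc _ = ∫ x in Set.Ioi (0 : ℝ), (|(-1 : ℝ)| * x ^ ((-1 : ℝ) - 1)) •
        ((x ^ (-1 : ℝ)) ^ (-r - 1) * Real.exp (-(b / 2 * x ^ (-1 : ℝ)))) := by
        refine setIntegral_congr_fun measurableSet_Ioi fun x hx => ?_
        have hx0 : (0 : ℝ) < x := hx
        simp only [gigWeight, smul_eq_mul, abs_neg, abs_one, one_mul]
        rw [← Real.rpow_mul hx0.le, ← mul_assoc, ← Real.rpow_add hx0, Real.rpow_neg_one]
        congr 2 <;> ring
    _ = _ := h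
    _ = _ := by rw [mul_comm, one_div, Real.inv_rpow (by positivity), ← Real.rpow_neg
          (by positivity), neg_neg]

theorem integrableOn_gigWeight_of_pos_right {r b : ℝ} (hb : 0 < b) (hr : r < 0) :
    IntegrableOn (gigWeight r 0 b) (Set.Ioi 0) := by
  refine Integrable.of_integral_ne_zero ?_
  have h := gigIntegral_zero_left hb hr
  rw [gigIntegral] at h
  rw [h]
  have := Real.Gamma_pos_of_pos (show 0 < -r by linarith)
  positivity

/-- Domination by a gamma weight for `x ≥ 1` and by an inverse gamma weight for `x ≤ 1`, with
exponents moved to the side where these converge. -/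
theorem integrableOn_gigWeight_of_pos {r a b : ℝ} (ha : 0 < a) (hb : 0 < b) :
    IntegrableOn (gigWeight r a b) (Set.Ioi 0) := by
  have i1 := integrableOn_gigWeight_of_pos_left ha (show 0 < max r 0 + 1 by positivity)
  have i2 := integrableOn_gigWeight_of_pos_right hb
    (show min r 0 - 1 < 0 by linarith [min_le_right r 0])
  refine Integrable.mono' (i1.add i2) (measurable_gigWeight' r a b).aestronglyMeasurable ?_
  filter_upwards [ae_restrict_mem measurableSet_Ioi] with x hx
  have hx0 : 0 < x := hx
  rw [Real.norm_of_nonneg (gigWeight_pos _ _ _ hx0).le]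
  have p1 := (gigWeight_pos (max r 0 + 1) a 0 hx0).le
  have p2 := (gigWeight_pos (min r 0 - 1) 0 b hx0).le
  have q1 : 0 ≤ b / x := by positivity
  have q2 : 0 ≤ a * x := by positivity
  simp only [Pi.add_apply]
  rcases le_total 1 x with h | h
  · refine le_add_of_le_of_nonneg ?_ p2
    rw [gigWeight, gigWeight]
    refine mul_le_mul (Real.rpow_le_rpow_of_exponent_le h ?_) (Real.exp_le_exp.2 ?_)
      (Real.exp_pos _).le (by positivity)
    · linarith [le_max_left r 0]
    · simp only [zero_div]; linarith
  · refine le_add_of_nonneg_of_le p1 ?_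
    rw [gigWeight, gigWeight]
    refine mul_le_mul (Real.rpow_le_rpow_of_exponent_ge hx0 h ?_) (Real.exp_le_exp.2 ?_)
      (Real.exp_pos _).le (by positivity)
    · linarith [min_le_left r 0]
    · linarith

theorem integrableOn_gigWeight {r a b : ℝ} (h : GIGAdmissible r a b) :
    IntegrableOn (gigWeight r a b) (Set.Ioi 0) := by
  rcases h with ⟨ha, hb⟩ | ⟨rfl, hb, hr⟩ | ⟨ha, rfl, hr⟩
  · exact integrableOn_gigWeight_of_pos ha hb
  · exact integrableOn_gigWeight_of_pos_right hb hr
  · exact integrableOn_gigWeight_of_pos_left ha hr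

/-- Integration by parts: the three-term recurrence of the Bessel functions. -/
theorem gigIntegral_recurrence {a b : ℝ} (c : ℝ) (ha : 0 < a) (hb : 0 < b) :
    c * gigIntegral c a b - a / 2 * gigIntegral (c + 1) a b + b / 2 * gigIntegral (c - 1) a b
      = 0 := by
  have i0 := (integrableOn_gigWeight_of_pos (r := c) ha hb).const_mul c
  have i1 := (integrableOn_gigWeight_of_pos (r := c + 1) ha hb).const_mul (a / 2)
  have i2 := (integrableOn_gigWeight_of_pos (r := c - 1) ha hb).const_mul (b / 2)
  set u : ℝ → ℝ := fun x => x ^ c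
  set v : ℝ → ℝ := fun x => Real.exp (-(1 / 2) * (a * x + b / x))
  have hu : ∀ x ∈ Set.Ioi (0 : ℝ), HasDerivAt u (c * x ^ (c - 1)) x := fun x hx =>
    Real.hasDerivAt_rpow_const (Or.inl (ne_of_gt hx))
  have hv : ∀ x ∈ Set.Ioi (0 : ℝ), HasDerivAt v (v x * (-(1 / 2) * (a - b / x ^ 2))) x := by
    intro x hx
    have hx0 : x ≠ 0 := ne_of_gt hx
    have h1 : HasDerivAt (fun x : ℝ => -(1 / 2) * (a * x + b / x))
        (-(1 / 2) * (a - b / x ^ 2)) x := by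
      have h2 : HasDerivAt (fun x : ℝ => -(1 / 2) * (a * x + b * x⁻¹))
          (-(1 / 2) * (a * 1 + b * -(x ^ 2)⁻¹)) x :=
        (((hasDerivAt_id x).const_mul a).add ((hasDerivAt_inv hx0).const_mul b)).const_mul _
      rw [show a - b / x ^ 2 = a * 1 + b * -(x ^ 2)⁻¹ by rw [div_eq_mul_inv]; ring]
      simpa only [div_eq_mul_inv b] using h2
    exact h1.exp
  have hF : ∀ x ∈ Set.Ioi (0 : ℝ), c * x ^ (c - 1) * v x
        + u x * (v x * (-(1 / 2) * (a - b / x ^ 2)))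
      = c * gigWeight c a b x - a / 2 * gigWeight (c + 1) a b x
        + b / 2 * gigWeight (c - 1) a b x := by
    intro x hx
    have hx0 : (0 : ℝ) < x := hx
    rw [show c - 1 = c + (-1) by ring, gigWeight_add _ _ _ _ hx0, gigWeight_add _ _ _ _ hx0,
      show c + -1 = c - 1 by ring]
    have e1 : u x = x * x ^ (c - 1) := by
      change x ^ c = _
      rw [Real.rpow_sub_one hx0.ne']; field_simp
    rw [e1, Real.rpow_one, Real.rpow_neg_one, gigWeight]
    change _ = c * (x ^ (c - 1) * v x) - a / 2 * (x * (x ^ (c - 1) * v x))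
      + b / 2 * (x⁻¹ * (x ^ (c - 1) * v x))
    field_simp
    ring
  have hInt : IntegrableOn (fun x => c * gigWeight c a b x - a / 2 * gigWeight (c + 1) a b x
        + b / 2 * gigWeight (c - 1) a b x) (Set.Ioi 0) := (i0.sub i1).add i2
  -- The boundary terms vanish for every `c`: `exp(-a x/2)` acts at infinity and `exp(-b/(2x))` at
  -- zero.
  have hbound : ∀ x > 0, (u * v) x ≤ x ^ c * Real.exp (-(a / 2) * x) ∧
      (u * v) x ≤ (x⁻¹) ^ (-c) * Real.exp (-(b / 2) * x⁻¹) := by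
    intro x hx
    have q1 : 0 ≤ b / x := by positivity
    have q2 : 0 ≤ a * x := by positivity
    rw [Real.inv_rpow hx.le, ← Real.rpow_neg hx.le, neg_neg, ← div_eq_mul_inv]
    simp only [Pi.mul_apply, u, v]
    constructor <;> refine mul_le_mul_of_nonneg_left (Real.exp_le_exp.2 ?_) (by positivity)
    · linarith
    · have : -(b / 2) / x = -(b / x / 2) := by ring
      linarith
  have hnn : ∀ x > 0, 0 ≤ (u * v) x := fun x hx => by
    simp only [Pi.mul_apply, u, v]; positivity
  have h0 : Filter.Tendsto (u * v) (nhdsWithin 0 (Set.Ioi 0)) (nhds 0) := by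
    have := (tendsto_rpow_mul_exp_neg_mul_atTop_nhds_zero (-c) (b / 2) (by positivity)).comp
      (tendsto_inv_nhdsGT_zero (𝕜 := ℝ))
    refine squeeze_zero' ?_ ?_ this
    · filter_upwards [self_mem_nhdsWithin] with x hx using hnn x hx
    · filter_upwards [self_mem_nhdsWithin] with x hx using (hbound x hx).2
  have h1 : Filter.Tendsto (u * v) Filter.atTop (nhds 0) := by
    refine squeeze_zero' ?_ ?_
      (tendsto_rpow_mul_exp_neg_mul_atTop_nhds_zero c (a / 2) (by positivity))
    · filter_upwards [Filter.eventually_gt_atTop 0] with x hx using hnn x hx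
    · filter_upwards [Filter.eventually_gt_atTop 0] with x hx using (hbound x hx).1
  have hmain := integral_Ioi_deriv_mul_eq_sub hu hv
    (hInt.congr_fun (fun x hx => (hF x hx).symm) measurableSet_Ioi) h0 h1
  have i01 : Integrable (fun x => c * gigWeight c a b x - a / 2 * gigWeight (c + 1) a b x)
      (volume.restrict (Set.Ioi 0)) := i0.sub i1
  rw [setIntegral_congr_fun measurableSet_Ioi hF, integral_add i01 i2,
    integral_sub i0 i1, integral_const_mul, integral_const_mul, integral_const_mul,
    sub_zero] at hmain
  exact hmain

/-! ### Moments of the generalized inverse Gaussian law -/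

/-- From `x ≤ t/2 + x²/(2t)`. A large `t` lets the second moment absorb the first at a small cost.
-/
theorem gigIntegral_add_one_le {q a b t : ℝ} (ha : 0 < a) (hb : 0 < b) (ht : 0 < t) :
    gigIntegral (q + 1) a b ≤ t / 2 * gigIntegral q a b + 1 / (2 * t) * gigIntegral (q + 2) a b := by
  have i0 := (integrableOn_gigWeight_of_pos (r := q) ha hb).const_mul (t / 2)
  have i1 := integrableOn_gigWeight_of_pos (r := q + 1) ha hb
  have i2 := (integrableOn_gigWeight_of_pos (r := q + 2) ha hb).const_mul (1 / (2 * t))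
  simp only [gigIntegral]
  rw [← integral_const_mul, ← integral_const_mul, ← integral_add i0 i2]
  refine setIntegral_mono_on i1 (i0.add i2) measurableSet_Ioi fun x hx => ?_
  have hx0 : 0 < x := hx
  rw [gigWeight_add _ _ _ _ hx0, gigWeight_add _ _ _ _ hx0, Real.rpow_one, Real.rpow_two,
    ← mul_assoc, ← add_mul]
  refine mul_le_mul_of_nonneg_right ?_ (gigWeight_pos _ _ _ hx0).le
  rw [← sub_nonneg, show t / 2 + 1 / (2 * t) * x ^ 2 - x = (t - x) ^ 2 / (2 * t) by
    field_simp; ring]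
  positivity

/-- The second moment is asymptotically at most `b / a`, uniformly in `b`. -/
theorem exists_gigIntegral_add_two_le (q : ℝ) {a ε : ℝ} (ha : 0 < a) (hε : 0 < ε) :
    ∃ C : ℝ, 0 ≤ C ∧ ∀ b > 0,
      gigIntegral (q + 2) a b ≤ ((1 + ε) / a * b + C) * gigIntegral q a b := by
  -- Chosen so that `|q + 1| / t ≤ a ε / (1 + ε)`. The first-moment term of the recurrence then
  -- takes at most this share of `a`, leaving `a / (1 + ε)` in front of the second moment. The `+ 1`
  -- keeps `t` positive when `q = -1`.
  set t := |q + 1| * (1 + ε) / (a * ε) + 1 with ht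
  have ht0 : 0 < t := by positivity
  refine ⟨(1 + ε) / a * (|q + 1| * t), by positivity, fun b hb => ?_⟩
  have hrec := gigIntegral_recurrence (q + 1) ha hb
  rw [show q + 1 + 1 = q + 2 by ring, add_sub_cancel_right] at hrec
  have h0 := gigIntegral_pos (integrableOn_gigWeight_of_pos (r := q) ha hb)
  have h1 := gigIntegral_pos (integrableOn_gigWeight_of_pos (r := q + 1) ha hb)
  have h2 := gigIntegral_pos (integrableOn_gigWeight_of_pos (r := q + 2) ha hb)
  have hle := mul_le_mul_of_nonneg_left (gigIntegral_add_one_le (q := q) ha hb ht0)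
    (abs_nonneg (q + 1))
  have habs : (q + 1) * gigIntegral (q + 1) a b ≤ |q + 1| * gigIntegral (q + 1) a b :=
    mul_le_mul_of_nonneg_right (le_abs_self _) h1.le
  have hqt : |q + 1| / t ≤ a * ε / (1 + ε) := by
    rw [div_le_div_iff₀ ht0 (by positivity), ht]
    have : a * ε * (|q + 1| * (1 + ε) / (a * ε) + 1) = |q + 1| * (1 + ε) + a * ε := by
      field_simp
    rw [this]
    have : 0 ≤ a * ε := by positivity
    linarith
  have hqt2 := mul_le_mul_of_nonneg_right hqt h2.le
  have e1 : |q + 1| * (t / 2 * gigIntegral q a b + 1 / (2 * t) * gigIntegral (q + 2) a b)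
      = |q + 1| * t / 2 * gigIntegral q a b + |q + 1| / t * gigIntegral (q + 2) a b / 2 := by
    field_simp
  rw [e1] at hle
  have e2 : a / (1 + ε) = a - a * ε / (1 + ε) := by field_simp; ring
  have key : a / (1 + ε) * gigIntegral (q + 2) a b ≤ (b + |q + 1| * t) * gigIntegral q a b := by
    rw [e2]; linarith
  calc gigIntegral (q + 2) a b
      = (1 + ε) / a * (a / (1 + ε) * gigIntegral (q + 2) a b) := by field_simp
    _ ≤ (1 + ε) / a * ((b + |q + 1| * t) * gigIntegral q a b) := by gcongr
    _ = _ := by ring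

/-- The moment of order `-1` is bounded, uniformly in `b` away from `0`. -/
theorem exists_gigIntegral_sub_one_le (q : ℝ) {a b₀ : ℝ} (ha : 0 < a) (hb₀ : 0 < b₀) :
    ∃ C : ℝ, 0 ≤ C ∧ ∀ b ≥ b₀, gigIntegral (q - 1) a b ≤ C * gigIntegral q a b := by
  obtain ⟨C, hC, hsq⟩ := exists_gigIntegral_add_two_le q ha one_pos
  -- The recurrence at `q` expresses `b I(q-1)` by `I(q)` and `I(q+1)`. The latter is at most `(I(q)
  -- + I(q+2))/2`, and `I(q+2)` grows linearly in `b`; division by `b ≥ b₀` gives the constant.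
  refine ⟨1 + (a / 2 + a * C / 2 + 2 * |q|) / b₀, by positivity, fun b hb => ?_⟩
  have hb0 : 0 < b := hb₀.trans_le hb
  have hrec := gigIntegral_recurrence q ha hb0
  have h0 := gigIntegral_pos (integrableOn_gigWeight_of_pos (r := q) ha hb0)
  have h1 := gigIntegral_add_one_le (q := q) ha hb0 one_pos
  have h2 := hsq b hb0
  have habs : -q * gigIntegral q a b ≤ |q| * gigIntegral q a b :=
    mul_le_mul_of_nonneg_right (neg_le_abs _) h0.le
  have e1 : a / 2 * (((1 + 1) / a * b + C) * gigIntegral q a b)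
      = (b + a * C / 2) * gigIntegral q a b := by field_simp; ring
  have h1' := mul_le_mul_of_nonneg_left h1 ha.le
  have h2' := mul_le_mul_of_nonneg_left h2 (show 0 ≤ a / 2 by positivity)
  rw [e1] at h2'
  have key : b * gigIntegral (q - 1) a b
      ≤ (b + (a / 2 + a * C / 2 + 2 * |q|)) * gigIntegral q a b := by
    nlinarith
  have hbb : b + (a / 2 + a * C / 2 + 2 * |q|)
      ≤ b * (1 + (a / 2 + a * C / 2 + 2 * |q|) / b₀) := by
    have h3 : a / 2 + a * C / 2 + 2 * |q| ≤ b * ((a / 2 + a * C / 2 + 2 * |q|) / b₀) := by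
      rw [mul_div_assoc', le_div_iff₀ hb₀, mul_comm]
      gcongr
    linarith
  have := key.trans (mul_le_mul_of_nonneg_right hbb h0.le)
  rw [mul_assoc] at this
  exact le_of_mul_le_mul_left this hb0

/-- Negative moments decrease in the order parameter of the law. -/
theorem gigIntegral_sub_mul_le {q q' a b s : ℝ} (ha : 0 < a) (hb : 0 < b) (hs : 0 < s)
    (hq : q' ≤ q) :
    gigIntegral (q - s) a b * gigIntegral q' a b
      ≤ gigIntegral (q' - s) a b * gigIntegral q a b := by
  have i : ∀ r, IntegrableOn (gigWeight r a b) (Set.Ioi 0) := fun r =>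
    integrableOn_gigWeight_of_pos ha hb
  have p := fun r => gigIntegral_pos (i r)
  set m := gigIntegral (q' - s) a b / gigIntegral q' a b with hm
  have hm0 : 0 < m := div_pos (p _) (p _)
  set x₀ := m ^ (-s⁻¹) with hx₀
  have hx₀0 : 0 < x₀ := Real.rpow_pos_of_pos hm0 _
  have hx₀s : x₀ ^ (-s) = m := by
    rw [hx₀, ← Real.rpow_mul hm0.le, neg_mul_neg, inv_mul_cancel₀ hs.ne', Real.rpow_one]
  set D := x₀ ^ (q - q') with hD
  -- Chebyshev's correlation inequality under order `q'`: `x^(q-q')` is nondecreasing, `x^(-s)` is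
  -- decreasing with mean `m`, and both are compared with their values at `x₀`, where `x₀^(-s) = m`.
  have hpt : ∀ x ∈ Set.Ioi (0 : ℝ), gigWeight (q - s) a b x
      ≤ m * gigWeight q a b x + D * gigWeight (q' - s) a b x - D * m * gigWeight q' a b x := by
    intro x hx
    have hx0 : 0 < x := hx
    have e1 : gigWeight (q - s) a b x = x ^ (q - q') * (x ^ (-s) * gigWeight q' a b x) := by
      rw [← gigWeight_add _ _ _ _ hx0, ← gigWeight_add _ _ _ _ hx0]; congr 1; ring
    have e2 : gigWeight q a b x = x ^ (q - q') * gigWeight q' a b x := by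
      rw [← gigWeight_add _ _ _ _ hx0]; congr 1; ring
    have e3 : gigWeight (q' - s) a b x = x ^ (-s) * gigWeight q' a b x := by
      rw [← gigWeight_add _ _ _ _ hx0]; congr 1
    rw [e1, e2, e3]
    have hw := gigWeight_pos q' a b hx0
    have hopp : (x ^ (q - q') - D) * (x ^ (-s) - m) ≤ 0 := by
      rcases le_total x x₀ with h | h
      · refine mul_nonpos_of_nonpos_of_nonneg ?_ ?_
        · rw [sub_nonpos]; exact Real.rpow_le_rpow hx0.le h (by linarith)
        · rw [sub_nonneg, ← hx₀s]; exact Real.rpow_le_rpow_of_nonpos hx0 h (by linarith)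
      · refine mul_nonpos_of_nonneg_of_nonpos ?_ ?_
        · rw [sub_nonneg]; exact Real.rpow_le_rpow hx₀0.le h (by linarith)
        · rw [sub_nonpos, ← hx₀s]; exact Real.rpow_le_rpow_of_nonpos hx₀0 h (by linarith)
    have := mul_nonpos_of_nonpos_of_nonneg hopp hw.le
    linarith
  have i1 := (i q).const_mul m
  have i2 := (i (q' - s)).const_mul D
  have i3 := (i q').const_mul (D * m)
  have i12 : IntegrableOn (fun x => m * gigWeight q a b x + D * gigWeight (q' - s) a b x)
    (Set.Ioi 0) := i1.add i2
  have i123 : IntegrableOn (fun x => m * gigWeight q a b x + D * gigWeight (q' - s) a b x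
    - D * m * gigWeight q' a b x) (Set.Ioi 0) := i12.sub i3
  have h := setIntegral_mono_on (i (q - s)) i123 measurableSet_Ioi hpt
  rw [integral_sub i12 i3, integral_add i1 i2, integral_const_mul, integral_const_mul,
    integral_const_mul] at h
  change gigIntegral (q - s) a b ≤ m * gigIntegral q a b + D * gigIntegral (q' - s) a b
    - D * m * gigIntegral q' a b at h
  have e : D * gigIntegral (q' - s) a b = D * m * gigIntegral q' a b := by
    rw [hm]; field_simp [(p q').ne']
  rw [e, add_sub_cancel_right, hm, div_mul_eq_mul_div] at h
  rwa [le_div_iff₀ (p _)] at h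

/-- Sharp bound for the negative moments as `b → 0`, for a negative order parameter. -/
theorem exists_gigIntegral_sub_le_of_neg {q a s lam : ℝ} (ha : 0 < a) (hq : q < 0) (hq1 : -1 ≤ q)
    (hs : 0 < s) (hs1 : s ≤ 1) (hlam : Real.Gamma (s - q) / Real.Gamma (-q) < lam) :
    ∃ C : ℝ, 0 ≤ C ∧ ∀ b > 0,
      gigIntegral (q - s) a b ≤ (lam * (b / 2) ^ (-s) + C) * gigIntegral q a b := by
  -- This `δ` keeps `q + δ` negative, so the correction integral at `a = 0` converges, and `δ ≤ 1`
  -- is what `1 - u^δ ≤ e^(-u)` needs.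
  set δ := -q / 2 with hδ
  have hδ0 : 0 < δ := by rw [hδ]; linarith
  have hδ1 : δ ≤ 1 := by rw [hδ]; linarith
  have g1 := Real.Gamma_pos_of_pos (show 0 < -q by linarith)
  have g2 := Real.Gamma_pos_of_pos (show 0 < s - q by linarith)
  have g3 := Real.Gamma_pos_of_pos (show 0 < -(q + δ) by rw [hδ]; linarith)
  have hlam0 : 0 < lam := (div_pos g2 g1).trans hlam
  -- a threshold for `b`
  set D : ℝ → ℝ := fun b => Real.Gamma (-q)
    - (a / 2) ^ δ * Real.Gamma (-(q + δ)) * (b / 2) ^ δ with hD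
  have hcont : Filter.Tendsto (fun b => lam * D b) (nhds 0) (nhds (lam * Real.Gamma (-q))) := by
    have hb : Filter.Tendsto (fun b : ℝ => (b / 2) ^ δ) (nhds 0) (nhds 0) := by
      have hc : Continuous fun b : ℝ => (b / 2) ^ δ :=
        (Real.continuous_rpow_const hδ0.le).comp (continuous_id.div_const 2)
      have := hc.tendsto 0
      simpa [Real.zero_rpow hδ0.ne'] using this
    have := ((hb.const_mul ((a / 2) ^ δ * Real.Gamma (-(q + δ)))).const_sub
      (Real.Gamma (-q))).const_mul lam
    simpa [hD] using this
  have hev := hcont.eventually_const_lt (show Real.Gamma (s - q) < lam * Real.Gamma (-q) by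
    rwa [div_lt_iff₀ g1] at hlam)
  obtain ⟨b₁, hb₁, hsmall⟩ := Metric.eventually_nhds_iff.1 hev
  obtain ⟨C, hC, hlarge⟩ := exists_gigIntegral_sub_one_le q ha hb₁
  refine ⟨1 + C, by positivity, fun b hb => ?_⟩
  have i : ∀ r, IntegrableOn (gigWeight r a b) (Set.Ioi 0) := fun r =>
    integrableOn_gigWeight_of_pos ha hb
  have p := fun r => gigIntegral_pos (i r)
  rcases lt_or_ge b b₁ with hbb | hbb
  -- For small `b` compare with `a = 0`: dropping `e^(-a x/2)` bounds the numerator above. For the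
  -- denominator `e^(-u) ≥ 1 - u^δ` leaves the factor `D b`, which tends to `Γ(-q)` as `b → 0`.
  · have hnum : gigIntegral (q - s) a b ≤ Real.Gamma (s - q) * (b / 2) ^ (q - s) := by
      rw [show s - q = -(q - s) by ring, ← gigIntegral_zero_left hb (show q - s < 0 by linarith)]
      refine setIntegral_mono_on (i _) (integrableOn_gigWeight_of_pos_right hb (by linarith))
        measurableSet_Ioi fun x hx => ?_
      have hx0 : 0 < x := hx
      have q2 : 0 ≤ a * x := by positivity
      refine mul_le_mul_of_nonneg_left (Real.exp_le_exp.2 ?_) (by positivity)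
      linarith
    have hden : D b * (b / 2) ^ q ≤ gigIntegral q a b := by
      have j1 := integrableOn_gigWeight_of_pos_right hb hq
      have j2 := (integrableOn_gigWeight_of_pos_right hb (show q + δ < 0 by
        rw [hδ]; linarith)).const_mul ((a / 2) ^ δ)
      have e : D b * (b / 2) ^ q = gigIntegral q 0 b - (a / 2) ^ δ * gigIntegral (q + δ) 0 b := by
        rw [gigIntegral_zero_left hb hq, gigIntegral_zero_left hb (by rw [hδ]; linarith), hD,
          Real.rpow_add (by positivity)]
        ring
      rw [e]
      simp only [gigIntegral]
      rw [← integral_const_mul, ← integral_sub j1 j2]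
      refine setIntegral_mono_on (j1.sub j2) (i _) measurableSet_Ioi fun x hx => ?_
      have hx0 : 0 < x := hx
      have q2 : 0 ≤ a / 2 * x := by positivity
      have e2 : gigWeight q a b x = Real.exp (-(a / 2 * x)) * gigWeight q 0 b x := by
        rw [gigWeight, gigWeight, mul_left_comm, ← Real.exp_add]
        congr 2
        ring
      rw [e2, gigWeight_add _ _ _ _ hx0, ← mul_assoc, ← Real.mul_rpow (by positivity) hx0.le]
      have hexp : 1 - (a / 2 * x) ^ δ ≤ Real.exp (-(a / 2 * x)) := by
        rcases le_total (a / 2 * x) 1 with h | h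
        · have h1 := Real.one_sub_le_exp_neg (a / 2 * x)
          have h2 : a / 2 * x ≤ (a / 2 * x) ^ δ := by
            conv_lhs => rw [← Real.rpow_one (a / 2 * x)]
            exact Real.rpow_le_rpow_of_exponent_ge (by positivity) h hδ1
          linarith
        · have h1 := Real.one_le_rpow h hδ0.le
          have h2 := Real.exp_pos (-(a / 2 * x))
          linarith
      have := mul_le_mul_of_nonneg_right hexp (gigWeight_pos q 0 b hx0).le
      linarith
    have hsm := hsmall (y := b) (by rwa [Real.dist_eq, sub_zero, abs_of_pos hb])
    have hsplit : (b / 2) ^ (q - s) = (b / 2) ^ (-s) * (b / 2) ^ q := by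
      rw [← Real.rpow_add (by positivity)]; congr 1; ring
    calc gigIntegral (q - s) a b ≤ Real.Gamma (s - q) * (b / 2) ^ (q - s) := hnum
      _ ≤ lam * D b * (b / 2) ^ (q - s) := by gcongr
      _ = lam * (b / 2) ^ (-s) * (D b * (b / 2) ^ q) := by rw [hsplit]; ring
      _ ≤ lam * (b / 2) ^ (-s) * gigIntegral q a b := by gcongr
      _ ≤ _ := by
        have := p q
        refine mul_le_mul_of_nonneg_right ?_ this.le
        linarith
  -- For `b` away from zero `x^(-s) ≤ 1 + x⁻¹` reduces to the bounded moment of order `-1`.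
  · have h1 : gigIntegral (q - s) a b ≤ gigIntegral q a b + gigIntegral (q - 1) a b := by
      simp only [gigIntegral]
      rw [← integral_add (i _) (i _)]
      refine setIntegral_mono_on (i _) ((i _).add (i _)) measurableSet_Ioi fun x hx => ?_
      have hx0 : 0 < x := hx
      rw [sub_eq_add_neg, sub_eq_add_neg, gigWeight_add _ _ _ _ hx0, gigWeight_add _ _ _ _ hx0,
        ← one_add_mul]
      refine mul_le_mul_of_nonneg_right ?_ (gigWeight_pos _ _ _ hx0).le
      rcases le_total x 1 with h | h
      · have : x ^ (-s) ≤ x ^ (-1 : ℝ) :=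
          Real.rpow_le_rpow_of_exponent_ge hx0 h (by linarith)
        linarith
      · have : x ^ (-s) ≤ 1 := Real.rpow_le_one_of_one_le_of_nonpos h (by linarith)
        have : 0 ≤ x ^ (-1 : ℝ) := by positivity
        linarith
    have h2 := hlarge b hbb
    have h3 : 0 ≤ lam * (b / 2) ^ (-s) * gigIntegral q a b :=
      mul_nonneg (by positivity) (p q).le
    linarith

/-- The order `q` may have any sign, while the asymptotics above need a negative one. Monotonicity
in the order transfers the bound from `q'` to `q`. -/
theorem exists_gigIntegral_sub_le {q q' a s lam : ℝ} (ha : 0 < a) (hq' : q' < 0) (hq1 : -1 ≤ q')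
    (hqq : q' ≤ q) (hs : 0 < s) (hs1 : s ≤ 1)
    (hlam : Real.Gamma (s - q') / Real.Gamma (-q') < lam) :
    ∃ C : ℝ, 0 ≤ C ∧ ∀ b > 0,
      gigIntegral (q - s) a b ≤ (lam * (b / 2) ^ (-s) + C) * gigIntegral q a b := by
  obtain ⟨C, hC, h⟩ := exists_gigIntegral_sub_le_of_neg ha hq' hq1 hs hs1 hlam
  refine ⟨C, hC, fun b hb => ?_⟩
  have p := fun r => gigIntegral_pos (integrableOn_gigWeight_of_pos (r := r) ha hb)
  have h1 := gigIntegral_sub_mul_le ha hb hs hqq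
  have h2 := mul_le_mul_of_nonneg_right (h b hb) (p q).le
  refine le_of_mul_le_mul_right ?_ (p q')
  linarith

/-! ### The GIG density -/

theorem lintegral_gigWeight {r a b : ℝ} (h : IntegrableOn (gigWeight r a b) (Set.Ioi 0)) :
    ∫⁻ y in Set.Ioi (0 : ℝ), ENNReal.ofReal (gigWeight r a b y)
      = ENNReal.ofReal (gigIntegral r a b) :=
  (ofReal_integral_eq_lintegral_ofReal h
    (by filter_upwards [ae_restrict_mem measurableSet_Ioi] with t ht
        exact (gigWeight_pos r a b ht).le)).symm

theorem gigPDF_of_pos {r a b x : ℝ} (h : IntegrableOn (gigWeight r a b) (Set.Ioi 0)) (hx : 0 < x) :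
    gigPDF r a b x = ENNReal.ofReal (gigWeight r a b x / gigIntegral r a b) := by
  rw [gigPDF, if_pos hx, lintegral_gigWeight h, ENNReal.ofReal_div_of_pos (gigIntegral_pos h)]

theorem measurable_gigPDF' (r a b : ℝ) : Measurable (gigPDF r a b) :=
  (measurable_gigPDF r a).comp (measurable_const.prodMk measurable_id)

/-- No integrability is needed, since `Z * Z⁻¹ ≤ 1` also for `Z = 0` and `Z = ∞`. Hence unwanted
coordinates can be integrated out for every `M`. -/
theorem lintegral_gigPDF_le_one (r a b : ℝ) : ∫⁻ x in Set.Ioi 0, gigPDF r a b x ≤ 1 := by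
  set Z := ∫⁻ y in Set.Ioi (0 : ℝ), ENNReal.ofReal (gigWeight r a b y) with hZ
  have h : ∫⁻ x in Set.Ioi 0, gigPDF r a b x = Z * Z⁻¹ := by
    rw [hZ, ← lintegral_mul_const _ (measurable_gigWeight' r a b).ennreal_ofReal]
    refine setLIntegral_congr_fun measurableSet_Ioi fun x hx => ?_
    simp only [gigPDF, if_pos (Set.mem_Ioi.1 hx), div_eq_mul_inv]
  rw [h]
  exact ENNReal.mul_inv_le_one Z

theorem lintegral_gigPDF {r a b : ℝ} (h : IntegrableOn (gigWeight r a b) (Set.Ioi 0)) :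
    ∫⁻ x in Set.Ioi 0, gigPDF r a b x = 1 := by
  have hp := gigIntegral_pos h
  calc _ = ∫⁻ x in Set.Ioi 0, ENNReal.ofReal (gigWeight r a b x)
        * ENNReal.ofReal (gigIntegral r a b)⁻¹ := by
        refine setLIntegral_congr_fun measurableSet_Ioi fun x hx => ?_
        rw [gigPDF_of_pos h hx, div_eq_mul_inv, ENNReal.ofReal_mul (gigWeight_pos _ _ _ hx).le]
    _ = _ := by
      rw [lintegral_mul_const _ (measurable_gigWeight' r a b).ennreal_ofReal,
        lintegral_gigWeight h, ← ENNReal.ofReal_mul hp.le, mul_inv_cancel₀ hp.ne',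
        ENNReal.ofReal_one]

theorem lintegral_rpow_mul_gigPDF_le {r a b s c : ℝ}
    (h : IntegrableOn (gigWeight r a b) (Set.Ioi 0))
    (hs : IntegrableOn (gigWeight (r + s) a b) (Set.Ioi 0))
    (hc : gigIntegral (r + s) a b ≤ c * gigIntegral r a b) :
    ∫⁻ x in Set.Ioi 0, ENNReal.ofReal (x ^ s) * gigPDF r a b x ≤ ENNReal.ofReal c := by
  have hp := gigIntegral_pos h
  calc _ = ∫⁻ x in Set.Ioi 0, ENNReal.ofReal (gigWeight (r + s) a b x)
        * ENNReal.ofReal (gigIntegral r a b)⁻¹ := by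
        refine setLIntegral_congr_fun measurableSet_Ioi fun x hx => ?_
        have hx0 : 0 < x := hx
        rw [gigPDF_of_pos h hx, div_eq_mul_inv, ← ENNReal.ofReal_mul (by positivity),
          ← ENNReal.ofReal_mul (gigWeight_pos _ _ _ hx).le, gigWeight_add _ _ _ _ hx0, mul_assoc]
    _ = ENNReal.ofReal (gigIntegral (r + s) a b * (gigIntegral r a b)⁻¹) := by
      rw [lintegral_mul_const _ (measurable_gigWeight' _ a b).ennreal_ofReal,
        lintegral_gigWeight hs, ← ENNReal.ofReal_mul (gigIntegral_pos hs).le]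
    _ ≤ _ := by
      refine ENNReal.ofReal_le_ofReal ?_
      rwa [← div_eq_mul_inv, div_le_iff₀ hp]

/-- The `GIG(-α, 0, 2β)` law is the inverse gamma law. -/
theorem gigPDF_zero_left {α β : ℝ} (hα : 0 < α) (hβ : 0 < β) (x : ℝ) :
    gigPDF (-α) 0 (2 * β) x = invGammaPDF α β x := by
  by_cases hx : 0 < x
  · have g := Real.Gamma_pos_of_pos hα
    rw [gigPDF_of_pos (integrableOn_gigWeight_of_pos_right (by positivity) (by linarith)) hx,
      gigIntegral_zero_left (by positivity) (by linarith), invGammaPDF, if_pos hx, neg_neg,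
      mul_div_cancel_left₀ _ two_ne_zero, gigWeight, Real.rpow_neg hβ.le]
    congr 1
    rw [show -α - 1 = -(α + 1) by ring,
      show -(1 / 2) * (0 * x + 2 * β / x) = -β / x by ring]
    field_simp
  · rw [gigPDF, invGammaPDF, if_neg hx, if_neg hx]

/-! ### The conditional precision matrix and the conditional mean of the latent field -/

/-- A linear functional vanishing on the kernel of `B` factors through `B`; the coordinates of the
factor are `w`. -/
theorem exists_transpose_mulVec_eq {m n : ℕ} (B : Matrix (Fin m) (Fin n) ℝ) (f : Fin n → ℝ)
    (h : ∀ x, B *ᵥ x = 0 → f ⬝ᵥ x = 0) : ∃ w, Bᵀ *ᵥ w = f := by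
  set φ : Module.Dual ℝ (Fin n → ℝ) :=
    { toFun := fun x => f ⬝ᵥ x
      map_add' := fun x y => dotProduct_add f x y
      map_smul' := fun c x => dotProduct_smul c f x }
  have hφ : φ ∈ (LinearMap.ker B.mulVecLin).dualAnnihilator := by
    rw [Submodule.mem_dualAnnihilator]
    intro x hx
    exact h x (by simpa using hx)
  rw [← LinearMap.range_dualMap_eq_dualAnnihilator_ker] at hφ
  obtain ⟨ψ, hψ⟩ := hφ
  refine ⟨fun j => ψ (Pi.single j 1), ?_⟩
  ext i
  have h1 : f i = ψ (B *ᵥ Pi.single i 1) := by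
    have := LinearMap.congr_fun hψ (Pi.single i 1)
    simpa [φ] using this.symm
  have h2 : B *ᵥ Pi.single i 1 = ∑ j, B j i • (Pi.single j 1 : Fin m → ℝ) := by
    ext k
    simp [Finset.sum_apply, Pi.single_apply]
  rw [h1, h2, map_sum]
  simp [Matrix.mulVec, dotProduct]

namespace LLnGM

variable {m n k : ℕ} (L : LLnGM m n k)

theorem rho_pos (hσ : 0 < L.σ) (hσε : 0 < L.σε) : 0 < L.rho := by
  unfold rho; positivity

theorem dotProduct_QBar_mulVec (V x y : Fin n → ℝ) :
    x ⬝ᵥ (L.QBar V *ᵥ y) = L.rho * ((L.B *ᵥ x) ⬝ᵥ (L.B *ᵥ y)) + ∑ i, x i * y i / V i := by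
  rw [QBar, Matrix.add_mulVec, dotProduct_add, Matrix.smul_mulVec, dotProduct_smul, smul_eq_mul,
    ← Matrix.mulVec_mulVec, Matrix.dotProduct_mulVec, Matrix.vecMul_transpose]
  congr 1
  rw [dotProduct]
  refine Finset.sum_congr rfl fun i _ => ?_
  rw [Matrix.mulVec_diagonal]
  ring

variable {L} {V : Fin n → ℝ}

theorem QBar_isHermitian : (L.QBar V).IsHermitian := by
  simp [Matrix.IsHermitian, QBar, Matrix.transpose_mul]

theorem QBar_posDef (hρ : 0 < L.rho) (hV : ∀ i, 0 < V i) : (L.QBar V).PosDef := by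
  refine Matrix.PosDef.of_dotProduct_mulVec_pos QBar_isHermitian fun x hx => ?_
  rw [star_trivial, dotProduct_QBar_mulVec]
  obtain ⟨i, hi⟩ := Function.ne_iff.1 hx
  have h1 : 0 ≤ L.rho * ((L.B *ᵥ x) ⬝ᵥ (L.B *ᵥ x)) :=
    mul_nonneg hρ.le (Finset.sum_nonneg fun j _ => mul_self_nonneg _)
  have h2 : 0 < ∑ i, x i * x i / V i :=
    Finset.sum_pos' (fun j _ => div_nonneg (mul_self_nonneg _) (hV j).le)
      ⟨i, Finset.mem_univ _, div_pos (mul_self_pos.2 hi) (hV i)⟩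
  linarith

theorem QBar_mul_inv (hρ : 0 < L.rho) (hV : ∀ i, 0 < V i) : L.QBar V * (L.QBar V)⁻¹ = 1 :=
  Matrix.mul_nonsing_inv _ ((Matrix.isUnit_iff_isUnit_det _).1 (QBar_posDef hρ hV).isUnit)

theorem sum_sq_div_nonneg (hV : ∀ i, 0 < V i) (x : Fin n → ℝ) : 0 ≤ ∑ i, x i * x i / V i :=
  Finset.sum_nonneg fun j _ => div_nonneg (mul_self_nonneg _) (hV j).le

theorem QBar_inv_diag_pos (hρ : 0 < L.rho) (hV : ∀ i, 0 < V i) (i : Fin n) :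
    0 < (L.QBar V)⁻¹ i i := (QBar_posDef hρ hV).inv.diag_pos

/-- The conditional variances are at most the prior ones. -/
theorem QBar_inv_diag_le (hρ : 0 < L.rho) (hV : ∀ i, 0 < V i) (i : Fin n) :
    (L.QBar V)⁻¹ i i ≤ V i := by
  -- For this `x` the quadratic form equals `x i`, while its diagonal part alone is at least `x i ^
  -- 2 / V i`.
  set x := (L.QBar V)⁻¹ *ᵥ Pi.single i 1 with hx
  have hxi : x i = (L.QBar V)⁻¹ i i := by simp [hx]
  have hq : x ⬝ᵥ (L.QBar V *ᵥ x) = x i := by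
    rw [hx, Matrix.mulVec_mulVec, QBar_mul_inv hρ hV, Matrix.one_mulVec, ← hx]
    simp
  rw [dotProduct_QBar_mulVec] at hq
  have h1 : 0 ≤ L.rho * ((L.B *ᵥ x) ⬝ᵥ (L.B *ᵥ x)) :=
    mul_nonneg hρ.le (Finset.sum_nonneg fun j _ => mul_self_nonneg _)
  have h2 : x i * x i / V i ≤ ∑ i, x i * x i / V i :=
    Finset.single_le_sum (f := fun i => x i * x i / V i)
      (fun j _ => div_nonneg (mul_self_nonneg _) (hV j).le) (Finset.mem_univ i)
  have h3 : x i * x i / V i ≤ x i := by linarith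
  rw [div_le_iff₀ (hV i)] at h3
  rw [← hxi]
  exact le_of_mul_le_mul_left h3 (hxi ▸ QBar_inv_diag_pos hρ hV i)

/-- The conditional variances are bounded below by the inverse diagonal of the precision. -/
theorem le_QBar_inv_diag (hρ : 0 < L.rho) (hV : ∀ i, 0 < V i) (i : Fin n) :
    V i / (1 + L.rho * ((L.B *ᵥ Pi.single i 1) ⬝ᵥ (L.B *ᵥ Pi.single i 1)) * V i)
      ≤ (L.QBar V)⁻¹ i i := by
  set c := L.rho * ((L.B *ᵥ Pi.single i 1) ⬝ᵥ (L.B *ᵥ Pi.single i 1)) with hc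
  have hc0 : 0 ≤ c := mul_nonneg hρ.le (Finset.sum_nonneg fun j _ => mul_self_nonneg _)
  have hVi := hV i
  set x := (L.QBar V)⁻¹ *ᵥ Pi.single i 1 with hx
  have hxi : x i = (L.QBar V)⁻¹ i i := by simp [hx]
  -- This is the inverse of the `i`-th diagonal entry of `Q̄(V)`; the quadratic form at `x - t • d`
  -- then equals `x i - t`, which is therefore nonnegative.
  set t := V i / (1 + c * V i) with ht
  have hQx : L.QBar V *ᵥ x = Pi.single i 1 := by
    rw [hx, Matrix.mulVec_mulVec, QBar_mul_inv hρ hV, Matrix.one_mulVec]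
  set d : Fin n → ℝ := Pi.single i 1 with hd
  have hdd : d ⬝ᵥ (L.QBar V *ᵥ d) = c + 1 / V i := by
    rw [dotProduct_QBar_mulVec, ← hc]
    congr 1
    rw [Finset.sum_eq_single i]
    · simp [hd]
    · intro j _ hj; simp [hd, hj]
    · simp
  have hxd : x ⬝ᵥ (L.QBar V *ᵥ d) = 1 := by
    rw [Matrix.dotProduct_mulVec, ← Matrix.mulVec_transpose,
      show (L.QBar V)ᵀ = L.QBar V from QBar_isHermitian, hQx, hd]
    simp
  have hnn := (QBar_posDef hρ hV).posSemidef.dotProduct_mulVec_nonneg (x - t • d)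
  rw [star_trivial, Matrix.mulVec_sub, Matrix.mulVec_smul, sub_dotProduct, dotProduct_sub,
    dotProduct_sub, hQx, smul_dotProduct, smul_dotProduct, dotProduct_smul, dotProduct_smul, hdd,
    hxd] at hnn
  have hxd' : x ⬝ᵥ d = x i := by simp [hd]
  have hdd' : d ⬝ᵥ d = 1 := by simp [hd]
  rw [hxd', hdd'] at hnn
  simp only [smul_eq_mul] at hnn
  have htc : t * (c + 1 / V i) = 1 := by rw [ht]; field_simp; ring
  rw [← hxi]
  have : t * (t * (c + 1 / V i)) = t := by rw [htc, mul_one]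
  linarith

/-- The mean of the latent field given the mixing variables. -/
def condMean (L : LLnGM m n k) (V : Fin n → ℝ) : Fin n → ℝ := (L.QBar V)⁻¹ *ᵥ L.mBar

/-- The normal equation `Q̄(V) x = m̄` of the conditional mean in weak form. Both bounds on the mean
come from choices of the test vector. -/
theorem mBar_dotProduct (hρ : 0 < L.rho) (hV : ∀ i, 0 < V i) (x : Fin n → ℝ) :
    L.mBar ⬝ᵥ x = L.rho * ((L.B *ᵥ x) ⬝ᵥ (L.B *ᵥ L.condMean V))
      + ∑ i, x i * L.condMean V i / V i := by
  rw [← dotProduct_QBar_mulVec, condMean, Matrix.mulVec_mulVec, QBar_mul_inv hρ hV,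
    Matrix.one_mulVec, dotProduct_comm]

/-- If `m̄` lies in the range of `Bᵀ`, the conditional mean is bounded, uniformly in the mixing
variables. -/
theorem exists_condMean_bound (hρ : 0 < L.rho) {w : Fin m → ℝ} (hw : L.mBar = L.Bᵀ *ᵥ w) :
    ∃ C : ℝ, 0 ≤ C ∧ ∀ V : Fin n → ℝ, (∀ i, 0 < V i) → ‖L.condMean V‖ ≤ C := by
  -- Compactness argument: a sequence of means with norms tending to infinity is normalized, and a
  -- limit direction `u` is extracted.
  by_contra hcon
  push Not at hcon
  choose V hV hbig using fun N : ℕ => hcon (N + 1) (by positivity)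
  have hmw : ∀ x, L.mBar ⬝ᵥ x = w ⬝ᵥ (L.B *ᵥ x) := by
    intro x
    rw [hw, Matrix.mulVec_transpose, ← Matrix.dotProduct_mulVec]
  set x : ℕ → Fin n → ℝ := fun N => L.condMean (V N) with hx
  have hxpos : ∀ N, 0 < ‖x N‖ := fun N => lt_trans (by positivity) (hbig N)
  -- the fitted values stay bounded
  have hB : ∀ N, (L.B *ᵥ x N) ⬝ᵥ (L.B *ᵥ x N) ≤ (w ⬝ᵥ w) / L.rho ^ 2 := by
    intro N
    have he := mBar_dotProduct hρ (hV N) (x N)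
    rw [hmw] at he
    have h2 := sum_sq_div_nonneg (hV N) (x N)
    set b := L.B *ᵥ x N with hb
    change w ⬝ᵥ b = L.rho * (b ⬝ᵥ b) + ∑ i, x N i * x N i / V N i at he
    have h3 : L.rho * (b ⬝ᵥ b) ≤ w ⬝ᵥ b := by linarith
    have h4 : 0 ≤ (L.rho • b - w) ⬝ᵥ (L.rho • b - w) :=
      Finset.sum_nonneg fun j _ => mul_self_nonneg _
    rw [sub_dotProduct, dotProduct_sub, dotProduct_sub, smul_dotProduct, smul_dotProduct,
      dotProduct_smul, dotProduct_smul, dotProduct_comm b w] at h4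
    simp only [smul_eq_mul] at h4
    have h5 : L.rho * (L.rho * (b ⬝ᵥ b)) ≤ L.rho * (w ⬝ᵥ b) := by gcongr
    rw [le_div_iff₀ (by positivity)]
    linarith
  obtain ⟨u, hu1, φ, hφ, hlim⟩ := (isCompact_sphere (0 : Fin n → ℝ) 1).tendsto_subseq
    (x := fun N => ‖x N‖⁻¹ • x N) fun N => by
      rw [mem_sphere_zero_iff_norm, norm_smul, norm_inv, norm_norm,
        inv_mul_cancel₀ (hxpos N).ne']
  have hu0 : u ≠ 0 := by
    intro h
    rw [mem_sphere_zero_iff_norm, h, norm_zero] at hu1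
    exact zero_ne_one hu1
  have hcoord : ∀ i, Filter.Tendsto (fun N => (x (φ N) i) / ‖x (φ N)‖) Filter.atTop
      (nhds (u i)) := by
    intro i
    have := (tendsto_pi_nhds.1 hlim) i
    simpa [div_eq_inv_mul] using this
  have hinv : Filter.Tendsto (fun N => ‖x (φ N)‖⁻¹) Filter.atTop (nhds 0) := by
    refine tendsto_inv_atTop_zero.comp (Filter.tendsto_atTop_mono (fun N => ?_)
      (tendsto_natCast_atTop_atTop (R := ℝ)))
    have h1 : (N : ℝ) ≤ φ N := by exact_mod_cast hφ.id_le N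
    have h2 := hbig (φ N)
    linarith
  have hBu : L.B *ᵥ u = 0 := by
    have hcont : Continuous fun y : Fin n → ℝ => (L.B *ᵥ y) ⬝ᵥ (L.B *ᵥ y) := by
      have : Continuous fun y : Fin n → ℝ => L.B *ᵥ y := by fun_prop
      simp only [dotProduct]
      fun_prop
    have h1 := (hcont.tendsto u).comp hlim
    have h2 : Filter.Tendsto (fun N => ‖x (φ N)‖⁻¹ * (‖x (φ N)‖⁻¹ * ((w ⬝ᵥ w) / L.rho ^ 2)))
        Filter.atTop (nhds 0) := by
      simpa using hinv.mul (hinv.mul_const ((w ⬝ᵥ w) / L.rho ^ 2))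
    have h3 : (L.B *ᵥ u) ⬝ᵥ (L.B *ᵥ u) ≤ 0 := by
      refine le_of_tendsto_of_tendsto' h1 h2 fun N => ?_
      simp only [Function.comp_apply, Matrix.mulVec_smul, smul_dotProduct, dotProduct_smul,
        smul_eq_mul]
      have := hB (φ N)
      gcongr
    have h4 : (L.B *ᵥ u) ⬝ᵥ (L.B *ᵥ u) = 0 :=
      le_antisymm h3 (Finset.sum_nonneg fun j _ => mul_self_nonneg _)
    exact dotProduct_self_eq_zero.1 h4
  -- eventually the signs agree
  have hsign : ∀ᶠ N in Filter.atTop, ∀ i, u i ≠ 0 → 0 < u i * x (φ N) i := by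
    rw [Filter.eventually_all]
    intro i
    by_cases hi : u i = 0
    · exact .of_forall fun N h => absurd hi h
    have h1 := ((hcoord i).const_mul (u i)).eventually_const_lt (mul_self_pos.2 hi)
    filter_upwards [h1] with N hN _
    rw [mul_div_assoc'] at hN
    exact (div_pos_iff_of_pos_right (hxpos _)).1 hN
  obtain ⟨N, hN⟩ := hsign.exists
  -- Testing with `u` gives the contradiction: `B u = 0` kills the left side and the first term on
  -- the right, but the weighted sum is positive because the signs agree.
  have he := mBar_dotProduct hρ (hV (φ N)) u
  rw [hmw, hBu] at he
  simp only [dotProduct_zero, zero_dotProduct, mul_zero, zero_add] at he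
  obtain ⟨i, hi⟩ := Function.ne_iff.1 hu0
  have hpos : 0 < ∑ i, u i * L.condMean (V (φ N)) i / V (φ N) i := by
    refine Finset.sum_pos' (fun j _ => div_nonneg ?_ (hV _ j).le)
      ⟨i, Finset.mem_univ _, div_pos (hN i hi) (hV _ i)⟩
    by_cases hj : u j = 0
    · simp [hj]
    · exact (hN j hj).le
  linarith

/-- The conditional mean grows at most at the rate given by the projection `e` of the vector of
ones onto the null space of `B`. -/
theorem exists_condMean_sq_le (hρ : 0 < L.rho) {e : Fin n → ℝ} {w : Fin m → ℝ}
    (hone : (1 : Fin n → ℝ) = e + L.Bᵀ *ᵥ w) :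
    ∃ C : ℝ, 0 ≤ C ∧ ∀ (V : Fin n → ℝ) (v : ℝ), (∀ i, 0 < V i) → (∀ i, V i ≤ v) → 0 ≤ v →
      ∑ i, L.condMean V i ^ 2 ≤ C * v + L.μ ^ 2 * (e ⬝ᵥ e) * v ^ 2 := by
  set w' : Fin m → ℝ := L.rho • (L.Y - L.X *ᵥ L.β + L.μ • (L.B *ᵥ L.h)) + L.μ • w with hw'
  have hm : L.mBar = L.Bᵀ *ᵥ w' + L.μ • e := by
    rw [mBar, hone, hw', Matrix.mulVec_add L.Bᵀ (L.rho • _), Matrix.mulVec_smul L.Bᵀ L.rho,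
      Matrix.mulVec_smul L.Bᵀ L.μ w, smul_add]
    abel
  have hww : 0 ≤ w' ⬝ᵥ w' := Finset.sum_nonneg fun j _ => mul_self_nonneg _
  refine ⟨(w' ⬝ᵥ w') / (2 * L.rho), by positivity, fun V v hV hVv hv => ?_⟩
  set x := L.condMean V with hx
  set b := L.B *ᵥ x with hb
  have he := mBar_dotProduct hρ hV x
  rw [hm, add_dotProduct, Matrix.mulVec_transpose, ← Matrix.dotProduct_mulVec, smul_dotProduct,
    smul_eq_mul] at he
  change w' ⬝ᵥ b + L.μ * (e ⬝ᵥ x) = L.rho * (b ⬝ᵥ b) + ∑ i, x i * x i / V i at he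
  have h1 : (∑ i, x i ^ 2) ≤ v * ∑ i, x i * x i / V i := by
    rw [Finset.mul_sum]
    refine Finset.sum_le_sum fun i _ => ?_
    have hVi := hV i
    rw [mul_div_assoc', le_div_iff₀ hVi, sq, mul_comm]
    exact mul_le_mul_of_nonneg_right (hVv i) (mul_self_nonneg _)
  -- Complete the square in `b`: the component of `m̄` in the range of `Bᵀ` costs only a constant.
  have h2 : w' ⬝ᵥ b - L.rho * (b ⬝ᵥ b) ≤ (w' ⬝ᵥ w') / (4 * L.rho) := by
    have h4 : 0 ≤ ((2 * L.rho) • b - w') ⬝ᵥ ((2 * L.rho) • b - w') :=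
      Finset.sum_nonneg fun j _ => mul_self_nonneg _
    rw [sub_dotProduct, dotProduct_sub, dotProduct_sub, smul_dotProduct, smul_dotProduct,
      dotProduct_smul, dotProduct_smul, dotProduct_comm b w'] at h4
    simp only [smul_eq_mul] at h4
    rw [le_div_iff₀ (by positivity)]
    linarith
  -- Used as `2 v μ (e·x) ≤ |x|² + v² μ² |e|²`. Half of `|x|²` is absorbed on the left, so the
  -- factor of `v²` is exactly `μ² |e|²`.
  have h3 : 0 ≤ (x - (v * L.μ) • e) ⬝ᵥ (x - (v * L.μ) • e) :=
    Finset.sum_nonneg fun j _ => mul_self_nonneg _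
  rw [sub_dotProduct, dotProduct_sub, dotProduct_sub, smul_dotProduct, smul_dotProduct,
    dotProduct_smul, dotProduct_smul, dotProduct_comm x e] at h3
  simp only [smul_eq_mul] at h3
  have hxx : x ⬝ᵥ x = ∑ i, x i ^ 2 := by simp [dotProduct, sq]
  rw [hxx] at h3
  have h4 : v * ∑ i, x i * x i / V i ≤ v * ((w' ⬝ᵥ w') / (4 * L.rho) + L.μ * (e ⬝ᵥ x)) := by
    gcongr
    linarith
  have h5 : (w' ⬝ᵥ w') / (2 * L.rho) = 2 * ((w' ⬝ᵥ w') / (4 * L.rho)) := by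
    field_simp; ring
  rw [h5]
  nlinarith

/-- Under the null-smallness condition, the vector of ones is, up to the range of `Bᵀ`, a vector
`e` of small norm. -/
theorem NullSmallness.exists_decomposition (hK : IsUnit L.K.det)
    (hD : 0 < L.σ ^ 2 * L.a + L.μ ^ 2) (hns : L.NullSmallness) :
    ∃ (e : Fin n → ℝ) (w : Fin m → ℝ), (1 : Fin n → ℝ) = e + L.Bᵀ *ᵥ w ∧
      L.μ ^ 2 * (e ⬝ᵥ e) < L.σ ^ 2 * L.a + L.μ ^ 2 := by
  have hker : ∀ x, L.B *ᵥ x = 0 → L.K⁻¹ *ᵥ x ∈ LinearMap.ker L.A.mulVecLin := by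
    intro x hx
    rw [B, ← Matrix.mulVec_mulVec] at hx
    simpa using hx
  have hKK : ∀ x, L.K *ᵥ (L.K⁻¹ *ᵥ x) = x := by
    intro x
    rw [Matrix.mulVec_mulVec, Matrix.mul_nonsing_inv _ hK, Matrix.one_mulVec]
  rcases hns with h0 | ⟨U, ⟨hUU, hrange⟩, hlt⟩
  · have hbot : LinearMap.ker L.A.mulVecLin = ⊥ := Submodule.finrank_eq_zero.1 h0
    obtain ⟨w, hw⟩ := exists_transpose_mulVec_eq L.B 1 fun x hx => by
      have h1 := hker x hx
      rw [hbot, Submodule.mem_bot] at h1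
      rw [← hKK x, h1, Matrix.mulVec_zero, dotProduct_zero]
    exact ⟨0, w, by rw [hw, zero_add], by simpa using hD⟩
  · set N := L.K * U with hN
    set G : Matrix (Fin L.nullity) (Fin L.nullity) ℝ := Uᵀ * L.Kᵀ * L.K * U with hG
    set z : Fin L.nullity → ℝ := (Uᵀ * L.Kᵀ) *ᵥ (1 : Fin n → ℝ) with hz
    have hGN : G = Nᵀ * N := by rw [hG, hN, Matrix.transpose_mul]; simp only [Matrix.mul_assoc]
    have hzN : z = Nᵀ *ᵥ 1 := by rw [hz, hN, Matrix.transpose_mul]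
    have hNN : ∀ x y, (N *ᵥ x) ⬝ᵥ (N *ᵥ y) = x ⬝ᵥ (G *ᵥ y) := by
      intro x y
      rw [hGN, ← Matrix.mulVec_mulVec y Nᵀ N, Matrix.dotProduct_mulVec x, Matrix.vecMul_transpose]
    have hGunit : IsUnit G := by
      rw [← Matrix.mulVec_injective_iff_isUnit]
      refine (injective_iff_map_eq_zero G.mulVecLin).2 fun x hx => ?_
      have h1 : (N *ᵥ x) ⬝ᵥ (N *ᵥ x) = 0 := by
        rw [hNN, show G *ᵥ x = 0 from hx, dotProduct_zero]
      have h2 : N *ᵥ x = 0 := dotProduct_self_eq_zero.1 h1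
      have h3 : (Uᵀ * L.K⁻¹) *ᵥ (N *ᵥ x) = x := by
        rw [Matrix.mulVec_mulVec, hN, Matrix.mul_assoc, ← Matrix.mul_assoc L.K⁻¹,
          Matrix.nonsing_inv_mul _ hK, Matrix.one_mul, hUU, Matrix.one_mulVec]
      rw [← h3, h2, Matrix.mulVec_zero]
    have hGdet := (Matrix.isUnit_iff_isUnit_det _).1 hGunit
    set g := G⁻¹ *ᵥ z with hg
    have hGg : G *ᵥ g = z := by
      rw [hg, Matrix.mulVec_mulVec, Matrix.mul_nonsing_inv _ hGdet, Matrix.one_mulVec]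
    -- The orthogonal projection of `1` onto the range of `K U`, which is the null space of `B`. Its
    -- squared norm is `zᵀ G⁻¹ z`, and `1 - e` is orthogonal to that space, hence in the range of
    -- `Bᵀ`.
    set e := N *ᵥ g with he
    have hee : e ⬝ᵥ e = L.nullForm U := by
      rw [he, hNN, hGg, dotProduct_comm]
      rfl
    obtain ⟨w, hw⟩ := exists_transpose_mulVec_eq L.B (1 - e) fun x hx => by
      have h1 := hker x hx
      rw [← hrange] at h1
      obtain ⟨y, hy⟩ := h1
      have h2 : x = N *ᵥ y := by
        rw [← hKK x, ← hy, hN, ← Matrix.mulVec_mulVec]; rfl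
      rw [h2, sub_dotProduct, he, hNN, Matrix.dotProduct_mulVec g, ← Matrix.mulVec_transpose,
        show Gᵀ = G by rw [hGN, Matrix.transpose_mul, Matrix.transpose_transpose], hGg, hzN,
        Matrix.mulVec_transpose, ← Matrix.dotProduct_mulVec, sub_self]
    refine ⟨e, w, by rw [hw]; abel, ?_⟩
    rw [hee]
    have hnf : 0 ≤ L.nullForm U := by
      rw [← hee]; exact Finset.sum_nonneg fun j _ => mul_self_nonneg _
    rw [div_mul_eq_mul_div, div_lt_one (Real.sqrt_pos.2 hD)] at hlt
    have := mul_self_lt_mul_self (by positivity) hlt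
    rw [Real.mul_self_sqrt hD.le] at this
    calc L.μ ^ 2 * L.nullForm U
        = |L.μ| * √(L.nullForm U) * (|L.μ| * √(L.nullForm U)) := by
          rw [← sq, mul_pow, sq_abs, Real.sq_sqrt hnf]
      _ < _ := this

end LLnGM

namespace LLnGM

variable {m n k : ℕ} {L : LLnGM m n k}

/-! ### The two updates of the Gibbs sampler -/

theorem measurable_latentCondPDF_right (V : PosOrthant n) :
    Measurable fun M => L.latentCondPDF V.1 M :=
  L.measurable_latentCondPDF.of_uncurry_left (x := V)

theorem posDef_latentCov (hσ : 0 < L.σ) (hσε : 0 < L.σε) (V : PosOrthant n) :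
    (L.σ ^ 2 • (L.QBar V.1)⁻¹).PosDef :=
  (QBar_posDef (L.rho_pos hσ hσε) V.2).inv.smul (by positivity)

theorem isMarkovKernel_latentKernel (hσ : 0 < L.σ) (hσε : 0 < L.σε) :
    IsMarkovKernel L.latentKernel :=
  ⟨fun V => isProbabilityMeasure_withDensity_mvNormalPDFReal (posDef_latentCov hσ hσε V) _
    (measurable_latentCondPDF_right V)⟩

/-- The conditional variance of a coordinate of the latent field. -/
def condVar (L : LLnGM m n k) (V : Fin n → ℝ) (i : Fin n) : ℝ≥0 :=
  (L.σ ^ 2 * (L.QBar V)⁻¹ i i).toNNReal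

theorem map_eval_latentKernel (hσ : 0 < L.σ) (hσε : 0 < L.σε) (V : PosOrthant n) (i : Fin n) :
    (L.latentKernel V).map (fun M => M i) = gaussianReal (L.condMean V.1 i) (L.condVar V.1 i) :=
  map_eval_withDensity_mvNormalPDFReal (posDef_latentCov hσ hσε V) _
    (measurable_latentCondPDF_right V) i

theorem coe_condVar (hσ : 0 < L.σ) (hσε : 0 < L.σε) (V : PosOrthant n) (i : Fin n) :
    (L.condVar V.1 i : ℝ) = L.σ ^ 2 * (L.QBar V.1)⁻¹ i i :=
  Real.coe_toNNReal _ (mul_nonneg (sq_nonneg _)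
    (QBar_inv_diag_pos (L.rho_pos hσ hσε) V.2 i).le)

theorem condVar_ne_zero (hσ : 0 < L.σ) (hσε : 0 < L.σε) (V : PosOrthant n) (i : Fin n) :
    L.condVar V.1 i ≠ 0 := by
  have := QBar_inv_diag_pos (L.rho_pos hσ hσε) V.2 i
  rw [← NNReal.coe_ne_zero, coe_condVar hσ hσε]
  positivity

/-- For `b = 0` the full conditional at `Mᵢ = 0` need not be normalizable; the normal marginals do
not charge this point. -/
theorem ae_latentKernel_ne_zero (hσ : 0 < L.σ) (hσε : 0 < L.σε) (V : PosOrthant n) :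
    ∀ᵐ M ∂(L.latentKernel V), ∀ i, M i ≠ 0 := by
  rw [ae_all_iff]
  intro i
  have : NullSingletonClass (gaussianReal (L.condMean V.1 i) (L.condVar V.1 i)) :=
    nullSingletonClass_gaussianReal (condVar_ne_zero hσ hσε V i)
  have h : ∀ᵐ x ∂(gaussianReal (L.condMean V.1 i) (L.condVar V.1 i)), x ≠ 0 :=
    measure_eq_zero_iff_ae_notMem.1 (measure_singleton (0 : ℝ))
  rw [← map_eval_latentKernel hσ hσε V i] at h
  exact ae_of_ae_map (measurable_pi_apply i).aemeasurable h

theorem measurable_mixingCondPDF_right (x : ℝ) : Measurable (L.mixingCondPDF x) :=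
  measurable_gigPDF' _ _ _

/-- Integrability of the full conditional densities of the mixing variables. -/
def MixingIntegrable (L : LLnGM m n k) : Prop :=
  ∀ x ≠ 0, IntegrableOn (gigWeight (L.p - 1 / 2) L.aTilde (L.b + (x / L.σ) ^ 2)) (Set.Ioi 0)

theorem mixingKernel_univ (hg : L.MixingIntegrable) {M : Fin n → ℝ} (hM : ∀ i, M i ≠ 0) :
    L.mixingKernel M Set.univ = 1 := by
  have h : L.mixingKernel M Set.univ
      = ∫⁻ V, ∏ i, L.mixingCondPDF (M i) (V.1 i) ∂(orthantVolume n) := by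
    change ((orthantVolume n).withDensity _) Set.univ = _
    rw [withDensity_apply _ MeasurableSet.univ, Measure.restrict_univ]
  rw [h, lintegral_orthantVolume_prod fun i => measurable_mixingCondPDF_right (M i)]
  exact Finset.prod_eq_one fun i _ => lintegral_gigPDF (hg (M i) (hM i))

theorem lintegral_mixingKernel_le (M : Fin n → ℝ) (i : Fin n) {f : ℝ → ℝ≥0∞} (hf : Measurable f) :
    ∫⁻ V, f (V.1 i) ∂(L.mixingKernel M)
      ≤ ∫⁻ v in Set.Ioi 0, f v * L.mixingCondPDF (M i) v := by
  have hm : Measurable fun V : PosOrthant n => ∏ j, L.mixingCondPDF (M j) (V.1 j) :=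
    L.measurable_mixingCondPDF.comp measurable_prodMk_left
  have hfm : Measurable fun V : PosOrthant n => f (V.1 i) :=
    hf.comp ((measurable_pi_apply i).comp measurable_subtype_coe)
  change ∫⁻ V, f (V.1 i) ∂((orthantVolume n).withDensity fun V =>
    ∏ j, L.mixingCondPDF (M j) (V.1 j)) ≤ _
  rw [lintegral_withDensity_eq_lintegral_mul _ hm hfm]
  -- The test function is merged into the `i`-th factor, so the integral remains a product.
  set F : Fin n → ℝ → ℝ≥0∞ := fun j v =>
    (if j = i then f v else 1) * L.mixingCondPDF (M j) v with hF
  have hFm : ∀ j, Measurable (F j) := by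
    intro j
    by_cases hj : j = i
    · simp only [hF, hj, if_true]; exact hf.mul (measurable_mixingCondPDF_right _)
    · simp only [hF, hj, if_false, one_mul]; exact measurable_mixingCondPDF_right _
  have e : ∀ V : PosOrthant n, (∏ j, L.mixingCondPDF (M j) (V.1 j)) * f (V.1 i)
      = ∏ j, F j (V.1 j) := by
    intro V
    simp only [hF, Finset.prod_mul_distrib, Finset.prod_ite_eq', Finset.mem_univ,
      if_true]
    rw [mul_comm]
  simp only [Pi.mul_apply, e]
  rw [lintegral_orthantVolume_prod hFm, ← Finset.mul_prod_erase _ _ (Finset.mem_univ i)]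
  have h1 : ∏ j ∈ Finset.univ.erase i, ∫⁻ v in Set.Ioi 0, F j v ≤ 1 := by
    refine Finset.prod_le_one' fun j hj => ?_
    have hji : j ≠ i := (Finset.mem_erase.1 hj).1
    simp only [hF, hji, if_false, one_mul]
    exact lintegral_gigPDF_le_one _ _ _
  calc _ ≤ (∫⁻ v in Set.Ioi 0, F i v) * 1 := by gcongr
    _ = _ := by simp [hF]

theorem isMarkovKernel_gibbsKernel (hσ : 0 < L.σ) (hσε : 0 < L.σε) (hg : L.MixingIntegrable) :
    IsMarkovKernel L.gibbsKernel := by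
  have := isMarkovKernel_latentKernel hσ hσε
  refine ⟨fun V => ⟨?_⟩⟩
  rw [gibbsKernel, Kernel.comp_apply' _ _ _ MeasurableSet.univ]
  calc _ = ∫⁻ _, 1 ∂(L.latentKernel V) := lintegral_congr_ae (by
        filter_upwards [ae_latentKernel_ne_zero hσ hσε V] with M hM
        exact mixingKernel_univ hg hM)
    _ = 1 := by simp

/-- Bounds on the moments of the full conditional laws of the mixing variables integrate to bounds
for the Gibbs sampler. -/
theorem lintegral_gibbsKernel_le (hσ : 0 < L.σ) (hσε : 0 < L.σε) (V : PosOrthant n) (i : Fin n)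
    {f H : ℝ → ℝ≥0∞} (hf : Measurable f) (hH : Measurable H)
    (h : ∀ x ≠ 0, ∫⁻ v in Set.Ioi 0, f v * L.mixingCondPDF x v ≤ H x) :
    ∫⁻ W, f (W.1 i) ∂(L.gibbsKernel V)
      ≤ ∫⁻ x, H x ∂(gaussianReal (L.condMean V.1 i) (L.condVar V.1 i)) := by
  have hfm : Measurable fun V : PosOrthant n => f (V.1 i) :=
    hf.comp ((measurable_pi_apply i).comp measurable_subtype_coe)
  rw [gibbsKernel, Kernel.lintegral_comp _ _ _ hfm, ← map_eval_latentKernel hσ hσε V i,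
    lintegral_map hH (measurable_pi_apply i)]
  refine lintegral_mono_ae ?_
  filter_upwards [ae_latentKernel_ne_zero hσ hσε V] with M hM
  exact (lintegral_mixingKernel_le M i hf).trans (h _ (hM i))

/-! ### The joint density and its two factorizations -/

/-- The joint density of `(Y, M, V)`. -/
def jointDensity (L : LLnGM m n k) (V M : Fin n → ℝ) : ℝ≥0∞ :=
  L.likelihood M * L.latentPrior V M * L.mixingPrior V

theorem measurable_likelihood : Measurable L.likelihood := by
  unfold likelihood
  refine Finset.measurable_prod _ fun j _ => ?_
  have h1 : Continuous fun M : Fin n → ℝ =>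
      (L.X *ᵥ L.β + L.B *ᵥ (M - L.μ • L.h)) j := by fun_prop
  simp only [gaussianPDF, gaussianPDFReal_def]
  have := h1.measurable
  fun_prop

theorem measurable_latentPrior :
    Measurable fun q : (Fin n → ℝ) × (Fin n → ℝ) => L.latentPrior q.1 q.2 := by
  unfold latentPrior
  refine Finset.measurable_prod _ fun j _ => ?_
  simp only [gaussianPDF, gaussianPDFReal_def]
  fun_prop

theorem measurable_latentPrior_right (V : Fin n → ℝ) : Measurable (L.latentPrior V) := by
  unfold latentPrior
  refine Finset.measurable_prod _ fun j _ => ?_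
  simp only [gaussianPDF, gaussianPDFReal_def]
  fun_prop

theorem measurable_mixingPrior : Measurable (L.mixingPrior) := by
  unfold mixingPrior
  exact Finset.measurable_prod _ fun j _ => (measurable_gigPDF' _ _ _).comp (measurable_pi_apply j)

theorem measurable_jointDensity :
    Measurable fun q : PosOrthant n × (Fin n → ℝ) => L.jointDensity q.1.1 q.2 := by
  unfold jointDensity
  exact ((measurable_likelihood.comp measurable_snd).mul (measurable_latentPrior.comp
    ((measurable_subtype_coe.comp measurable_fst).prodMk measurable_snd))).mul
    (measurable_mixingPrior.comp (measurable_subtype_coe.comp measurable_fst))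

/-- Conjugacy: expanding the square adds `μ²/σ²` to `a` and `(x/σ)²` to `b`, and `v^(-1/2)` lowers
the order by `1/2`. The cross term `μ x/σ²` does not involve `v`. -/
theorem gaussianPDF_mul_gigPDF (hσ : 0 < L.σ)
    (hp : IntegrableOn (gigWeight L.p L.a L.b) (Set.Ioi 0)) (hg : L.MixingIntegrable)
    {x v : ℝ} (hx : x ≠ 0) (hv : 0 < v) :
    gaussianPDF (L.μ * v) (Real.toNNReal (L.σ ^ 2 * v)) x * gigPDF L.p L.a L.b v
      = ENNReal.ofReal ((√(2 * Real.pi * L.σ ^ 2))⁻¹ * Real.exp (L.μ * x / L.σ ^ 2)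
          * gigIntegral (L.p - 1 / 2) L.aTilde (L.b + (x / L.σ) ^ 2) / gigIntegral L.p L.a L.b)
        * L.mixingCondPDF x v := by
  have h1 := gigIntegral_pos hp
  have h2 := gigIntegral_pos (hg x hx)
  rw [mixingCondPDF, gigPDF_of_pos hp hv, gigPDF_of_pos (hg x hx) hv, gaussianPDF,
    ← ENNReal.ofReal_mul (gaussianPDFReal_nonneg _ _ _), ← ENNReal.ofReal_mul (by positivity)]
  congr 1
  have e1 : gaussianPDFReal (L.μ * v) (Real.toNNReal (L.σ ^ 2 * v)) x
      = (√(2 * Real.pi * L.σ ^ 2))⁻¹ * v ^ (-(1 / 2) : ℝ)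
        * Real.exp (-(x - L.μ * v) ^ 2 / (2 * (L.σ ^ 2 * v))) := by
    rw [gaussianPDFReal_def]
    dsimp only
    rw [Real.coe_toNNReal _ (by positivity), ← mul_assoc, Real.sqrt_mul (by positivity), mul_inv,
      Real.rpow_neg hv.le, ← Real.sqrt_eq_rpow]
  have e2 : Real.exp (-(x - L.μ * v) ^ 2 / (2 * (L.σ ^ 2 * v)))
        * Real.exp (-(1 / 2) * (L.a * v + L.b / v))
      = Real.exp (L.μ * x / L.σ ^ 2)
        * Real.exp (-(1 / 2) * (L.aTilde * v + (L.b + (x / L.σ) ^ 2) / v)) := by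
    rw [← Real.exp_add, ← Real.exp_add, aTilde]
    congr 1
    field_simp
    ring
  have e3 : v ^ (L.p - 1 / 2 - 1) = v ^ (-(1 / 2) : ℝ) * v ^ (L.p - 1) := by
    rw [← Real.rpow_add hv]; congr 1; ring
  rw [e1, gigWeight, gigWeight, e3]
  generalize gigIntegral (L.p - 1 / 2) L.aTilde (L.b + (x / L.σ) ^ 2) = I at h2 ⊢
  calc _ = (√(2 * Real.pi * L.σ ^ 2))⁻¹ * v ^ (-(1 / 2) : ℝ) * v ^ (L.p - 1)
        / gigIntegral L.p L.a L.b * (Real.exp (-(x - L.μ * v) ^ 2 / (2 * (L.σ ^ 2 * v)))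
        * Real.exp (-(1 / 2) * (L.a * v + L.b / v))) := by ring
    _ = _ := by
        rw [e2]
        field_simp

theorem jointDensity_eq_mixing (hσ : 0 < L.σ)
    (hp : IntegrableOn (gigWeight L.p L.a L.b) (Set.Ioi 0)) (hg : L.MixingIntegrable)
    {M : Fin n → ℝ} (hM : ∀ i, M i ≠ 0) :
    ∃ c : ℝ≥0∞, ∀ V : PosOrthant n,
      L.jointDensity V.1 M = c * ∏ i, L.mixingCondPDF (M i) (V.1 i) := by
  refine ⟨L.likelihood M * ∏ i, ENNReal.ofReal ((√(2 * Real.pi * L.σ ^ 2))⁻¹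
    * Real.exp (L.μ * M i / L.σ ^ 2) * gigIntegral (L.p - 1 / 2) L.aTilde
      (L.b + (M i / L.σ) ^ 2) / gigIntegral L.p L.a L.b), fun V => ?_⟩
  rw [jointDensity, mul_assoc, mul_assoc, latentPrior, mixingPrior, ← Finset.prod_mul_distrib,
    ← Finset.prod_mul_distrib]
  congr 1
  exact Finset.prod_congr rfl fun i _ => gaussianPDF_mul_gigPDF hσ hp hg (hM i) (V.2 i)

theorem likelihood_eq (hσε : 0 < L.σε) (M : Fin n → ℝ) :
    L.likelihood M = ENNReal.ofReal (((√(2 * Real.pi * L.σε ^ 2))⁻¹) ^ m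
      * Real.exp (-(1 / (2 * L.σε ^ 2))
        * ((L.Y - L.X *ᵥ L.β + L.μ • (L.B *ᵥ L.h) - L.B *ᵥ M)
          ⬝ᵥ (L.Y - L.X *ᵥ L.β + L.μ • (L.B *ᵥ L.h) - L.B *ᵥ M)))) := by
  simp only [likelihood, gaussianPDF]
  rw [← ENNReal.ofReal_prod_of_nonneg fun i _ => gaussianPDFReal_nonneg _ _ _]
  congr 1
  simp only [gaussianPDFReal_def]
  rw [Finset.prod_mul_distrib, Finset.prod_const, Finset.card_univ, Fintype.card_fin,
    Real.coe_toNNReal _ (by positivity), ← Real.exp_sum, dotProduct, Finset.mul_sum]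
  congr 2
  refine Finset.sum_congr rfl fun j _ => ?_
  rw [Matrix.mulVec_sub, Matrix.mulVec_smul]
  simp only [Pi.add_apply, Pi.sub_apply, Pi.smul_apply]
  ring

theorem latentPrior_eq (hσ : 0 < L.σ) (V : PosOrthant n) (M : Fin n → ℝ) :
    L.latentPrior V.1 M = ENNReal.ofReal ((∏ i, (√(2 * Real.pi * (L.σ ^ 2 * V.1 i)))⁻¹)
      * Real.exp (-(1 / (2 * L.σ ^ 2)) * ((∑ i, M i * M i / V.1 i)
        - 2 * L.μ * ((1 : Fin n → ℝ) ⬝ᵥ M) + L.μ ^ 2 * ∑ i, V.1 i))) := by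
  simp only [latentPrior, gaussianPDF]
  rw [← ENNReal.ofReal_prod_of_nonneg fun i _ => gaussianPDFReal_nonneg _ _ _]
  congr 1
  simp only [gaussianPDFReal_def]
  have hc : ∀ i, ((L.σ ^ 2 * V.1 i).toNNReal : ℝ) = L.σ ^ 2 * V.1 i := fun i =>
    Real.coe_toNNReal _ (by have := V.2 i; positivity)
  simp only [hc]
  rw [Finset.prod_mul_distrib, ← Real.exp_sum]
  congr 2
  rw [dotProduct, Finset.mul_sum, Finset.mul_sum, ← Finset.sum_sub_distrib,
    ← Finset.sum_add_distrib, Finset.mul_sum]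
  refine Finset.sum_congr rfl fun i _ => ?_
  have := V.2 i
  simp only [Pi.one_apply]
  field_simp
  ring

theorem latentCondPDF_eq (hσ : 0 < L.σ) (hσε : 0 < L.σε) (V : PosOrthant n) (M : Fin n → ℝ) :
    L.latentCondPDF V.1 M = ENNReal.ofReal
      ((√((2 * Real.pi) ^ n * ((L.σ ^ 2) ^ n * ((L.QBar V.1).det)⁻¹)))⁻¹
        * Real.exp (-(1 / (2 * L.σ ^ 2))
          * ((M - L.condMean V.1) ⬝ᵥ (L.QBar V.1 *ᵥ (M - L.condMean V.1))))) := by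
  have hdet := (QBar_posDef (L.rho_pos hσ hσε) V.2).det_pos
  have hu : IsUnit (L.QBar V.1).det := isUnit_iff_ne_zero.2 hdet.ne'
  have hinv : (L.σ ^ 2 • (L.QBar V.1)⁻¹)⁻¹ = (L.σ ^ 2)⁻¹ • L.QBar V.1 := by
    refine Matrix.inv_eq_right_inv ?_
    rw [Matrix.smul_mul, Matrix.mul_smul, smul_smul, Matrix.nonsing_inv_mul _ hu,
      mul_inv_cancel₀ (by positivity), one_smul]
  rw [latentCondPDF, mvNormalPDFReal, hinv, Matrix.det_smul, Fintype.card_fin,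
    Matrix.det_nonsing_inv, Ring.inverse_eq_inv', Matrix.smul_mulVec, dotProduct_smul, smul_eq_mul,
    condMean]
  congr 3
  field_simp

theorem condMean_quadForm (hρ : 0 < L.rho) {V : Fin n → ℝ} (hV : ∀ i, 0 < V i)
    (M : Fin n → ℝ) :
    (M - L.condMean V) ⬝ᵥ (L.QBar V *ᵥ (M - L.condMean V))
      = L.rho * ((L.B *ᵥ M) ⬝ᵥ (L.B *ᵥ M)) + (∑ i, M i * M i / V i) - 2 * (L.mBar ⬝ᵥ M)
        + L.mBar ⬝ᵥ L.condMean V := by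
  have hQ : L.QBar V *ᵥ L.condMean V = L.mBar := by
    rw [condMean, Matrix.mulVec_mulVec, QBar_mul_inv hρ hV, Matrix.one_mulVec]
  have h1 : L.condMean V ⬝ᵥ (L.QBar V *ᵥ M) = L.mBar ⬝ᵥ M := by
    rw [Matrix.dotProduct_mulVec, ← Matrix.mulVec_transpose,
      show (L.QBar V)ᵀ = L.QBar V from QBar_isHermitian, hQ]
  rw [Matrix.mulVec_sub, hQ, sub_dotProduct, dotProduct_sub, dotProduct_sub, h1,
    dotProduct_QBar_mulVec, dotProduct_comm M, dotProduct_comm (L.condMean V)]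
  ring

/-- Completing the square in `M`: likelihood and prior together have quadratic part `Q̄(V)/σ²` and
linear part `m̄/σ²`. All the rest depends on `V` alone. -/
theorem jointDensity_eq_latent (hσ : 0 < L.σ) (hσε : 0 < L.σε) (V : PosOrthant n) :
    ∃ c : ℝ≥0∞, ∀ M : Fin n → ℝ, L.jointDensity V.1 M = c * L.latentCondPDF V.1 M := by
  have hρ := L.rho_pos hσ hσε
  have hdet := (QBar_posDef hρ V.2).det_pos
  set R := L.Y - L.X *ᵥ L.β + L.μ • (L.B *ᵥ L.h) with hR
  set C1 := ((√(2 * Real.pi * L.σε ^ 2))⁻¹) ^ m with hC1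
  set C2 := ∏ i, (√(2 * Real.pi * (L.σ ^ 2 * V.1 i)))⁻¹ with hC2
  set C3 := √((2 * Real.pi) ^ n * ((L.σ ^ 2) ^ n * ((L.QBar V.1).det)⁻¹)) with hC3
  have hC10 : 0 ≤ C1 := by positivity
  have hC20 : 0 ≤ C2 := Finset.prod_nonneg fun i _ => by positivity
  have hC30 : 0 < C3 := Real.sqrt_pos.2 (by positivity)
  set E := -(1 / (2 * L.σε ^ 2)) * (R ⬝ᵥ R) + (-(1 / (2 * L.σ ^ 2))
    * (L.μ ^ 2 * ∑ i, V.1 i - L.mBar ⬝ᵥ L.condMean V.1)) with hE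
  refine ⟨ENNReal.ofReal (C1 * C2 * C3 * Real.exp E) * L.mixingPrior V.1, fun M => ?_⟩
  rw [jointDensity, likelihood_eq hσε, latentPrior_eq hσ, latentCondPDF_eq hσ hσε,
    ← ENNReal.ofReal_mul (by positivity), mul_right_comm (ENNReal.ofReal _) (L.mixingPrior V.1),
    ← ENNReal.ofReal_mul (by positivity), ← hR, ← hC1, ← hC2, ← hC3, condMean_quadForm hρ V.2]
  congr 2
  have hm : L.mBar ⬝ᵥ M = L.rho * (R ⬝ᵥ (L.B *ᵥ M)) + L.μ * ((1 : Fin n → ℝ) ⬝ᵥ M) := by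
    rw [mBar, ← hR, add_dotProduct, smul_dotProduct, smul_dotProduct, Matrix.mulVec_transpose,
      ← Matrix.dotProduct_mulVec, smul_eq_mul, smul_eq_mul]
  have hexp : -(1 / (2 * L.σε ^ 2)) * ((R - L.B *ᵥ M) ⬝ᵥ (R - L.B *ᵥ M))
        + -(1 / (2 * L.σ ^ 2)) * ((∑ i, M i * M i / V.1 i)
          - 2 * L.μ * ((1 : Fin n → ℝ) ⬝ᵥ M) + L.μ ^ 2 * ∑ i, V.1 i)
      = E + -(1 / (2 * L.σ ^ 2)) * (L.rho * ((L.B *ᵥ M) ⬝ᵥ (L.B *ᵥ M))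
        + (∑ i, M i * M i / V.1 i) - 2 * (L.mBar ⬝ᵥ M) + L.mBar ⬝ᵥ L.condMean V.1) := by
    rw [hE, hm, sub_dotProduct, dotProduct_sub, dotProduct_sub, dotProduct_comm (L.B *ᵥ M) R, rho]
    field_simp
    ring
  calc _ = C1 * C2 * Real.exp (-(1 / (2 * L.σε ^ 2)) * ((R - L.B *ᵥ M) ⬝ᵥ (R - L.B *ᵥ M))
        + -(1 / (2 * L.σ ^ 2)) * ((∑ i, M i * M i / V.1 i)
          - 2 * L.μ * ((1 : Fin n → ℝ) ⬝ᵥ M) + L.μ ^ 2 * ∑ i, V.1 i)) := by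
        rw [Real.exp_add]; ring
    _ = _ := by
        rw [hexp, Real.exp_add]
        field_simp

/-- The conditional density of `M` has mass one, so the proportionality constant is the marginal
density of `V`. -/
theorem lintegral_jointDensity_mul_latentCondPDF (hσ : 0 < L.σ) (hσε : 0 < L.σε)
    (V : PosOrthant n) (M : Fin n → ℝ) :
    (∫⁻ M, L.jointDensity V.1 M) * L.latentCondPDF V.1 M = L.jointDensity V.1 M := by
  obtain ⟨c, hc⟩ := jointDensity_eq_latent hσ hσε V
  have h1 : ∫⁻ M, L.latentCondPDF V.1 M = 1 := by
    have := isMarkovKernel_latentKernel (L := L) hσ hσε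
    have h : L.latentKernel V Set.univ = 1 := measure_univ
    change (volume.withDensity _) Set.univ = 1 at h
    rwa [withDensity_apply _ MeasurableSet.univ, Measure.restrict_univ] at h
  simp only [hc]
  rw [lintegral_const_mul _ (measurable_latentCondPDF_right V), h1, mul_one]

theorem ae_volume_ne_zero : ∀ᵐ M : Fin n → ℝ, ∀ i, M i ≠ 0 := by
  rw [ae_all_iff]
  intro i
  have h : ∀ᵐ x : ℝ, x ≠ 0 := measure_eq_zero_iff_ae_notMem.1 (measure_singleton (0 : ℝ))
  exact (Measure.quasiMeasurePreserving_eval (fun _ : Fin n => (volume : Measure ℝ)) i).ae h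

/-! ### Invariance of the posterior law -/

theorem unnormalizedPosterior_eq : L.unnormalizedPosterior
    = (orthantVolume n).withDensity fun V => ∫⁻ M, L.jointDensity V.1 M := rfl

/-- The marginal of `V` times the `M`-update is the joint density. After Tonelli, for fixed `M` with
nonzero coordinates, the joint density is a constant times the normalized `V`-update, so redrawing
`V` changes nothing. -/
theorem bind_unnormalizedPosterior (hσ : 0 < L.σ) (hσε : 0 < L.σε)
    (hp : IntegrableOn (gigWeight L.p L.a L.b) (Set.Ioi 0)) (hg : L.MixingIntegrable) :
    L.unnormalizedPosterior.bind L.gibbsKernel = L.unnormalizedPosterior := by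
  have hJ := L.measurable_jointDensity
  have hu : Measurable fun V : PosOrthant n => ∫⁻ M, L.jointDensity V.1 M :=
    hJ.lintegral_prod_right'
  ext A hA
  have hkA : Measurable fun M => L.mixingKernel M A := L.mixingKernel.measurable_coe hA
  have hgA : Measurable fun V => L.gibbsKernel V A := L.gibbsKernel.measurable_coe hA
  rw [Measure.bind_apply hA L.gibbsKernel.aemeasurable, unnormalizedPosterior_eq,
    lintegral_withDensity_eq_lintegral_mul _ hu hgA, withDensity_apply _ hA]
  have hstep : ∀ V : PosOrthant n, ((fun V : PosOrthant n => ∫⁻ M, L.jointDensity V.1 M)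
      * fun V => L.gibbsKernel V A) V = ∫⁻ M, L.jointDensity V.1 M * L.mixingKernel M A := by
    intro V
    have h1 : L.gibbsKernel V A = ∫⁻ M, L.latentCondPDF V.1 M * L.mixingKernel M A := by
      rw [gibbsKernel, Kernel.comp_apply' _ _ _ hA]
      change ∫⁻ M, L.mixingKernel M A ∂(volume.withDensity fun M => L.latentCondPDF V.1 M) = _
      rw [lintegral_withDensity_eq_lintegral_mul _ (measurable_latentCondPDF_right V) hkA]
      rfl
    have hfk : Measurable fun M => L.latentCondPDF V.1 M * L.mixingKernel M A :=
      (measurable_latentCondPDF_right V).mul hkA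
    rw [Pi.mul_apply, h1, ← lintegral_const_mul _ hfk]
    refine lintegral_congr fun M => ?_
    rw [← mul_assoc, lintegral_jointDensity_mul_latentCondPDF hσ hσε]
  have hJA : Measurable fun q : PosOrthant n × (Fin n → ℝ) =>
      L.jointDensity q.1.1 q.2 * L.mixingKernel q.2 A := hJ.mul (hkA.comp measurable_snd)
  have hswap := lintegral_lintegral_swap (μ := (orthantVolume n).restrict A) (ν := volume)
    (f := fun V M => L.jointDensity V.1 M) hJ.aemeasurable
  rw [lintegral_congr hstep, lintegral_lintegral_swap hJA.aemeasurable, hswap]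
  refine lintegral_congr_ae ?_
  filter_upwards [ae_volume_ne_zero] with M hM
  obtain ⟨c, hc⟩ := jointDensity_eq_mixing hσ hp hg hM
  have hgm : Measurable fun V : PosOrthant n => ∏ i, L.mixingCondPDF (M i) (V.1 i) :=
    L.measurable_mixingCondPDF.comp measurable_prodMk_left
  have hmix : ∀ S, MeasurableSet S → L.mixingKernel M S
      = ∫⁻ V in S, ∏ i, L.mixingCondPDF (M i) (V.1 i) ∂(orthantVolume n) := fun S hS =>
    withDensity_apply _ hS
  have hone := mixingKernel_univ hg hM
  rw [hmix _ MeasurableSet.univ, Measure.restrict_univ] at hone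
  rw [hmix A hA]
  simp only [hc]
  rw [lintegral_mul_const _ (hgm.const_mul c), lintegral_const_mul _ hgm, hone, mul_one,
    lintegral_const_mul _ hgm]

theorem likelihood_le (hσε : 0 < L.σε) (M : Fin n → ℝ) :
    L.likelihood M ≤ ENNReal.ofReal (((√(2 * Real.pi * L.σε ^ 2))⁻¹) ^ m) := by
  rw [likelihood_eq hσε]
  refine ENNReal.ofReal_le_ofReal (mul_le_of_le_one_right (by positivity) ?_)
  rw [Real.exp_le_one_iff, neg_mul, neg_nonpos]
  exact mul_nonneg (by positivity) (Finset.sum_nonneg fun j _ => mul_self_nonneg _)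

theorem lintegral_latentPrior (hσ : 0 < L.σ) (V : PosOrthant n) :
    ∫⁻ M, L.latentPrior V.1 M = 1 := by
  simp only [latentPrior]
  rw [volume_pi, lintegral_fin_prod _ fun i => measurable_gaussianPDF _ _]
  refine Finset.prod_eq_one fun i _ => lintegral_gaussianPDF_eq_one _ ?_
  have := V.2 i
  exact (Real.toNNReal_pos.2 (by positivity)).ne'

theorem lintegral_mixingPrior (hp : IntegrableOn (gigWeight L.p L.a L.b) (Set.Ioi 0)) :
    ∫⁻ V, L.mixingPrior V.1 ∂(orthantVolume n) = 1 := by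
  simp only [mixingPrior]
  rw [lintegral_orthantVolume_prod fun i => measurable_gigPDF' _ _ _]
  exact Finset.prod_eq_one fun i _ => lintegral_gigPDF hp

theorem unnormalizedPosterior_univ : L.unnormalizedPosterior Set.univ
    = ∫⁻ V, (∫⁻ M, L.jointDensity V.1 M) ∂(orthantVolume n) := by
  rw [unnormalizedPosterior_eq, withDensity_apply _ MeasurableSet.univ, Measure.restrict_univ]

theorem unnormalizedPosterior_univ_ne_top (hσ : 0 < L.σ) (hσε : 0 < L.σε)
    (hp : IntegrableOn (gigWeight L.p L.a L.b) (Set.Ioi 0)) :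
    L.unnormalizedPosterior Set.univ ≠ ∞ := by
  set C := ENNReal.ofReal (((√(2 * Real.pi * L.σε ^ 2))⁻¹) ^ m) with hC
  have hmp : Measurable fun V : PosOrthant n => L.mixingPrior V.1 :=
    measurable_mixingPrior.comp measurable_subtype_coe
  have hle : L.unnormalizedPosterior Set.univ ≤ C := by
    rw [unnormalizedPosterior_univ]
    calc _ ≤ ∫⁻ V, C * L.mixingPrior V.1 ∂(orthantVolume n) := by
          refine lintegral_mono fun V => ?_
          have hlp : Measurable (L.latentPrior V.1) := measurable_latentPrior_right V.1
          calc _ ≤ ∫⁻ M, C * L.latentPrior V.1 M * L.mixingPrior V.1 := by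
                refine lintegral_mono fun M => ?_
                unfold jointDensity
                gcongr
                exact likelihood_le hσε M
            _ = _ := by
                rw [lintegral_mul_const _ (hlp.const_mul C), lintegral_const_mul _ hlp,
                  lintegral_latentPrior hσ, mul_one]
      _ = C := by rw [lintegral_const_mul _ hmp, lintegral_mixingPrior hp, mul_one]
  exact (hle.trans_lt ENNReal.ofReal_lt_top).ne

theorem unnormalizedPosterior_univ_ne_zero (hσ : 0 < L.σ) (hσε : 0 < L.σε)
    (hp : IntegrableOn (gigWeight L.p L.a L.b) (Set.Ioi 0)) :
    L.unnormalizedPosterior Set.univ ≠ 0 := by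
  have hJ := L.measurable_jointDensity
  have hpos : ∀ (V : PosOrthant n) M, L.jointDensity V.1 M ≠ 0 := by
    intro V M
    have h1 := gigIntegral_pos hp
    refine mul_ne_zero (mul_ne_zero ?_ ?_) ?_
    · rw [likelihood_eq hσε]
      exact (ENNReal.ofReal_pos.2 (by positivity)).ne'
    · rw [latentPrior_eq hσ]
      refine (ENNReal.ofReal_pos.2 (mul_pos (Finset.prod_pos fun i _ => ?_) (Real.exp_pos _))).ne'
      have := V.2 i
      positivity
    · refine Finset.prod_ne_zero_iff.2 fun i _ => ?_
      rw [gigPDF_of_pos hp (V.2 i)]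
      exact (ENNReal.ofReal_pos.2 (div_pos (gigWeight_pos _ _ _ (V.2 i)) h1)).ne'
  rw [unnormalizedPosterior_univ]
  intro h0
  rw [lintegral_eq_zero_iff hJ.lintegral_prod_right'] at h0
  have hne : ∀ V : PosOrthant n, ∫⁻ M, L.jointDensity V.1 M ≠ 0 := by
    intro V h
    have hJV : Measurable fun M => L.jointDensity V.1 M :=
      (measurable_likelihood.mul (measurable_latentPrior_right V.1)).mul_const _
    rw [lintegral_eq_zero_iff hJV] at h
    obtain ⟨M, hM⟩ := h.exists
    exact hpos V M hM
  -- A positive density with zero integral forces the reference measure to vanish, against the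
  -- mixing prior having mass one.
  have hbot : orthantVolume n = 0 := by
    rw [← ae_eq_bot, ← Filter.eventually_false_iff_eq_bot]
    filter_upwards [h0] with V hV using hne V hV
  have := lintegral_mixingPrior (n := n) hp
  rw [hbot, lintegral_zero_measure] at this
  exact zero_ne_one this

theorem isProbabilityMeasure_posterior (hσ : 0 < L.σ) (hσε : 0 < L.σε)
    (hp : IntegrableOn (gigWeight L.p L.a L.b) (Set.Ioi 0)) :
    IsProbabilityMeasure L.posterior :=
  ⟨by rw [posterior, Measure.smul_apply, smul_eq_mul, ENNReal.inv_mul_cancel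
    (unnormalizedPosterior_univ_ne_zero hσ hσε hp) (unnormalizedPosterior_univ_ne_top hσ hσε hp)]⟩

theorem invariant_posterior (hσ : 0 < L.σ) (hσε : 0 < L.σε)
    (hp : IntegrableOn (gigWeight L.p L.a L.b) (Set.Ioi 0)) (hg : L.MixingIntegrable) :
    L.gibbsKernel.Invariant L.posterior := by
  rw [Kernel.Invariant]
  ext A hA
  have h := congrArg (fun κ : Measure (PosOrthant n) => κ A)
    (bind_unnormalizedPosterior hσ hσε hp hg)
  rw [Measure.bind_apply hA L.gibbsKernel.aemeasurable] at h
  rw [Measure.bind_apply hA L.gibbsKernel.aemeasurable, posterior, lintegral_smul_measure, h,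
    Measure.smul_apply]

/-! ### Minorization on compact sets -/

/-- The density of the latent field given the mixing variables, as a real number. -/
def latentCondDensity (L : LLnGM m n k) (V M : Fin n → ℝ) : ℝ :=
  (√((2 * Real.pi) ^ n * ((L.σ ^ 2) ^ n * ((L.QBar V).det)⁻¹)))⁻¹
    * Real.exp (-(1 / (2 * L.σ ^ 2))
      * ((M - L.condMean V) ⬝ᵥ (L.QBar V *ᵥ (M - L.condMean V))))

theorem latentCondDensity_pos (hσ : 0 < L.σ) (hσε : 0 < L.σε) {V : Fin n → ℝ}
    (hV : ∀ i, 0 < V i) (M : Fin n → ℝ) : 0 < L.latentCondDensity V M := by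
  have := (QBar_posDef (L.rho_pos hσ hσε) hV).det_pos
  unfold latentCondDensity
  positivity

theorem continuous_latentCondDensity (hσ : 0 < L.σ) (hσε : 0 < L.σε) {T : Type*}
    [TopologicalSpace T] {V M : T → Fin n → ℝ} (hV : Continuous V) (hM : Continuous M)
    (hpos : ∀ q i, 0 < V q i) : Continuous fun q => L.latentCondDensity (V q) (M q) := by
  have hdet : ∀ q, 0 < (L.QBar (V q)).det := fun q =>
    (QBar_posDef (L.rho_pos hσ hσε) (hpos q)).det_pos
  have hQc : Continuous fun q => L.QBar (V q) := by
    unfold QBar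
    refine continuous_const.add (Continuous.matrix_diagonal (continuous_pi fun i => ?_))
    exact ((continuous_apply i).comp hV).inv₀ fun q => (hpos q i).ne'
  have hdc : Continuous fun q => ((L.QBar (V q)).det)⁻¹ :=
    hQc.matrix_det.inv₀ fun q => (hdet q).ne'
  have hmc : Continuous fun q => L.condMean (V q) := by
    unfold condMean
    simp only [Matrix.inv_def, Ring.inverse_eq_inv']
    exact (hdc.smul hQc.matrix_adjugate).matrix_mulVec continuous_const
  have hsub : Continuous fun q => M q - L.condMean (V q) := hM.sub hmc
  have hquad : Continuous fun q =>
      (M q - L.condMean (V q)) ⬝ᵥ (L.QBar (V q) *ᵥ (M q - L.condMean (V q))) :=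
    hsub.dotProduct (hQc.matrix_mulVec hsub)
  unfold latentCondDensity
  refine Continuous.mul (Continuous.inv₀ ?_ fun q => ?_) ?_
  · exact (continuous_const.mul (continuous_const.mul hdc)).sqrt
  · have := hdet q
    positivity
  · exact Real.continuous_exp.comp (continuous_const.mul hquad)

theorem exists_latentCondPDF_lower_bound (hσ : 0 < L.σ) (hσε : 0 < L.σε) {r₁ r₂ : ℝ}
    (hr₁ : 0 < r₁) :
    ∃ ε : ℝ, 0 < ε ∧ ∀ V : PosOrthant n, (∀ i, V.1 i ∈ Set.Icc r₁ r₂) →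
      ∀ M : Fin n → ℝ, (∀ i, M i ∈ Set.Icc (1 : ℝ) 2) →
        ENNReal.ofReal ε ≤ L.latentCondPDF V.1 M := by
  have hpos : ∀ (q : (Fin n → Set.Icc r₁ r₂) × (Fin n → Set.Icc (1 : ℝ) 2)) i,
      0 < (fun i => (q.1 i : ℝ)) i := fun q i => hr₁.trans_le (q.1 i).2.1
  have hcont : Continuous fun q : (Fin n → Set.Icc r₁ r₂) × (Fin n → Set.Icc (1 : ℝ) 2) =>
      L.latentCondDensity (fun i => (q.1 i : ℝ)) (fun i => (q.2 i : ℝ)) :=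
    continuous_latentCondDensity hσ hσε (by fun_prop) (by fun_prop) hpos
  have hmin : ∃ ε : ℝ, 0 < ε ∧ ∀ q : (Fin n → Set.Icc r₁ r₂) × (Fin n → Set.Icc (1 : ℝ) 2),
      ε ≤ L.latentCondDensity (fun i => (q.1 i : ℝ)) (fun i => (q.2 i : ℝ)) := by
    -- The box is empty if `r₁ > r₂` and `n > 0`; any `ε` then works.
    rcases isEmpty_or_nonempty ((Fin n → Set.Icc r₁ r₂) × (Fin n → Set.Icc (1 : ℝ) 2)) with
      hemp | hne
    · exact ⟨1, one_pos, fun q => (hemp.false q).elim⟩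
    · obtain ⟨q₀, -, hq₀⟩ := isCompact_univ.exists_isMinOn Set.univ_nonempty hcont.continuousOn
      exact ⟨_, latentCondDensity_pos hσ hσε (hpos q₀) _, fun q => hq₀ (Set.mem_univ q)⟩
  obtain ⟨ε, hε, h⟩ := hmin
  refine ⟨ε, hε, fun V hV M hM => ?_⟩
  have h' := h (fun i => ⟨V.1 i, hV i⟩, fun i => ⟨M i, hM i⟩)
  have e := latentCondPDF_eq hσ hσε V M
  exact (ENNReal.ofReal_le_ofReal h').trans_eq e.symm

/-- Restrict the draw of `M` to the cube `[1,2]ⁿ`, where its density is at least `ε`. The cube has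
volume one and avoids zero coordinates, so the `V`-update is a probability law there and `η` has
mass `ε`. -/
theorem exists_minorization (hσ : 0 < L.σ) (hσε : 0 < L.σε) (hg : L.MixingIntegrable) {r₁ r₂ : ℝ}
    (hr₁ : 0 < r₁) :
    ∃ η : Measure (PosOrthant n), η Set.univ ≠ 0 ∧
      ∀ V : PosOrthant n, (∀ i, V.1 i ∈ Set.Icc r₁ r₂) → η ≤ L.gibbsKernel V := by
  obtain ⟨ε, hε, h⟩ := exists_latentCondPDF_lower_bound (L := L) hσ hσε (r₂ := r₂) hr₁
  set S : Set (Fin n → ℝ) := Set.univ.pi fun _ => Set.Icc (1 : ℝ) 2 with hS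
  have hSm : MeasurableSet S := MeasurableSet.univ_pi fun _ => measurableSet_Icc
  refine ⟨ENNReal.ofReal ε • (volume.restrict S).bind L.mixingKernel, ?_, fun V hV => ?_⟩
  · rw [Measure.smul_apply, smul_eq_mul, Measure.bind_apply MeasurableSet.univ
      L.mixingKernel.aemeasurable]
    refine mul_ne_zero (ENNReal.ofReal_pos.2 hε).ne' ?_
    have h1 : ∫⁻ M in S, L.mixingKernel M Set.univ = ∫⁻ _ in S, 1 :=
      setLIntegral_congr_fun hSm fun M hM => mixingKernel_univ hg fun i =>
        (lt_of_lt_of_le one_pos (hM i trivial).1).ne'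
    rw [h1, setLIntegral_one, hS, volume_pi_pi]
    simp only [Real.volume_Icc]
    norm_num
  · refine Measure.le_iff.2 fun A hA => ?_
    have hkA : Measurable fun M => L.mixingKernel M A := L.mixingKernel.measurable_coe hA
    rw [Measure.smul_apply, smul_eq_mul, Measure.bind_apply hA L.mixingKernel.aemeasurable,
      gibbsKernel, Kernel.comp_apply' _ _ _ hA]
    change _ ≤ ∫⁻ M, L.mixingKernel M A ∂(volume.withDensity fun M => L.latentCondPDF V.1 M)
    rw [lintegral_withDensity_eq_lintegral_mul _ (measurable_latentCondPDF_right V) hkA,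
      ← lintegral_const_mul _ hkA]
    refine le_trans ?_ (setLIntegral_le_lintegral S _)
    refine setLIntegral_mono ((measurable_latentCondPDF_right V).mul hkA) fun M hM => ?_
    simp only [Pi.mul_apply]
    gcongr
    exact h V hV M fun i => hM i trivial

end LLnGM

/-! ### Moment drifts and geometric ergodicity -/

theorem lintegral_ofReal_affine_le {α : Type*} [MeasurableSpace α] {ν : Measure α}
    [IsProbabilityMeasure ν] {f : α → ℝ} (hf : Measurable f) {c₀ c₁ B : ℝ} (hc₀ : 0 ≤ c₀)
    (hc₁ : 0 ≤ c₁) (hB : 0 ≤ B) (h : ∫⁻ x, ENNReal.ofReal (f x) ∂ν ≤ ENNReal.ofReal B) :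
    ∫⁻ x, ENNReal.ofReal (c₀ + c₁ * f x) ∂ν ≤ ENNReal.ofReal (c₀ + c₁ * B) := by
  have hfm : Measurable fun x => ENNReal.ofReal (f x) := hf.ennreal_ofReal
  calc ∫⁻ x, ENNReal.ofReal (c₀ + c₁ * f x) ∂ν
      ≤ ∫⁻ x, (ENNReal.ofReal c₀ + ENNReal.ofReal c₁ * ENNReal.ofReal (f x)) ∂ν := by
        refine lintegral_mono fun x => ENNReal.ofReal_add_le.trans ?_
        rw [ENNReal.ofReal_mul hc₁]
    _ = ENNReal.ofReal c₀ + ENNReal.ofReal c₁ * ∫⁻ x, ENNReal.ofReal (f x) ∂ν := by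
        rw [lintegral_add_left measurable_const, lintegral_const, measure_univ, mul_one,
          lintegral_const_mul _ hfm]
    _ ≤ ENNReal.ofReal c₀ + ENNReal.ofReal c₁ * ENNReal.ofReal B := by gcongr
    _ = _ := by rw [← ENNReal.ofReal_mul hc₁, ← ENNReal.ofReal_add hc₀ (mul_nonneg hc₁ hB)]

theorem sum_ofReal_le {ι : Type*} (s : Finset ι) {f : ι → ℝ≥0∞} {g : ι → ℝ}
    (hg : ∀ i ∈ s, 0 ≤ g i) (h : ∀ i ∈ s, f i ≤ ENNReal.ofReal (g i)) :
    ∑ i ∈ s, f i ≤ ENNReal.ofReal (∑ i ∈ s, g i) := by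
  rw [ENNReal.ofReal_sum_of_nonneg hg]
  exact Finset.sum_le_sum h

namespace LLnGM

variable {m n k : ℕ} {L : LLnGM m n k}

/-- Geometric ergodicity from drift conditions on a positive and a negative moment. -/
theorem geometricallyErgodic_of_moment_drift (hσ : 0 < L.σ) (hσε : 0 < L.σε)
    (hp : IntegrableOn (gigWeight L.p L.a L.b) (Set.Ioi 0)) (hg : L.MixingIntegrable)
    {s t : ℝ} (hs : 0 < s) (ht : 0 < t)
    (hpos : ∃ lam K : ℝ, lam < 1 ∧ ∀ V : PosOrthant n,
      ∑ i, ∫⁻ W, ENNReal.ofReal (W.1 i ^ s) ∂(L.gibbsKernel V)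
        ≤ ENNReal.ofReal (lam * ∑ i, V.1 i ^ s + K))
    (hneg : ∃ lam K : ℝ, lam < 1 ∧ ∀ V : PosOrthant n,
      ∑ i, ∫⁻ W, ENNReal.ofReal (W.1 i ^ (-t)) ∂(L.gibbsKernel V)
        ≤ ENNReal.ofReal (lam * ∑ i, V.1 i ^ (-t) + K)) :
    GeometricallyErgodic L.gibbsKernel L.posterior := by
  obtain ⟨l₁, K₁, hl₁, h₁⟩ := hpos
  obtain ⟨l₂, K₂, hl₂, h₂⟩ := hneg
  have := isMarkovKernel_gibbsKernel hσ hσε hg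
  have := isProbabilityMeasure_posterior hσ hσε hp
  have hs0 : ∀ (V : PosOrthant n) (r : ℝ) i, 0 ≤ V.1 i ^ r := fun V r i =>
    Real.rpow_nonneg (V.2 i).le r
  have hS : ∀ (V : PosOrthant n) (r : ℝ), 0 ≤ ∑ i, V.1 i ^ r := fun V r =>
    Finset.sum_nonneg fun i _ => hs0 V r i
  have hm : ∀ (r : ℝ) i, Measurable fun V : PosOrthant n => V.1 i ^ r := fun r i =>
    ((measurable_pi_apply i).comp measurable_subtype_coe).pow_const r
  have hlint : ∀ (V : PosOrthant n) (r : ℝ),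
      ∫⁻ W, ENNReal.ofReal (∑ i, W.1 i ^ r) ∂(L.gibbsKernel V)
        = ∑ i, ∫⁻ W, ENNReal.ofReal (W.1 i ^ r) ∂(L.gibbsKernel V) := by
    intro V r
    rw [← lintegral_finsetSum _ fun i _ => (hm r i).ennreal_ofReal]
    exact lintegral_congr fun W => ENNReal.ofReal_sum_of_nonneg fun i _ => hs0 W r i
  -- The given rates may be negative, while Harris' theorem requires a nonnegative one.
  set lam := max (max l₁ l₂) 0 with hlam
  set K := |K₁| + |K₂| with hK
  refine geometricallyErgodic_of_drift_minorization
    (W := fun V : PosOrthant n => ∑ i, V.1 i ^ s + ∑ i, V.1 i ^ (-t)) (lam := lam) (K := K)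
    (invariant_posterior hσ hσε hp hg)
    ((Finset.measurable_sum _ fun i _ => hm s i).add (Finset.measurable_sum _ fun i _ => hm _ i))
    (fun V => add_nonneg (hS V s) (hS V _)) (le_max_right _ _)
    (max_lt (max_lt hl₁ hl₂) one_pos) (by positivity) (fun V => ?_) (fun R => ?_)
  · have hms : Measurable fun V : PosOrthant n => ENNReal.ofReal (∑ i, V.1 i ^ s) :=
      (Finset.measurable_sum _ fun i _ => hm s i).ennreal_ofReal
    have e₁ : l₁ * ∑ i, V.1 i ^ s ≤ lam * ∑ i, V.1 i ^ s :=
      mul_le_mul_of_nonneg_right ((le_max_left _ _).trans (le_max_left _ _)) (hS V s)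
    have e₂ : l₂ * ∑ i, V.1 i ^ (-t) ≤ lam * ∑ i, V.1 i ^ (-t) :=
      mul_le_mul_of_nonneg_right ((le_max_right _ _).trans (le_max_left _ _)) (hS V _)
    have hlam0 : 0 ≤ lam := le_max_right _ _
    calc _ = ∫⁻ W, (ENNReal.ofReal (∑ i, W.1 i ^ s) + ENNReal.ofReal (∑ i, W.1 i ^ (-t)))
          ∂(L.gibbsKernel V) :=
          lintegral_congr fun W => ENNReal.ofReal_add (hS W s) (hS W _)
      _ ≤ ENNReal.ofReal (lam * ∑ i, V.1 i ^ s + |K₁|)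
          + ENNReal.ofReal (lam * ∑ i, V.1 i ^ (-t) + |K₂|) := by
          rw [lintegral_add_left hms, hlint, hlint]
          refine add_le_add ((h₁ V).trans (ENNReal.ofReal_le_ofReal ?_))
            ((h₂ V).trans (ENNReal.ofReal_le_ofReal ?_))
          · linarith [le_abs_self K₁]
          · linarith [le_abs_self K₂]
      _ = _ := by
          have := hS V s
          have := hS V (-t)
          rw [← ENNReal.ofReal_add (by positivity) (by positivity)]
          congr 1
          ring
  -- On a sublevel set each of `Vᵢ ^ s` and `Vᵢ ^ (-t)` is at most `R'`, so `V` lies in a box; the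
  -- maximum with `1` makes the real powers of `R'` positive.
  · set R' := max R 1 with hR'
    have hR'0 : 0 < R' := one_pos.trans_le (le_max_right _ _)
    obtain ⟨η, hη, h⟩ := exists_minorization (L := L) hσ hσε hg
      (r₁ := R' ^ (-(1 / t))) (r₂ := R' ^ (1 / s)) (Real.rpow_pos_of_pos hR'0 _)
    refine ⟨η, hη, fun V hV => h V fun i => ?_⟩
    have hVi := V.2 i
    have i₁ : V.1 i ^ s ≤ R' := by
      have := Finset.single_le_sum (fun j _ => hs0 V s j) (Finset.mem_univ i)
      have := hS V (-t)
      have := le_max_left R 1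
      linarith
    have i₂ : V.1 i ^ (-t) ≤ R' := by
      have := Finset.single_le_sum (fun j _ => hs0 V (-t) j) (Finset.mem_univ i)
      have := hS V s
      have := le_max_left R 1
      linarith
    constructor
    · have := Real.rpow_le_rpow_of_nonpos (Real.rpow_pos_of_pos hVi (-t)) i₂
        (show -(1 / t) ≤ 0 by rw [neg_nonpos]; positivity)
      rwa [← Real.rpow_mul hVi.le, neg_mul_neg, mul_one_div_cancel ht.ne', Real.rpow_one] at this
    · have := Real.rpow_le_rpow (hs0 V s i) i₁ (show 0 ≤ 1 / s by positivity)
      rwa [← Real.rpow_mul hVi.le, mul_one_div_cancel hs.ne', Real.rpow_one] at this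

/-- A bound on a moment of the full conditional laws of the mixing variables gives a bound on the
one-step moment of the Gibbs sampler. -/
theorem lintegral_rpow_gibbsKernel_le (hσ : 0 < L.σ) (hσε : 0 < L.σε) (hg : L.MixingIntegrable)
    {r c₀ c₁ B : ℝ} (hc₀ : 0 ≤ c₀) (hc₁ : 0 ≤ c₁) (hB : 0 ≤ B) {f : ℝ → ℝ} (hf : Measurable f)
    (hr : ∀ x ≠ 0, IntegrableOn
      (gigWeight (L.p - 1 / 2 + r) L.aTilde (L.b + (x / L.σ) ^ 2)) (Set.Ioi 0))
    (h : ∀ x ≠ 0, gigIntegral (L.p - 1 / 2 + r) L.aTilde (L.b + (x / L.σ) ^ 2)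
      ≤ (c₀ + c₁ * f x) * gigIntegral (L.p - 1 / 2) L.aTilde (L.b + (x / L.σ) ^ 2))
    (V : PosOrthant n) (i : Fin n)
    (hfB : ∫⁻ x, ENNReal.ofReal (f x) ∂(gaussianReal (L.condMean V.1 i) (L.condVar V.1 i))
      ≤ ENNReal.ofReal B) :
    ∫⁻ W, ENNReal.ofReal (W.1 i ^ r) ∂(L.gibbsKernel V) ≤ ENNReal.ofReal (c₀ + c₁ * B) :=
  (lintegral_gibbsKernel_le hσ hσε V i (f := fun v => ENNReal.ofReal (v ^ r))
    (H := fun x => ENNReal.ofReal (c₀ + c₁ * f x)) (measurable_id.pow_const r).ennreal_ofReal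
    ((hf.const_mul c₁).const_add c₀).ennreal_ofReal
    fun x hx => lintegral_rpow_mul_gigPDF_le (hg x hx) (hr x hx) (h x hx)).trans
  (lintegral_ofReal_affine_le hf hc₀ hc₁ hB hfB)

theorem sigma_sq_mul_aTilde (hσ : 0 < L.σ) : L.σ ^ 2 * L.aTilde = L.σ ^ 2 * L.a + L.μ ^ 2 := by
  unfold aTilde
  field_simp

/-- Drift of the second moment under null-smallness. -/
theorem exists_sq_drift (hK : IsUnit L.K.det) (hσ : 0 < L.σ) (hσε : 0 < L.σε)
    (hg : L.MixingIntegrable) (hã : 0 < L.aTilde) (hb : 0 ≤ L.b) (hns : L.NullSmallness) :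
    ∃ lam K : ℝ, lam < 1 ∧ ∀ V : PosOrthant n,
      ∑ i, ∫⁻ W, ENNReal.ofReal (W.1 i ^ (2 : ℝ)) ∂(L.gibbsKernel V)
        ≤ ENNReal.ofReal (lam * ∑ i, V.1 i ^ (2 : ℝ) + K) := by
  have hD : 0 < L.σ ^ 2 * L.a + L.μ ^ 2 := by
    rw [← sigma_sq_mul_aTilde hσ]; positivity
  obtain ⟨e, w, hone, he⟩ := hns.exists_decomposition hK hD
  have hρ := L.rho_pos hσ hσε
  obtain ⟨Cm, hCm, hmean⟩ := exists_condMean_sq_le hρ hone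
  set D := L.σ ^ 2 * L.a + L.μ ^ 2 with hDdef
  set κ := L.μ ^ 2 * (e ⬝ᵥ e) / D with hκ
  have hee : 0 ≤ e ⬝ᵥ e := Finset.sum_nonneg fun j _ => mul_self_nonneg _
  have hκ0 : 0 ≤ κ := by positivity
  have hκ1 : κ < 1 := (div_lt_one hD).2 he
  -- Then `1 - (1 + ε) κ = (1 - κ)(2 - κ)/2 > 0`, so the loss in the GIG moment keeps the rate below
  -- one.
  set ε := (1 - κ) / 2 with hε
  have hε0 : 0 < ε := by rw [hε]; linarith
  obtain ⟨C, hC, hmom⟩ := exists_gigIntegral_add_two_le (L.p - 1 / 2) hã hε0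
  set c₁ := (1 + ε) / D with hc₁
  set c₀ := (1 + ε) / L.aTilde * L.b + C with hc₀
  have hc₁0 : 0 ≤ c₁ := by positivity
  have hc₀0 : 0 ≤ c₀ := by positivity
  have hβ : ∀ x ≠ 0, 0 < L.b + (x / L.σ) ^ 2 := fun x hx => by positivity
  have hcoord : ∀ (V : PosOrthant n) i, ∫⁻ W, ENNReal.ofReal (W.1 i ^ (2 : ℝ)) ∂(L.gibbsKernel V)
      ≤ ENNReal.ofReal (c₀ + c₁ * (L.condMean V.1 i ^ 2 + L.σ ^ 2 * V.1 i)) := by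
    intro V i
    have hVi := V.2 i
    refine lintegral_rpow_gibbsKernel_le hσ hσε hg hc₀0 hc₁0 (f := fun x => x ^ 2)
      (by positivity) (measurable_id.pow_const 2)
      (fun x hx => integrableOn_gigWeight_of_pos hã (hβ x hx)) (fun x hx => ?_) V i ?_
    · refine (hmom _ (hβ x hx)).trans_eq ?_
      congr 1
      rw [hc₀, hc₁, hDdef, ← sigma_sq_mul_aTilde hσ]
      field_simp
      ring
    · rw [lintegral_sq_gaussianReal, coe_condVar hσ hσε]
      gcongr
      exact QBar_inv_diag_le hρ V.2 i
  set lam₀ := (1 + ε) * κ with hlam₀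
  have hlam₀1 : lam₀ < 1 := by rw [hlam₀, hε]; nlinarith
  set δ := (1 - lam₀) / 2 with hδ
  have hδ0 : 0 < δ := by rw [hδ]; linarith
  -- Collects the terms linear in `v = |V|`; they are absorbed by `F v ≤ δ v² + F²/(4δ)`.
  set F := c₁ * (Cm + L.σ ^ 2 * n) with hF
  refine ⟨lam₀ + δ, n * c₀ + F ^ 2 / (4 * δ), by rw [hδ]; linarith, fun V => ?_⟩
  refine (sum_ofReal_le _ (fun i _ => ?_) fun i _ => hcoord V i).trans
    (ENNReal.ofReal_le_ofReal ?_)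
  · have := V.2 i
    positivity
  set v := √(∑ i, V.1 i ^ 2) with hv
  have hv0 : 0 ≤ v := Real.sqrt_nonneg _
  have hv2 : v ^ 2 = ∑ i, V.1 i ^ 2 := Real.sq_sqrt (Finset.sum_nonneg fun i _ => sq_nonneg _)
  have hVv : ∀ i, V.1 i ≤ v := fun i => Real.le_sqrt_of_sq_le
    (Finset.single_le_sum (f := fun i => V.1 i ^ 2) (fun j _ => sq_nonneg _) (Finset.mem_univ i))
  have hsum : ∑ i, V.1 i ≤ n * v := by
    calc _ ≤ ∑ _i : Fin n, v := Finset.sum_le_sum fun i _ => hVv i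
      _ = _ := by simp
  have h1 := hmean V.1 v V.2 hVv hv0
  have h2 : ∑ i, (c₀ + c₁ * (L.condMean V.1 i ^ 2 + L.σ ^ 2 * V.1 i))
      = n * c₀ + c₁ * (∑ i, L.condMean V.1 i ^ 2 + L.σ ^ 2 * ∑ i, V.1 i) := by
    rw [Finset.sum_add_distrib, Finset.sum_const, Finset.card_univ, Fintype.card_fin, nsmul_eq_mul,
      ← Finset.mul_sum, Finset.sum_add_distrib, ← Finset.mul_sum]
  simp only [Real.rpow_two]
  rw [h2, ← hv2]
  have h3 : c₁ * (L.μ ^ 2 * (e ⬝ᵥ e)) = lam₀ := by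
    rw [hc₁, hlam₀, hκ]; ring
  have h4 : F * v ≤ δ * v ^ 2 + F ^ 2 / (4 * δ) := by
    have : 0 ≤ (2 * δ * v - F) ^ 2 / (4 * δ) := by positivity
    have e : (2 * δ * v - F) ^ 2 / (4 * δ) = δ * v ^ 2 - F * v + F ^ 2 / (4 * δ) := by
      field_simp; ring
    linarith
  calc _ ≤ n * c₀ + c₁ * (Cm * v + L.μ ^ 2 * (e ⬝ᵥ e) * v ^ 2 + L.σ ^ 2 * (n * v)) := by gcongr
    _ = n * c₀ + (c₁ * (L.μ ^ 2 * (e ⬝ᵥ e))) * v ^ 2 + F * v := by rw [hF]; ring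
    _ ≤ _ := by rw [h3]; linarith

/-- The inverse moment has a bounded one-step expectation if the conditional inverse moments are
bounded. -/
theorem exists_inv_drift_of_gigIntegral_le (hσ : 0 < L.σ) (hσε : 0 < L.σε)
    (hg : L.MixingIntegrable) {C : ℝ} (hC : 0 ≤ C)
    (hr : ∀ x ≠ 0, IntegrableOn
      (gigWeight (L.p - 1 / 2 + -1) L.aTilde (L.b + (x / L.σ) ^ 2)) (Set.Ioi 0))
    (h : ∀ x ≠ 0, gigIntegral (L.p - 1 / 2 + -1) L.aTilde (L.b + (x / L.σ) ^ 2)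
      ≤ C * gigIntegral (L.p - 1 / 2) L.aTilde (L.b + (x / L.σ) ^ 2)) :
    ∃ lam K : ℝ, lam < 1 ∧ ∀ V : PosOrthant n,
      ∑ i, ∫⁻ W, ENNReal.ofReal (W.1 i ^ (-1 : ℝ)) ∂(L.gibbsKernel V)
        ≤ ENNReal.ofReal (lam * ∑ i, V.1 i ^ (-1 : ℝ) + K) := by
  refine ⟨0, ∑ _i : Fin n, (C + 0 * 0), one_pos, fun V => ?_⟩
  rw [zero_mul, zero_add]
  refine sum_ofReal_le _ (fun i _ => by simpa using hC) fun i _ => ?_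
  exact lintegral_rpow_gibbsKernel_le hσ hσε hg hC le_rfl le_rfl (f := fun _ => 0)
    measurable_const hr (by simpa using h) V i (by simp)

/-! ### The regime of inverse gamma full conditionals -/

/-- The inverse moment of an inverse gamma law is its shape divided by its scale, and the scale is
at least `b/2`. -/
theorem exists_inv_drift_of_aTilde_eq_zero (hσ : 0 < L.σ) (hσε : 0 < L.σε)
    (hg : L.MixingIntegrable) (hã : L.aTilde = 0) (hp : L.p < 0) (hb : 0 < L.b) :
    ∃ lam K : ℝ, lam < 1 ∧ ∀ V : PosOrthant n,
      ∑ i, ∫⁻ W, ENNReal.ofReal (W.1 i ^ (-1 : ℝ)) ∂(L.gibbsKernel V)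
        ≤ ENNReal.ofReal (lam * ∑ i, V.1 i ^ (-1 : ℝ) + K) := by
  have hβ : ∀ x, L.b ≤ L.b + (x / L.σ) ^ 2 := fun x => le_add_of_nonneg_right (sq_nonneg _)
  have g1 := Real.Gamma_pos_of_pos (show 0 < -(L.p - 1 / 2 + -1) by linarith [hp])
  have g2 := Real.Gamma_pos_of_pos (show 0 < -(L.p - 1 / 2) by linarith)
  refine exists_inv_drift_of_gigIntegral_le hσ hσε hg
    (C := Real.Gamma (-(L.p - 1 / 2 + -1)) / Real.Gamma (-(L.p - 1 / 2)) * (L.b / 2)⁻¹)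
    (by positivity) (fun x _ => ?_) fun x _ => ?_
  · rw [hã]
    exact integrableOn_gigWeight_of_pos_right (hb.trans_le (hβ x)) (by linarith)
  · have hβ0 := hb.trans_le (hβ x)
    rw [hã, gigIntegral_zero_left hβ0 (by linarith), gigIntegral_zero_left hβ0 (by linarith),
      Real.rpow_add (by positivity), Real.rpow_neg_one]
    have h1 : ((L.b + (x / L.σ) ^ 2) / 2)⁻¹ ≤ (L.b / 2)⁻¹ := by
      gcongr
      exact hβ x
    calc _ = Real.Gamma (-(L.p - 1 / 2 + -1)) * ((L.b + (x / L.σ) ^ 2) / 2) ^ (L.p - 1 / 2)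
          * ((L.b + (x / L.σ) ^ 2) / 2)⁻¹ := by ring
      _ ≤ Real.Gamma (-(L.p - 1 / 2 + -1)) * ((L.b + (x / L.σ) ^ 2) / 2) ^ (L.p - 1 / 2)
          * (L.b / 2)⁻¹ := by gcongr
      _ = _ := by
        generalize Real.Gamma (-(L.p - 1 / 2)) = g at g2 ⊢
        field_simp

/-- The bound `s ≤ 1/2` makes the powers `s` and `2 s` subadditive, separating `b` and the bounded
mean from the variance. The remaining coefficient of `Vᵢ ^ s` is a quotient of Gamma products; `s ≤
-p/2` is the range in which bringing the arguments closer lowers the product. -/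
theorem exists_rpow_drift_of_aTilde_eq_zero (hσ : 0 < L.σ) (hσε : 0 < L.σε)
    (hg : L.MixingIntegrable) (hã : L.aTilde = 0) (hμ : L.μ = 0) (hb : 0 < L.b)
    {s : ℝ} (hs : 0 < s) (hs1 : s ≤ 1 / 2) (hsp : s ≤ -L.p / 2) :
    ∃ lam K : ℝ, lam < 1 ∧ ∀ V : PosOrthant n,
      ∑ i, ∫⁻ W, ENNReal.ofReal (W.1 i ^ s) ∂(L.gibbsKernel V)
        ≤ ENNReal.ofReal (lam * ∑ i, V.1 i ^ s + K) := by
  have hρ := L.rho_pos hσ hσε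
  obtain ⟨Cm, hCm, hmean⟩ := exists_condMean_bound (L := L) hρ
    (w := L.rho • (L.Y - L.X *ᵥ L.β + L.μ • (L.B *ᵥ L.h)))
    (by rw [mBar, hμ, zero_smul, add_zero, zero_smul, add_zero, Matrix.mulVec_smul])
  have hβ : ∀ x, 0 < L.b + (x / L.σ) ^ 2 := fun x => by positivity
  have g0 := Real.Gamma_pos_of_pos (show (0 : ℝ) < 1 / 2 by norm_num)
  have g1 := Real.Gamma_pos_of_pos (show 0 < 1 / 2 + s by linarith)
  have g2 := Real.Gamma_pos_of_pos (show 0 < 1 / 2 - L.p by linarith)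
  have g3 := Real.Gamma_pos_of_pos (show 0 < 1 / 2 - L.p - s by linarith)
  set G := Real.Gamma (1 / 2 - L.p - s) / Real.Gamma (1 / 2 - L.p) with hG
  have hG0 : 0 < G := div_pos g3 g2
  set c₀ := G * (L.b / 2) ^ s with hc₀
  set c₁ := G * ((2 * L.σ ^ 2) ^ s)⁻¹ with hc₁
  have hc₀0 : 0 ≤ c₀ := by positivity
  have hc₁0 : 0 ≤ c₁ := by positivity
  set N := stdNormalAbsMoment (2 * s) with hN
  have hN0 : 0 < N := stdNormalAbsMoment_pos (by linarith)
  have hcoord : ∀ (V : PosOrthant n) i, ∫⁻ W, ENNReal.ofReal (W.1 i ^ s) ∂(L.gibbsKernel V)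
      ≤ ENNReal.ofReal (c₀ + c₁ * (Cm ^ (2 * s) + (L.σ ^ 2 * V.1 i) ^ s * N)) := by
    intro V i
    have hVi := V.2 i
    refine lintegral_rpow_gibbsKernel_le hσ hσε hg hc₀0 hc₁0 (f := fun x => |x| ^ (2 * s))
      (by positivity) (by fun_prop) (fun x _ => ?_) (fun x _ => ?_) V i ?_
    · rw [hã]
      exact integrableOn_gigWeight_of_pos_right (hβ x) (by linarith)
    · have hβ2 : 0 < (L.b + (x / L.σ) ^ 2) / 2 := half_pos (hβ x)
      rw [hã, gigIntegral_zero_left (hβ x) (by linarith),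
        gigIntegral_zero_left (hβ x) (by linarith), Real.rpow_add hβ2,
        show -(L.p - 1 / 2 + s) = 1 / 2 - L.p - s by ring,
        show -(L.p - 1 / 2) = 1 / 2 - L.p by ring]
      have e1 : (x ^ 2 / (2 * L.σ ^ 2)) ^ s = ((2 * L.σ ^ 2) ^ s)⁻¹ * |x| ^ (2 * s) := by
        rw [Real.div_rpow (sq_nonneg _) (by positivity), Real.rpow_mul (abs_nonneg x),
          Real.rpow_two, sq_abs]
        ring
      have e2 : ((L.b + (x / L.σ) ^ 2) / 2) ^ s
          ≤ (L.b / 2) ^ s + ((2 * L.σ ^ 2) ^ s)⁻¹ * |x| ^ (2 * s) := by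
        rw [← e1, show (L.b + (x / L.σ) ^ 2) / 2 = L.b / 2 + x ^ 2 / (2 * L.σ ^ 2) by
          field_simp]
        exact Real.rpow_add_le_add_rpow (by positivity) (by positivity) hs.le (by linarith)
      have e3 : Real.Gamma (1 / 2 - L.p - s) = G * Real.Gamma (1 / 2 - L.p) := by
        rw [hG, div_mul_cancel₀ _ g2.ne']
      calc _ = G * Real.Gamma (1 / 2 - L.p) * ((L.b + (x / L.σ) ^ 2) / 2) ^ (L.p - 1 / 2)
            * ((L.b + (x / L.σ) ^ 2) / 2) ^ s := by rw [e3]; ring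
        _ ≤ G * Real.Gamma (1 / 2 - L.p) * ((L.b + (x / L.σ) ^ 2) / 2) ^ (L.p - 1 / 2)
            * ((L.b / 2) ^ s + ((2 * L.σ ^ 2) ^ s)⁻¹ * |x| ^ (2 * s)) := by gcongr
        _ = _ := by rw [hc₀, hc₁]; ring
    · refine (lintegral_abs_rpow_gaussianReal_le _ _ (by linarith) (by linarith)).trans ?_
      rw [coe_condVar hσ hσε, mul_div_cancel_left₀ _ two_ne_zero, ← hN]
      have hq := QBar_inv_diag_pos hρ V.2 i
      refine ENNReal.ofReal_le_ofReal ?_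
      gcongr
      · exact (norm_le_pi_norm (L.condMean V.1) i).trans (hmean V.1 V.2)
      · exact QBar_inv_diag_le hρ V.2 i
  refine ⟨c₁ * (L.σ ^ 2) ^ s * N, n * (c₀ + c₁ * Cm ^ (2 * s)), ?_, fun V => ?_⟩
  · have hlt := Real.Gamma_mul_Gamma_lt (x := 1 / 2) (y := 1 / 2 - L.p) (s := s) (by norm_num) hs
      (by linarith)
    have e : c₁ * (L.σ ^ 2) ^ s * N
        = Real.Gamma (1 / 2 + s) * Real.Gamma (1 / 2 - L.p - s)
          / (Real.Gamma (1 / 2) * Real.Gamma (1 / 2 - L.p)) := by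
      rw [hc₁, hN, hG, stdNormalAbsMoment, mul_div_cancel_left₀ _ two_ne_zero,
        show (2 * s + 1) / 2 = 1 / 2 + s by ring, Real.mul_rpow two_pos.le (sq_nonneg _)]
      have : 0 < (L.σ ^ 2) ^ s := by positivity
      have : 0 < (2 : ℝ) ^ s := by positivity
      field_simp
    rw [e, div_lt_one (by positivity)]
    exact hlt
  · refine (sum_ofReal_le _ (fun i _ => ?_) fun i _ => hcoord V i).trans_eq ?_
    · have := V.2 i
      positivity
    · congr 1
      rw [Finset.mul_sum]
      have : ∀ i, c₀ + c₁ * (Cm ^ (2 * s) + (L.σ ^ 2 * V.1 i) ^ s * N)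
          = (c₀ + c₁ * Cm ^ (2 * s)) + c₁ * (L.σ ^ 2) ^ s * N * V.1 i ^ s := fun i => by
        rw [Real.mul_rpow (sq_nonneg _) (V.2 i).le]; ring
      simp only [this]
      rw [Finset.sum_add_distrib, Finset.sum_const, Finset.card_univ, Fintype.card_fin,
        nsmul_eq_mul, add_comm]

/-! ### The regimes under null-smallness -/

theorem exists_inv_drift_of_aTilde_pos (hσ : 0 < L.σ) (hσε : 0 < L.σε)
    (hg : L.MixingIntegrable) (hã : 0 < L.aTilde) (hb : 0 < L.b) :
    ∃ lam K : ℝ, lam < 1 ∧ ∀ V : PosOrthant n,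
      ∑ i, ∫⁻ W, ENNReal.ofReal (W.1 i ^ (-1 : ℝ)) ∂(L.gibbsKernel V)
        ≤ ENNReal.ofReal (lam * ∑ i, V.1 i ^ (-1 : ℝ) + K) := by
  obtain ⟨C, hC, h⟩ := exists_gigIntegral_sub_one_le (L.p - 1 / 2) hã hb
  have hβ : ∀ x, L.b ≤ L.b + (x / L.σ) ^ 2 := fun x => le_add_of_nonneg_right (sq_nonneg _)
  exact exists_inv_drift_of_gigIntegral_le hσ hσε hg hC
    (fun x _ => integrableOn_gigWeight_of_pos hã (hb.trans_le (hβ x)))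
    fun x _ => by rw [← sub_eq_add_neg]; exact h _ (hβ x)

/-- Drift of a small negative moment when the mixing prior is a gamma law. -/
theorem exists_rpow_neg_drift (hσ : 0 < L.σ) (hσε : 0 < L.σε)
    (hg : L.MixingIntegrable) (hã : 0 < L.aTilde) (hb : L.b = 0) {t : ℝ} (ht : 0 < t)
    (ht1 : t ≤ 1 / 8) (htp : 2 * t ≤ L.p) :
    ∃ lam K : ℝ, lam < 1 ∧ ∀ V : PosOrthant n,
      ∑ i, ∫⁻ W, ENNReal.ofReal (W.1 i ^ (-t)) ∂(L.gibbsKernel V)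
        ≤ ENNReal.ofReal (lam * ∑ i, V.1 i ^ (-t) + K) := by
  have hρ := L.rho_pos hσ hσε
  have g0 := Real.Gamma_pos_of_pos (show (0 : ℝ) < 1 / 2 by norm_num)
  have g1 := Real.Gamma_pos_of_pos (show 0 < 1 / 2 - t by linarith)
  have g2 := Real.Gamma_pos_of_pos (show 0 < 1 / 2 - 2 * t by linarith)
  -- The strict gap leaves room for `l`, which exceeds the limiting GIG constant and still gives a
  -- rate below one after multiplication by `Γ(1/2 - t)/Γ(1/2)`, the normal moment without its power
  -- of `2`.
  have hlt : Real.Gamma (1 / 2 - t) / Real.Gamma (1 / 2 - 2 * t)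
      < Real.Gamma (1 / 2) / Real.Gamma (1 / 2 - t) := by
    have := Real.Gamma_midpoint_sq_lt (x := 1 / 2 - 2 * t) (y := 1 / 2) (by linarith) (by linarith)
    rw [show (1 / 2 - 2 * t + 1 / 2) / 2 = 1 / 2 - t by ring] at this
    rw [div_lt_div_iff₀ g2 g1]
    linarith
  obtain ⟨l, hl₁, hl₂⟩ := exists_between hlt
  have hl0 : 0 < l := (div_pos g1 g2).trans hl₁
  -- The comparison order `2 t - 1/2` is negative since `t ≤ 1/8` and at most `p - 1/2` since `2 t ≤
  -- p`.
  obtain ⟨C, hC, hmom⟩ := exists_gigIntegral_sub_le (q := L.p - 1 / 2) (q' := 2 * t - 1 / 2)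
    (s := t) (lam := l) hã (by linarith) (by linarith) (by linarith) ht (by linarith) (by
      rwa [show t - (2 * t - 1 / 2) = 1 / 2 - t by ring,
        show -(2 * t - 1 / 2) = 1 / 2 - 2 * t by ring])
  set N := stdNormalAbsMoment (-(2 * t)) with hN
  have hN0 : 0 < N := stdNormalAbsMoment_pos (by linarith)
  set c₁ := l * (2 * L.σ ^ 2) ^ t with hc₁
  have hc₁0 : 0 ≤ c₁ := by positivity
  set c : Fin n → ℝ := fun i =>
    L.rho * ((L.B *ᵥ Pi.single i 1) ⬝ᵥ (L.B *ᵥ Pi.single i 1)) with hc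
  have hc0 : ∀ i, 0 ≤ c i := fun i =>
    mul_nonneg hρ.le (Finset.sum_nonneg fun j _ => mul_self_nonneg _)
  have hcoord : ∀ (V : PosOrthant n) i, ∫⁻ W, ENNReal.ofReal (W.1 i ^ (-t)) ∂(L.gibbsKernel V)
      ≤ ENNReal.ofReal (C + c₁ * ((L.σ ^ 2) ^ (-t) * (V.1 i ^ (-t) + c i ^ t) * N)) := by
    intro V i
    have hVi := V.2 i
    have hci := hc0 i
    refine lintegral_rpow_gibbsKernel_le hσ hσε hg hC hc₁0 (f := fun x => |x| ^ (-(2 * t)))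
      (by positivity) (by fun_prop) (fun x hx => ?_) (fun x hx => ?_) V i ?_
    · exact integrableOn_gigWeight_of_pos hã (by rw [hb, zero_add]; positivity)
    · have hβ : 0 < L.b + (x / L.σ) ^ 2 := by rw [hb, zero_add]; positivity
      rw [← sub_eq_add_neg]
      refine (hmom _ hβ).trans_eq ?_
      congr 1
      have e1 : ((L.b + (x / L.σ) ^ 2) / 2) ^ (-t) = (2 * L.σ ^ 2) ^ t * |x| ^ (-(2 * t)) := by
        rw [hb, zero_add, show (x / L.σ) ^ 2 / 2 = |x| ^ 2 / (2 * L.σ ^ 2) by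
          rw [sq_abs]; field_simp, Real.div_rpow (sq_nonneg _) (by positivity),
          Real.rpow_neg (by positivity : (0 : ℝ) ≤ 2 * L.σ ^ 2), div_inv_eq_mul, mul_comm,
          ← Real.rpow_two |x|, ← Real.rpow_mul (abs_nonneg x), mul_neg]
      rw [e1, hc₁]
      ring
    · refine (lintegral_abs_rpow_neg_gaussianReal_le _ (condVar_ne_zero hσ hσε V i)
        (by linarith) (by linarith)).trans ?_
      rw [coe_condVar hσ hσε, mul_div_cancel_left₀ _ two_ne_zero, ← hN]
      have hq := QBar_inv_diag_pos hρ V.2 i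
      refine ENNReal.ofReal_le_ofReal ?_
      rw [Real.mul_rpow (sq_nonneg _) hq.le]
      gcongr
      -- The inverse of the conditional variance is at most `(1/Vᵢ + cᵢ)/σ²`; subadditivity of the
      -- power `t` isolates `Vᵢ ^ (-t)` with coefficient one.
      have h1 : V.1 i / (1 + c i * V.1 i) ≤ (L.QBar V.1)⁻¹ i i := le_QBar_inv_diag hρ V.2 i
      calc _ ≤ (V.1 i / (1 + c i * V.1 i)) ^ (-t) :=
            Real.rpow_le_rpow_of_nonpos (by positivity) h1 (by linarith)
        _ = ((V.1 i)⁻¹ + c i) ^ t := by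
            rw [Real.rpow_neg (by positivity), ← Real.inv_rpow (by positivity)]
            congr 1
            field_simp
        _ ≤ (V.1 i)⁻¹ ^ t + c i ^ t :=
            Real.rpow_add_le_add_rpow (by positivity) hci ht.le (by linarith)
        _ = _ := by rw [Real.inv_rpow hVi.le, Real.rpow_neg hVi.le]
  have hcst : c₁ * (L.σ ^ 2) ^ (-t) * N = l * (Real.Gamma (1 / 2 - t) / Real.Gamma (1 / 2)) := by
    rw [hc₁, hN, stdNormalAbsMoment, show -(2 * t) / 2 = -t by ring,
      show (-(2 * t) + 1) / 2 = 1 / 2 - t by ring, Real.mul_rpow two_pos.le (sq_nonneg _),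
      Real.rpow_neg two_pos.le, Real.rpow_neg (sq_nonneg _)]
    have : 0 < (L.σ ^ 2) ^ t := by positivity
    have : 0 < (2 : ℝ) ^ t := by positivity
    field_simp
  refine ⟨c₁ * (L.σ ^ 2) ^ (-t) * N, ∑ i, (C + c₁ * (L.σ ^ 2) ^ (-t) * N * c i ^ t), ?_,
    fun V => ?_⟩
  · rw [hcst, ← mul_div_assoc, div_lt_one g0]
    rwa [lt_div_iff₀ g1] at hl₂
  · refine (sum_ofReal_le _ (fun i _ => ?_) fun i _ => hcoord V i).trans_eq ?_
    · have := V.2 i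
      have := hc0 i
      positivity
    · congr 1
      rw [Finset.mul_sum, ← Finset.sum_add_distrib]
      exact Finset.sum_congr rfl fun i _ => by ring

/-! ### The three regimes -/

theorem aTilde_eq_zero_iff (hσ : 0 < L.σ) (ha : 0 ≤ L.a) :
    L.aTilde = 0 ↔ L.a = 0 ∧ L.μ = 0 := by
  unfold aTilde
  rw [add_eq_zero_iff_of_nonneg ha (by positivity)]
  simp [hσ.ne']

theorem mixingIntegrable_of_aTilde_pos (hσ : 0 < L.σ) (hã : 0 < L.aTilde) (hb : 0 ≤ L.b) :
    L.MixingIntegrable := fun x hx => integrableOn_gigWeight_of_pos hã (by positivity)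

end LLnGM

end

theorem proposition2p7 {m n k : ℕ} (L : LLnGM m n k) (hK : IsUnit L.K.det)
    (hσ : 0 < L.σ) (hσε : 0 < L.σε) (hΨ : GIGAdmissible L.p L.a L.b) :
    (L.aTilde = 0 ↔ L.a = 0 ∧ L.μ = 0) ∧
    -- Regime (I)
    (L.a = 0 → L.μ = 0 →
      L.p < 0 ∧ 0 < L.b ∧
      (∀ x v : ℝ, L.mixingCondPDF x v =
        invGammaPDF (-L.p + 1 / 2) (L.b / 2 + x ^ 2 / (2 * L.σ ^ 2)) v) ∧
      GeometricallyErgodic L.gibbsKernel L.posterior) ∧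
    -- Regime (II)
    (L.a = 0 → 0 < L.b → L.p < 0 → L.μ ≠ 0 →
      L.aTilde = L.μ ^ 2 / L.σ ^ 2 ∧ 0 < L.aTilde ∧
      (∀ x v : ℝ, L.mixingCondPDF x v =
        gigPDF (L.p - 1 / 2) L.aTilde (L.b + (x / L.σ) ^ 2) v) ∧
      (L.NullSmallness ↔ (L.nullity = 0 ∨ ∃ U : Matrix (Fin n) (Fin L.nullity) ℝ,
        L.IsNullBasis U ∧ Real.sqrt (L.nullForm U) < 1)) ∧
      (L.NullSmallness → GeometricallyErgodic L.gibbsKernel L.posterior)) ∧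
    -- Regime (III)
    (0 < L.a → L.b = 0 → 0 < L.p →
      0 < L.aTilde ∧
      (∀ x v : ℝ, L.mixingCondPDF x v =
        gigPDF (L.p - 1 / 2) L.aTilde ((x / L.σ) ^ 2) v) ∧
      (L.NullSmallness → GeometricallyErgodic L.gibbsKernel L.posterior)) := by
  have hp := integrableOn_gigWeight hΨ
  have ha : 0 ≤ L.a := by
    rcases hΨ with h | h | h
    exacts [h.1.le, h.1.ge, h.1.le]
  refine ⟨LLnGM.aTilde_eq_zero_iff hσ ha, fun ha0 hμ => ?_, fun ha0 hb hp0 hμ => ?_,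
    fun ha0 hb hp0 => ?_⟩
  · have hbp : 0 < L.b ∧ L.p < 0 := by
      rcases hΨ with h | h | h
      exacts [absurd ha0 h.1.ne', h.2, absurd ha0 h.1.ne']
    obtain ⟨hb, hp0⟩ := hbp
    have hã : L.aTilde = 0 := (LLnGM.aTilde_eq_zero_iff hσ ha).2 ⟨ha0, hμ⟩
    have hg : L.MixingIntegrable := fun x _ => by
      rw [hã]
      exact integrableOn_gigWeight_of_pos_right (by positivity) (by linarith)
    refine ⟨hp0, hb, fun x v => ?_, ?_⟩
    · rw [← gigPDF_zero_left (by linarith) (by positivity), LLnGM.mixingCondPDF, hã]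
      congr 1
      · ring
      · field_simp
    · have hs : 0 < min (-L.p / 2) (1 / 2) := lt_min (by linarith) (by norm_num)
      exact LLnGM.geometricallyErgodic_of_moment_drift hσ hσε hp hg hs one_pos
        (LLnGM.exists_rpow_drift_of_aTilde_eq_zero hσ hσε hg hã hμ hb hs (min_le_right _ _)
          (min_le_left _ _))
        (LLnGM.exists_inv_drift_of_aTilde_eq_zero hσ hσε hg hã hp0 hb)
  · have hã' : L.aTilde = L.μ ^ 2 / L.σ ^ 2 := by rw [LLnGM.aTilde, ha0, zero_add]
    have hã : 0 < L.aTilde := by rw [hã']; positivity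
    have hg := LLnGM.mixingIntegrable_of_aTilde_pos hσ hã hb.le
    -- For `a = 0` the prefactor of the null-smallness condition is `|μ|/√(μ²) = 1`.
    have hone : |L.μ| / Real.sqrt (L.σ ^ 2 * L.a + L.μ ^ 2) = 1 := by
      rw [ha0, mul_zero, zero_add, Real.sqrt_sq_eq_abs, div_self (abs_ne_zero.2 hμ)]
    refine ⟨hã', hã, fun x v => rfl, ?_, fun hns => ?_⟩
    · simp only [LLnGM.NullSmallness, hone, one_mul]
    · exact LLnGM.geometricallyErgodic_of_moment_drift hσ hσε hp hg two_pos one_pos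
        (LLnGM.exists_sq_drift hK hσ hσε hg hã hb.le hns)
        (LLnGM.exists_inv_drift_of_aTilde_pos hσ hσε hg hã hb)
  · have hã : 0 < L.aTilde := by rw [LLnGM.aTilde]; positivity
    have hg := LLnGM.mixingIntegrable_of_aTilde_pos hσ hã hb.ge
    refine ⟨hã, fun x v => ?_, fun hns => ?_⟩
    · rw [LLnGM.mixingCondPDF, hb, zero_add]
    · have ht : 0 < min (L.p / 2) (1 / 8) := lt_min (by linarith) (by norm_num)
      exact LLnGM.geometricallyErgodic_of_moment_drift hσ hσε hp hg two_pos ht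
        (LLnGM.exists_sq_drift hK hσ hσε hg hã hb.ge hns)
        (LLnGM.exists_rpow_neg_drift hσ hσε hg hã hb ht (min_le_right _ _)
          (by linarith [min_le_left (L.p / 2) (1 / 8)]))
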